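/- **Game.** Let $N$ agents choose $x_i\in\mathbb R^{n_i}$, $n=\sum_i n_i$. Agent $i$ has the cost $\mathbb J_i(x)=\mathbb E[f_i(x,\xi)]+g_i(x_i)$, where $\xi$ is a random vector in $\mathbb R^d$ and $f_i:\mathbb R^n\times\mathbb R^d\to\mathbb R$ is measurable, and the agents share the constraint $\sum_i A_ix_i\le b:=\sum_i b_i$, with $A_i\in\mathbb R^{m\times n_i}$, $b_i\in\mathbb R^m$. Assume: - $g_i:\mathbb R^{n_i}\to\mathbb R\cup\{+\infty\}$ is convex and lower semicontinuous, and $\Omega_i=\operatorname{dom} g_i$ is nonempty and compact; put $\Omega=\prod_i\Omega_i$ and $\mathcal X=\{x\in\Omega: \sum_iA_ix_i\le b\}$. Slater's condition holds: some $x\in\Omega$ has $\sum_iA_ix_i<b$ componentwise. - $\mathbb E|f_i(x,\xi)|<\infty$ for $x\in\mathcal X$. For each $i$ there is an open convex $U_i\supseteq\Omega_i$ (for example $\mathbb R^{n_i}$) such that, for every $x\in\Omega$ and every value of $\xi$, the function $f_i(\cdot,x_{-i},\xi)$ is convex, $C^1$ and Lipschitz on $U_i$, with a Lipschitz constant $\ell_i(x_{-i},\xi)$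 that is integrable in $\xi$. - The pseudogradient $\mathbb F(x)=\operatorname{col}(\mathbb E[\nabla_{x_i}f_i(x,\xi)])_{i}$ is continuous on $\Omega$. Let $\mathrm{SOL}$ be the set of $x^*\in\mathcal X$ with $\langle\mathbb F(x^*),x-x^*\rangle+\sum_ig_i(x_i)-\sum_ig_i(x^*_i)\ge0$ for all $x\in\mathcal X$. A stochastic generalized Nash equilibrium is an $x^*\in\mathcal X$ such that $\mathbb J_i(x^*)\le\mathbb J_i(y,x^*_{-i})$ for every $i$ and every $y\in\Omega_i$ with $A_iy\le b-\sum_{j\ne i}A_jx_j^*$; it is *variational* (a v-SGNE) if also $x^*\in\mathrm{SOL}$. **Further assumptions.** - *Restricted cocoercivity:* for some $\beta>0$, $\langle\mathbb F(x)-\mathbb F(x^*),x-x^*\rangle\ge\beta\|\mathbb F(x)-\mathbb F(x^*)\|^2$ for all $x\in\Omega$, $x^*\in\mathrm{SOL}$. - *Graph:* $W=(w_{ij})$ is a symmetric weighted adjacency matrix (positive on edges, zero elsewhere) of a connected undirected graph on the agents; $d_i=\sum_jw_{ij}$, $d^*=\max_id_i$, $L=\operatorname{diag}(d_i)-W$,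 $\mathbf L=L\otimes I_m$, $\mathbf A=\operatorname{diag}(A_1,\dots,A_N)$. Fix $0<\theta\le\min\{1/(2d^*),\beta\}$ (where $1/0=+\infty$). - *Step sizes:* for some $\gamma>0$ and all $i$, $0<\alpha_i\le(\gamma+\max_j\sum_k|[A_i^\top]_{jk}|)^{-1}$, $0<\nu_i\le(\gamma+2d_i)^{-1}$, $0<\sigma_i\le(\gamma+2d_i+\max_j\sum_k|[A_i]_{jk}|)^{-1}$, and $\|\Phi^{-1}\|<2\theta$ in the spectral norm, where $$\Phi=\begin{pmatrix}\alpha^{-1}&0&-\mathbf A^\top\\0&\nu^{-1}&-\mathbf L\\-\mathbf A&-\mathbf L&\sigma^{-1}\end{pmatrix},$$ with $\alpha^{-1},\nu^{-1},\sigma^{-1}$ the block-diagonal matrices of the inverse step sizes. - *Samples:* $\xi^{(t)}_{k,i}$ ($k\ge0$, $t\ge1$, $1\le i\le N$) all have the law of $\xi$, and the vectors $(\xi^{(t)}_{k,i})_{i}$ are independent over the pairs $(k,t)$, jointly independent of the initial point. Put $F_{\mathrm{SAA}}^k(x)=\operatorname{col}\big(\frac1{S_k}\sum_{t=1}^{S_k}\nabla_{x_i}f_i(x,\xi^{(t)}_{k,i})\big)_i$.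 - *Batch size:* for some $c,k_0,a>0$, $S_k\ge c(k+k_0)^{a+1}$ for all $k\ge0$. - *Variance reduction:* there are $p\ge2$, $\sigma_1\ge0$ and a measurable, locally bounded $\sigma:\mathrm{SOL}\to\mathbb R$ such that $\mathbb E[\|F^k_{\mathrm{SAA}}(x)-\mathbb F(x)\|^p]^{1/p}\le\sigma(x^*)+\sigma_1\|x-x^*\|$ for all $k\ge0$, $x\in\Omega$ and $x^*\in\mathrm{SOL}$. **Theorem.** From any (possibly random) initial point with $x_i^0\in\Omega_i$, $z_i^0\in\mathbb R^m$, $\lambda_i^0\in\mathbb R^m_{\ge0}$, iterate $$\begin{aligned}x_i^{k+1}&=\operatorname{prox}_{\alpha_ig_i}\big[x_i^k-\alpha_i\big((F^k_{\mathrm{SAA}}(x^k))_i+A_i^\top\lambda_i^k\big)\big],\\ z_i^{k+1}&=z_i^k-\nu_i\textstyle\sum_jw_{ij}(\lambda_i^k-\lambda_j^k),\\ \lambda_i^{k+1}&=\operatorname{proj}_{\mathbb R^m_{\ge0}}\big[\lambda_i^k+\sigma_i\big(A_i(2x_i^{k+1}-x_i^k)-b_i\big)+\sigma_i\textstyle\sum_jw_{ij}\big(2(z_i^{k+1}-z_j^{k+1})-(z_i^k-z_j^k)\big)-\sigma_i\sum_jw_{ij}(\lambda_i^k-\lambda_j^k)\big],\end{aligned}$$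 where $\operatorname{prox}_{\alpha g}(v)=\operatorname{argmin}_u\{g(u)+\frac1{2\alpha}\|u-v\|^2\}$. Then, almost surely, the sequence $(x^k)_{k}$ converges to a variational stochastic generalized Nash equilibrium. -/

import Mathlib

open MeasureTheory ProbabilityTheory Filter
open scoped Matrix Topology NNReal Kronecker

noncomputable section

namespace SGNE

/-- `ℝⁿ` with its Euclidean norm. -/
abbrev Vec (n : ℕ) := EuclideanSpace ℝ (Fin n)

/-- Collective strategies `x = col(x₁, …, x_N)`, `xᵢ ∈ ℝ^{nᵢ}`, with the Euclidean norm. -/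
abbrev Profile {N : ℕ} (n : Fin N → ℕ) := PiLp 2 (fun i : Fin N => Vec (n i))

/-- The profile `(y, x_{-i})`. -/
def Profile.upd {N : ℕ} {n : Fin N → ℕ} (x : Profile n) (i : Fin N) (y : Vec (n i)) : Profile n :=
  WithLp.toLp 2 (Function.update x.ofLp i y)

/-- A matrix acting on Euclidean vectors. -/
def act {p q : ℕ} (M : Matrix (Fin p) (Fin q) ℝ) (v : Vec q) : Vec p :=
  WithLp.toLp 2 (M *ᵥ v.ofLp)

/-- The data of a stochastic generalized Nash equilibrium problem with `N` agents, affine coupling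
constraints `∑ᵢ Aᵢ xᵢ ≤ ∑ᵢ bᵢ` in `ℝᵐ`, and a random parameter in `ℝᵈ` with distribution `law`. -/
structure Game (N m d : ℕ) (n : Fin N → ℕ) where
  /-- smooth part of the sampled cost of agent `i` -/
  f : (i : Fin N) → Profile n → Vec d → ℝ
  /-- nonsmooth, extended-valued local cost of agent `i` -/
  g : (i : Fin N) → Vec (n i) → EReal
  /-- local block of the constraint matrix -/
  A : (i : Fin N) → Matrix (Fin m) (Fin (n i)) ℝ
  /-- local part of the constraint vector -/
  b : Fin N → Vec m
  /-- distribution of the random parameter -/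
  law : Measure (Vec d)

namespace Game

variable {N m d : ℕ} {n : Fin N → ℕ} (G : Game N m d n)

/-- Local decision set `Ωᵢ = dom gᵢ`. -/
def dom (i : Fin N) : Set (Vec (n i)) := {y | G.g i y < ⊤}

/-- `Ω = ∏ᵢ Ωᵢ`. -/
def domAll : Set (Profile n) := {x | ∀ i, x i ∈ G.dom i}

/-- The constraint vector `b = ∑ᵢ bᵢ`. -/
def bTot : Vec m := ∑ i, G.b i

/-- `A x = ∑ᵢ Aᵢ xᵢ`. -/
def coupling (x : Profile n) : Vec m := ∑ i, act (G.A i) (x i)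

/-- Collective feasible set `X`. -/
def feasible : Set (Profile n) := {x | x ∈ G.domAll ∧ ∀ r, G.coupling x r ≤ G.bTot r}

/-- Feasible set `Xᵢ(x_{-i})` of agent `i`. -/
def localFeasible (i : Fin N) (x : Profile n) : Set (Vec (n i)) :=
  {y | y ∈ G.dom i ∧
    ∀ r, act (G.A i) y r ≤ G.bTot r - ∑ j ∈ Finset.univ.erase i, act (G.A j) (x j) r}

/-- Expected cost `𝕁ᵢ(x) = 𝔼[fᵢ(x, ξ)] + gᵢ(xᵢ)`. -/
def cost (i : Fin N) (x : Profile n) : EReal :=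
  ((∫ ξ, G.f i x ξ ∂G.law : ℝ) : EReal) + G.g i (x i)

/-- `∇_{xᵢ} fᵢ(xᵢ, x_{-i}, ξ)`. -/
def partialGrad (i : Fin N) (x : Profile n) (ξ : Vec d) : Vec (n i) :=
  gradient (fun y => G.f i (x.upd i y) ξ) (x i)

/-- Expected pseudogradient `𝔽(x) = col(𝔼[∇_{xᵢ} fᵢ(x, ξ)])ᵢ`. -/
def pseudograd (x : Profile n) : Profile n :=
  WithLp.toLp 2 (fun i => ∫ ξ, G.partialGrad i x ξ ∂G.law)

/-- Solutions of the stochastic variational inequality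
`⟨𝔽(x*), x - x*⟩ + ∑ᵢ gᵢ(xᵢ) - ∑ᵢ gᵢ(xᵢ*) ≥ 0` for all `x ∈ X`. -/
def sol : Set (Profile n) :=
  {xs | xs ∈ G.feasible ∧ ∀ x ∈ G.feasible,
    ∑ i, G.g i (xs i) ≤ ((inner ℝ (G.pseudograd xs) (x - xs) : ℝ) : EReal) + ∑ i, G.g i (x i)}

/-- Stochastic generalized Nash equilibrium. -/
def IsSGNE (xs : Profile n) : Prop :=
  xs ∈ G.feasible ∧ ∀ i, ∀ y ∈ G.localFeasible i xs, G.cost i xs ≤ G.cost i (xs.upd i y)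

/-- Variational equilibrium: an equilibrium that solves the variational inequality. -/
def IsVSGNE (xs : Profile n) : Prop := xs ∈ G.sol ∧ G.IsSGNE xs

/-- Standing assumptions on the costs and the constraints. -/
structure Standing : Prop where
  prob : IsProbabilityMeasure G.law
  g_ne_bot : ∀ i y, G.g i y ≠ ⊥
  g_lsc : ∀ i, LowerSemicontinuous (G.g i)
  /-- convexity of `gᵢ`, through its epigraph -/
  g_convex : ∀ i, Convex ℝ {p : Vec (n i) × ℝ | G.g i p.1 ≤ (p.2 : EReal)}
  dom_nonempty : ∀ i, (G.dom i).Nonempty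
  dom_compact : ∀ i, IsCompact (G.dom i)
  /-- Slater's condition -/
  slater : ∃ x ∈ G.domAll, ∀ r, G.coupling x r < G.bTot r
  f_measurable : ∀ i, Measurable (Function.uncurry (G.f i))
  f_integrable : ∀ i, ∀ x ∈ G.feasible, Integrable (G.f i x) G.law
  /-- On an open convex neighbourhood `U` of `Ωᵢ` (possibly the whole space) the function
  `fᵢ(·, x_{-i}, ξ)` is convex, continuously differentiable and Lipschitz continuous, with a
  constant that is integrable in `ξ`. -/
  f_regular : ∀ i, ∃ U : Set (Vec (n i)), IsOpen U ∧ Convex ℝ U ∧ G.dom i ⊆ U ∧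
    ∀ x ∈ G.domAll, ∃ ell : Vec d → ℝ≥0, Integrable (fun ξ => (ell ξ : ℝ)) G.law ∧
      ∀ ξ, ConvexOn ℝ U (fun y => G.f i (x.upd i y) ξ) ∧
        ContDiffOn ℝ 1 (fun y => G.f i (x.upd i y) ξ) U ∧
        LipschitzOnWith (ell ξ) (fun y => G.f i (x.upd i y) ξ) U
  pseudograd_continuous : ContinuousOn G.pseudograd G.domAll

/-- `𝔽` is `β`-cocoercive restricted to the solution set. -/
def RestrictedCocoercive (β : ℝ) : Prop :=
  ∀ x ∈ G.domAll, ∀ xs ∈ G.sol,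
    β * ‖G.pseudograd x - G.pseudograd xs‖ ^ 2
      ≤ inner ℝ (G.pseudograd x - G.pseudograd xs) (x - xs)

end Game

/-- `W` is a weighted adjacency matrix of the undirected graph `Γ`. -/
structure IsWeightedAdj {N : ℕ} (Γ : SimpleGraph (Fin N)) (W : Matrix (Fin N) (Fin N) ℝ) :
    Prop where
  symm : W.IsSymm
  pos : ∀ i j, Γ.Adj i j → 0 < W i j
  zero : ∀ i j, ¬ Γ.Adj i j → W i j = 0

/-- Weighted degree `dᵢ = ∑ⱼ w_{ij}`. -/
def deg {N : ℕ} (W : Matrix (Fin N) (Fin N) ℝ) (i : Fin N) : ℝ := ∑ j, W i j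

/-- Laplacian `L = D - W`. -/
def lap {N : ℕ} (W : Matrix (Fin N) (Fin N) ℝ) : Matrix (Fin N) (Fin N) ℝ :=
  Matrix.diagonal (deg W) - W

/-- Step sizes `αᵢ, νᵢ, σᵢ`. -/
structure Steps (N : ℕ) where
  α : Fin N → ℝ
  ν : Fin N → ℝ
  σ : Fin N → ℝ

/-- `prox_{a g}(v)`, the minimizer of `g(u) + ‖u - v‖² / (2 a)`. -/
def prox {p : ℕ} (a : ℝ) (g : Vec p → EReal) (v : Vec p) : Vec p :=
  Classical.epsilon (fun u => ∀ w,
    g u + ((‖u - v‖ ^ 2 / (2 * a) : ℝ) : EReal) ≤ g w + ((‖w - v‖ ^ 2 / (2 * a) : ℝ) : EReal))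

/-- Projection onto the nonnegative orthant. -/
def projNonneg {p : ℕ} (v : Vec p) : Vec p := WithLp.toLp 2 (fun r => max (v r) 0)

/-- State `(x, z, λ)` of the algorithm. -/
structure State {N : ℕ} (n : Fin N → ℕ) (m : ℕ) where
  x : Profile n
  z : Fin N → Vec m
  lam : Fin N → Vec m

namespace Game

variable {N m d : ℕ} {n : Fin N → ℕ} (G : Game N m d n)

/-- `𝐀 = diag(A₁, …, A_N)`. -/
def Abold : Matrix (Fin N × Fin m) ((i : Fin N) × Fin (n i)) ℝ :=
  fun p q => if p.1 = q.1 then G.A q.1 p.2 q.2 else 0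

/-- `𝐋 = L ⊗ I_m`. -/
def Lbold (m : ℕ) (W : Matrix (Fin N) (Fin N) ℝ) : Matrix (Fin N × Fin m) (Fin N × Fin m) ℝ :=
  lap W ⊗ₖ (1 : Matrix (Fin m) (Fin m) ℝ)

/-- The preconditioning matrix
`Φ = [α⁻¹, 0, -𝐀ᵀ; 0, ν⁻¹, -𝐋; -𝐀, -𝐋, σ⁻¹]`. -/
def precond (W : Matrix (Fin N) (Fin N) ℝ) (s : Steps N) :
    Matrix (((i : Fin N) × Fin (n i)) ⊕ ((Fin N × Fin m) ⊕ (Fin N × Fin m)))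
      (((i : Fin N) × Fin (n i)) ⊕ ((Fin N × Fin m) ⊕ (Fin N × Fin m))) ℝ :=
  Matrix.fromBlocks
    (Matrix.diagonal fun q => (s.α q.1)⁻¹)
    (Matrix.fromCols 0 (-(G.Abold)ᵀ))
    (Matrix.fromRows 0 (-G.Abold))
    (Matrix.fromBlocks
      (Matrix.diagonal fun p => (s.ν p.1)⁻¹) (-Lbold m W)
      (-Lbold m W) (Matrix.diagonal fun p => (s.σ p.1)⁻¹))

/-- Bounds on the step sizes, with the parameter `γ`, and `‖Φ⁻¹‖ < 2θ` in the spectral norm. -/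
structure StepBounds (W : Matrix (Fin N) (Fin N) ℝ) (γ θ : ℝ) (s : Steps N) : Prop where
  α_pos : ∀ i, 0 < s.α i
  α_le : ∀ i, s.α i ≤ (γ + ⨆ q : Fin (n i), ∑ r : Fin m, |(G.A i)ᵀ q r|)⁻¹
  ν_pos : ∀ i, 0 < s.ν i
  ν_le : ∀ i, s.ν i ≤ (γ + 2 * deg W i)⁻¹
  σ_pos : ∀ i, 0 < s.σ i
  σ_le : ∀ i, s.σ i ≤ (γ + 2 * deg W i + ⨆ r : Fin m, ∑ q : Fin (n i), |G.A i r q|)⁻¹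
  norm_inv : ‖Matrix.toEuclideanCLM (𝕜 := ℝ) (G.precond W s)⁻¹‖ < 2 * θ

/-- One iteration of the preconditioned forward-backward algorithm, `Fh` being the approximate
pseudogradient at the current `x`. Sums over the neighbours of `i` are written over all agents,
because the other weights vanish. -/
def step (W : Matrix (Fin N) (Fin N) ℝ) (s : Steps N) (Fh : Profile n) (w : State n m) :
    State n m :=
  let x' : Profile n := WithLp.toLp 2 fun i =>
    prox (s.α i) (G.g i) (w.x i - s.α i • (Fh i + act (G.A i)ᵀ (w.lam i)))
  let z' : Fin N → Vec m := fun i =>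
    w.z i - s.ν i • ∑ j, W i j • (w.lam i - w.lam j)
  let lam' : Fin N → Vec m := fun i =>
    projNonneg (w.lam i
      + s.σ i • (act (G.A i) ((2 : ℝ) • x' i - w.x i) - G.b i)
      + s.σ i • ∑ j, W i j • ((2 : ℝ) • (z' i - z' j) - (w.z i - w.z j))
      - s.σ i • ∑ j, W i j • (w.lam i - w.lam j))
  ⟨x', z', lam'⟩

/-- Sample average approximation `F_SAA` of the pseudogradient at `x`, with batch size `S` and
samples `ξ t i`, `t < S`, for agent `i`. -/
def saa (S : ℕ) (ξ : ℕ → Fin N → Vec d) (x : Profile n) : Profile n :=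
  WithLp.toLp 2 fun i => (S : ℝ)⁻¹ • ∑ t ∈ Finset.range S, G.partialGrad i x (ξ t i)

/-- The iterates: iteration `k` has batch size `S k` and uses the samples `ξ k`. -/
def iter (W : Matrix (Fin N) (Fin N) ℝ) (s : Steps N) (S : ℕ → ℕ) (ξ : ℕ → ℕ → Fin N → Vec d)
    (w₀ : State n m) : ℕ → State n m
  | 0 => w₀
  | k + 1 => G.step W s (G.saa (S k) (ξ k) (iter W s S ξ w₀ k).x) (iter W s S ξ w₀ k)

/-- Variance reduction condition on the sample average approximations. -/
def VarianceReduction {Ξ : Type*} [MeasurableSpace Ξ] (μ : Measure Ξ) (S : ℕ → ℕ)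
    (ξ : ℕ → ℕ → Fin N → Ξ → Vec d) : Prop :=
  ∃ p : ℝ, 2 ≤ p ∧ ∃ σ₁ : ℝ, 0 ≤ σ₁ ∧ ∃ σ : G.sol → ℝ, Measurable σ ∧
    (∀ xs, ∃ C : ℝ, ∀ᶠ ys in 𝓝 xs, |σ ys| ≤ C) ∧
    ∀ k, ∀ x ∈ G.domAll, ∀ xs : G.sol,
      eLpNorm (fun ω => G.saa (S k) (fun t i => ξ k t i ω) x - G.pseudograd x)
        (ENNReal.ofReal p) μ ≤ ENNReal.ofReal (σ xs + σ₁ * ‖x - xs‖)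

end Game

end SGNE

end

/-! Attach to each agent a local multiplier `λ_i` and an auxiliary `z_i`. The KKT conditions of the
variational inequality become `0 ∈ B u + C u` for `u = (x, z, λ)`. The relation `B` (`MonotonePart`)
collects the subdifferential of `∑ g_i`, the normal cone of the orthant and the skew coupling
through `A` and `L`; the map `C` (`smoothPart`) collects `𝔽`, `Lλ` and `b`. Zeros correspond to
solutions: the kernel of `L` on a connected graph is consensus, so all agents share one multiplier
(`MonotonePart.primal_mem_sol`); conversely Slater's condition yields a multiplier, and `z`
redistributes the slack because the range of `L` is the set of zero-sum profiles
(`exists_zero_of_mem_sol`). A solution exists by Brouwer's theorem applied to a prox map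
(`exists_variational_solution`).

In the metric of `Φ` the algorithm is forward-backward splitting with error `e_k = F_SAA - 𝔽` in the
`x` block (`step_monotonePart`): the off-diagonal blocks of `Φ` cancel the implicit coupling, so
every block update is explicit. The step-size bounds make `Φ` diagonally dominant, hence positive
definite, and `‖Φ⁻¹‖ < 2θ` lets the cocoercivity of `C` relative to zeros absorb the forward step
(`forwardBackward_descent`). For every zero `w` the quantity `⟨Φ(u_k - w), u_k - w⟩` then decreases
up to `‖e_k‖²/δ - 2⟨e_k, u_k - w⟩`.

The error is paired with the old iterate `u_k`, which batch `k` does not influence. So `∑ e_k` and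
`∑ ⟨e_k, u_k⟩` are martingales. Compactness of `Ω` and variance reduction at batch zero bound the
variance of one sampled gradient uniformly; averaging gives order `1/S_k`, which is summable, and
`L²` martingale convergence applies (`ae_tendsto_sum_batchError`). Neither series involves `w`, so
one null set serves all zeros. Off it a deterministic argument (`forwardBackward_tendsto`)
concludes: cluster points are zeros by the closed graph of `B`, and Fejér monotonicity relative to a
cluster point gives convergence of the whole sequence. Finally, convexity of `f_i` in its own
variable turns solutions into equilibria (`isVSGNE_of_mem_sol`). -/

noncomputable section

namespace SGNE

/-! ### Proximal points and metric projections -/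

section ProximalPoint

variable {E : Type*} [NormedAddCommGroup E] [InnerProductSpace ℝ E]

/-- A linear bound along the unit interval forces nonnegativity of the constant term. -/
theorem nonneg_of_forall_add_mul_nonneg {D Q : ℝ} (h : ∀ t : ℝ, 0 < t → t ≤ 1 → 0 ≤ D + t * Q) :
    0 ≤ D := by
  have hc : Tendsto (fun t : ℝ => D + t * Q) (𝓝[>] 0) (𝓝 (D + 0 * Q)) :=
    (Continuous.tendsto (by fun_prop) 0).mono_left nhdsWithin_le_nhds
  rw [zero_mul, add_zero] at hc
  refine ge_of_tendsto hc ?_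
  filter_upwards [Ioc_mem_nhdsGT (zero_lt_one' ℝ)] with t ht using h t ht.1 ht.2

/-- Compare the minimizer with `(1 - t) u + t y`, divide by `t` and let `t → 0`; the quadratic
remainder has order `t`. -/
theorem prox_variational {K : Set E} (hK : Convex ℝ K) {h : E → ℝ} (hh : ConvexOn ℝ K h)
    {a : ℝ} (ha : 0 < a) {u v : E} (hu : u ∈ K)
    (hmin : ∀ w ∈ K, h u + ‖u - v‖ ^ 2 / (2 * a) ≤ h w + ‖w - v‖ ^ 2 / (2 * a))
    {y : E} (hy : y ∈ K) : h u + inner ℝ (v - u) (y - u) / a ≤ h y := by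
  have key : 0 ≤ h y - h u - inner ℝ (v - u) (y - u) / a := by
    refine nonneg_of_forall_add_mul_nonneg (Q := ‖y - u‖ ^ 2 / (2 * a)) fun t ht0 ht1 => ?_
    have hw : (1 - t) • u + t • y ∈ K := hK hu hy (by linarith) ht0.le (by ring)
    have h1 := hh.2 hu hy (by linarith : 0 ≤ 1 - t) ht0.le (by ring)
    have h2 := hmin _ hw
    have h3 : (1 - t) • u + t • y - v = (u - v) + t • (y - u) := by module
    have h4 : inner ℝ (v - u) (y - u) = - inner ℝ (u - v) (y - u) := by
      rw [← inner_neg_left, neg_sub]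
    rw [h3, norm_add_sq_real, norm_smul, inner_smul_right, Real.norm_of_nonneg ht0.le] at h2
    rw [h4]
    simp only [smul_eq_mul] at h1
    have h5 : 0 ≤ t * (h y - h u - -inner ℝ (u - v) (y - u) / a + t * (‖y - u‖ ^ 2 / (2 * a))) := by
      have : (‖u - v‖ ^ 2 + 2 * (t * inner ℝ (u - v) (y - u)) + (t * ‖y - u‖) ^ 2) / (2 * a)
          = ‖u - v‖ ^ 2 / (2 * a) + t * (inner ℝ (u - v) (y - u) / a)
            + t * (t * (‖y - u‖ ^ 2 / (2 * a))) := by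
        field_simp
      rw [this] at h2
      have e : t * (h y - h u - -inner ℝ (u - v) (y - u) / a + t * (‖y - u‖ ^ 2 / (2 * a)))
        = t * h y - t * h u + t * (inner ℝ (u - v) (y - u) / a)
          + t * (t * (‖y - u‖ ^ 2 / (2 * a))) := by ring
      rw [e]
      linarith
    exact nonneg_of_mul_nonneg_right h5 ht0
  linarith

/-- Adding the two variational inequalities cancels `h` and leaves `‖u₁ - u₂‖² ≤ ⟨v₁ - v₂, u₁ -
u₂⟩`; Cauchy–Schwarz finishes. -/
theorem prox_nonexpansive {h : E → ℝ} {a : ℝ} (ha : 0 < a) {u₁ u₂ v₁ v₂ : E}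
    (h₁ : h u₁ + inner ℝ (v₁ - u₁) (u₂ - u₁) / a ≤ h u₂)
    (h₂ : h u₂ + inner ℝ (v₂ - u₂) (u₁ - u₂) / a ≤ h u₁) : ‖u₁ - u₂‖ ≤ ‖v₁ - v₂‖ := by
  have h3 : inner ℝ (v₁ - u₁) (u₂ - u₁) + inner ℝ (v₂ - u₂) (u₁ - u₂) ≤ 0 := by
    have : (inner ℝ (v₁ - u₁) (u₂ - u₁) + inner ℝ (v₂ - u₂) (u₁ - u₂)) / a ≤ 0 := by
      rw [add_div]; linarith
    by_contra hc
    push Not at hc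
    exact absurd this (not_le.2 (div_pos hc ha))
  have h4 : inner ℝ (v₁ - u₁) (u₂ - u₁) + inner ℝ (v₂ - u₂) (u₁ - u₂)
      = inner ℝ (u₁ - u₂) (u₁ - u₂) - inner ℝ (v₁ - v₂) (u₁ - u₂) := by
    have : u₂ - u₁ = -(u₁ - u₂) := by abel
    rw [this, inner_neg_right, ← sub_eq_neg_add, ← inner_sub_left, ← inner_sub_left]
    congr 1; abel
  rw [h4, real_inner_self_eq_norm_sq] at h3
  have h5 := real_inner_le_norm (v₁ - v₂) (u₁ - u₂)
  by_contra hc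
  push Not at hc
  nlinarith [norm_nonneg (v₁ - v₂)]

omit [InnerProductSpace ℝ E] in
theorem exists_prox {K : Set E} (hK : IsCompact K) (hne : K.Nonempty) {h : E → ℝ}
    (hh : LowerSemicontinuousOn h K) (a : ℝ) (v : E) :
    ∃ u ∈ K, ∀ w ∈ K, h u + ‖u - v‖ ^ 2 / (2 * a) ≤ h w + ‖w - v‖ ^ 2 / (2 * a) := by
  have hc : LowerSemicontinuousOn (fun u => h u + ‖u - v‖ ^ 2 / (2 * a)) K :=
    hh.add ((by fun_prop : Continuous fun u : E => ‖u - v‖ ^ 2 /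
      (2 * a)).lowerSemicontinuous.lowerSemicontinuousOn K)
  obtain ⟨u, hu, hm⟩ := hc.exists_isMinOn hne hK
  exact ⟨u, hu, fun w hw => isMinOn_iff.1 hm w hw⟩

/-- Metric projection on a compact convex set, as a nonexpansive retraction. -/
theorem exists_convex_retraction {K : Set E} (hK : IsCompact K) (hconv : Convex ℝ K)
    (hne : K.Nonempty) :
    ∃ P : E → E, LipschitzWith 1 P ∧ (∀ v, P v ∈ K) ∧ (∀ v ∈ K, P v = v) ∧
      ∀ v, ∀ y ∈ K, inner ℝ (v - P v) (y - P v) ≤ 0 := by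
  have h0 : ConvexOn ℝ K (fun _ : E => (0 : ℝ)) := convexOn_const 0 hconv
  choose P hPK hP using fun v => exists_prox hK hne
    (h := fun _ => (0 : ℝ)) (continuousOn_const.lowerSemicontinuousOn) 1 v
  have hv : ∀ v, ∀ y ∈ K, inner ℝ (v - P v) (y - P v) ≤ 0 := fun v y hy => by
    simpa using prox_variational hconv h0 one_pos (hPK v) (hP v) hy
  refine ⟨P, LipschitzWith.of_dist_le_mul fun x y => ?_, hPK, fun v hvK => ?_, hv⟩
  · rw [NNReal.coe_one, one_mul, dist_eq_norm, dist_eq_norm]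
    exact prox_nonexpansive (h := fun _ => 0) one_pos
      (by simpa using hv x _ (hPK y)) (by simpa using hv y _ (hPK x))
  · have := hv v v hvK
    rw [real_inner_self_eq_norm_sq] at this
    have h2 : ‖v - P v‖ = 0 := by nlinarith [norm_nonneg (v - P v)]
    exact (sub_eq_zero.1 (norm_eq_zero.1 h2)).symm

end ProximalPoint

/-! ### Brouwer's theorem by the volume-polynomial argument, and variational inequalities -/

section Brouwer

/-- `det (1 + t M)` is determined by its values at `dim + 1` nodes, with universal coefficients. -/
theorem exists_det_interpolation {E : Type*} [NormedAddCommGroup E] [NormedSpace ℝ E]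
    [FiniteDimensional ℝ E] (τ : Fin (Module.finrank ℝ E + 1) → ℝ) (hτ : Function.Injective τ)
    (t : ℝ) :
    ∃ l : Fin (Module.finrank ℝ E + 1) → ℝ, ∑ i, l i = 1 ∧
      ∀ M : E →L[ℝ] E, (1 + t • M).det = ∑ i, l i * (1 + τ i • M).det := by
  classical
  -- The weights depend on the nodes and on `t`, not on `M`, so they can later be taken out of an
  -- integral in which `M` varies with the point.
  refine ⟨fun i => (Lagrange.basis Finset.univ τ i).eval t, ?_, fun M => ?_⟩
  · rw [← Polynomial.eval_finsetSum, Lagrange.sum_basis hτ.injOn Finset.univ_nonempty,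
      Polynomial.eval_one]
  · let b := Module.finBasis ℝ E
    let A := LinearMap.toMatrix b b (M : E →ₗ[ℝ] E)
    let q : Polynomial ℝ := Matrix.det ((Polynomial.X : Polynomial ℝ) • A.map Polynomial.C
      + (1 : Matrix _ _ ℝ).map Polynomial.C)
    have hq : ∀ s : ℝ, q.eval s = (1 + s • M).det := by
      intro s
      have h1 : (1 + s • M).det = Matrix.det (1 + s • A) := by
        rw [ContinuousLinearMap.det, ← LinearMap.det_toMatrix b]
        congr 1
        rw [ContinuousLinearMap.toLinearMap_add, map_add, ContinuousLinearMap.toLinearMap_smul,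
          map_smul]
        congr 1
        exact LinearMap.toMatrix_one b
      rw [h1]
      change (Polynomial.evalRingHom s) (Matrix.det _) = _
      rw [RingHom.map_det]
      congr 1
      ext i j
      simp only [RingHom.mapMatrix_apply, Matrix.map_apply, Matrix.add_apply, Matrix.smul_apply,
        smul_eq_mul, Polynomial.coe_evalRingHom, Polynomial.eval_add, Polynomial.eval_mul,
        Polynomial.eval_X, Polynomial.eval_C]
      exact add_comm _ _
    have hdeg : q.degree < (Finset.univ : Finset (Fin (Module.finrank ℝ E + 1))).card := by
      refine lt_of_le_of_lt Polynomial.degree_le_natDegree ?_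
      have := Polynomial.natDegree_det_X_add_C_le A (1 : Matrix _ _ ℝ)
      rw [Finset.card_univ, Fintype.card_fin]
      rw [Fintype.card_fin] at this
      exact_mod_cast Nat.lt_succ_of_le this
    have h2 := Lagrange.eq_interpolate hτ.injOn hdeg
    rw [← hq t, h2, Lagrange.interpolate_apply, Polynomial.eval_finsetSum]
    refine Finset.sum_congr rfl fun i _ => ?_
    rw [Polynomial.eval_mul, Polynomial.eval_C, hq, mul_comm]

variable {E : Type*} [NormedAddCommGroup E]

/-- A perturbation of the identity by a strict contraction that vanishes off a set preserves
that set. -/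
theorem image_id_add_contraction [NormedSpace ℝ E] [CompleteSpace E] {U : Set E} {p : E → E}
    {k : ℝ≥0} (hk : k < 1) (hp : LipschitzWith k p) (h0 : ∀ x ∉ U, p x = 0) :
    Function.Injective (fun x => x + p x) ∧ (fun x => x + p x) '' U = U := by
  have hinj : Function.Injective (fun x => x + p x) := by
    intro x y hxy
    have h1 : x - y = p y - p x := by
      have : x + p x = y + p y := hxy
      rw [sub_eq_sub_iff_add_eq_add, this, add_comm]
    have h2 := hp.dist_le_mul y x
    rw [dist_eq_norm, dist_eq_norm, ← h1, norm_sub_rev y x] at h2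
    have h3 : (k : ℝ) < 1 := by exact_mod_cast hk
    have h4 : ‖x - y‖ = 0 := by nlinarith [norm_nonneg (x - y)]
    exact sub_eq_zero.1 (norm_eq_zero.1 h4)
  refine ⟨hinj, Set.Subset.antisymm ?_ fun y hy => ?_⟩
  · rintro _ ⟨x, hx, rfl⟩
    -- If the image of `x` left `U`, it would be fixed by the map; injectivity then makes it equal
    -- to `x ∈ U`.
    by_contra hc
    have h1 : (x + p x) + p (x + p x) = x + p x := by rw [h0 _ hc, add_zero]
    have h2 : x + p x = x := hinj h1
    exact hc (by change x + p x ∈ U; rw [h2]; exact hx)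
  -- Preimages of `y` are the fixed points of the contraction `x ↦ y - p x`.
  · have hcon : ContractingWith k (fun x => y - p x) := by
      refine ⟨hk, LipschitzWith.of_dist_le_mul fun a b => ?_⟩
      rw [dist_sub_left]
      exact hp.dist_le_mul a b
    have hfix : y - p (hcon.fixedPoint _) = hcon.fixedPoint _ := hcon.fixedPoint_isFixedPt
    have hval : hcon.fixedPoint _ + p (hcon.fixedPoint _) = y := by
      rw [← sub_eq_iff_eq_add.1 hfix]
    refine ⟨hcon.fixedPoint _, ?_, hval⟩
    by_contra hc
    rw [h0 _ hc, add_zero] at hval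
    exact hc (by rw [hval]; exact hy)

/-- `det (1 + t M)` stays positive while `t M` is a strict contraction. -/
theorem det_one_add_smul_pos [NormedSpace ℝ E] [FiniteDimensional ℝ E] {M : E →L[ℝ] E} {t : ℝ}
    (ht : 0 ≤ t) (hM : t * ‖M‖ < 1) : 0 < (1 + t • M).det := by
  -- A kernel vector would satisfy `‖v‖ ≤ s‖M‖‖v‖ < ‖v‖`. So the determinant has no zero on `[0,
  -- t]`, and it equals 1 at 0.
  have hne : ∀ s ∈ Set.Icc 0 t, (1 + s • M).det ≠ 0 := by
    intro s hs h0
    have hnu : LinearMap.ker ((1 + s • M : E →L[ℝ] E) : E →ₗ[ℝ] E) ≠ ⊥ := by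
      intro hb
      have := LinearMap.isUnit_iff_ker_eq_bot _ |>.2 hb
      exact (LinearMap.isUnit_det _ this).ne_zero h0
    obtain ⟨v, hv, hv0⟩ := (Submodule.ne_bot_iff _).1 hnu
    have h1 : v = -(s • M v) := by
      have : v + s • M v = 0 := by simpa using hv
      exact eq_neg_of_add_eq_zero_left this
    have h2 : ‖v‖ ≤ s * (‖M‖ * ‖v‖) := by
      calc ‖v‖ = ‖s • M v‖ := by conv_lhs => rw [h1, norm_neg]
        _ ≤ s * (‖M‖ * ‖v‖) := by
          rw [norm_smul, Real.norm_of_nonneg hs.1]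
          exact mul_le_mul_of_nonneg_left (M.le_opNorm v) hs.1
    have h3 : 0 < ‖v‖ := norm_pos_iff.2 hv0
    have h4 : s * ‖M‖ < 1 := lt_of_le_of_lt (mul_le_mul_of_nonneg_right hs.2 (norm_nonneg M)) hM
    nlinarith
  have hcont : ContinuousOn (fun s : ℝ => (1 + s • M).det) (Set.Icc 0 t) :=
    (ContinuousLinearMap.continuous_det.comp (by fun_prop)).continuousOn
  by_contra hc
  push Not at hc
  have hmem : (0 : ℝ) ∈ Set.Icc ((1 + t • M).det) ((1 + (0 : ℝ) • M).det) := by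
    refine ⟨hc, ?_⟩
    rw [zero_smul, add_zero]
    simp [ContinuousLinearMap.det, ContinuousLinearMap.one_def]
  obtain ⟨s, hs, hs0⟩ := intermediate_value_Icc' ht hcont hmem
  exact hne s hs hs0

/-- The closed unit ball has no continuously differentiable retraction onto its sphere. -/
theorem no_smooth_retraction [InnerProductSpace ℝ E] [FiniteDimensional ℝ E] {r : E → E}
    (hr : ∀ x ∈ Metric.closedBall (0 : E) 1, ContDiffAt ℝ 1 r x)
    (hn : ∀ x ∈ Metric.closedBall (0 : E) 1, ‖r x‖ = 1) (hb : ∀ x, ‖x‖ = 1 → r x = x) : False := by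
  borelize E
  set B : Set E := Metric.closedBall 0 1
  set U : Set E := Metric.ball 0 1
  have hUB : U ⊆ B := Metric.ball_subset_closedBall
  have hBc : IsCompact B := isCompact_closedBall 0 1
  set g : E → E := fun x => r x - x
  have hg : ∀ x ∈ B, ContDiffAt ℝ 1 g x := fun x hx => (hr x hx).sub contDiffAt_id
  set D : E → E →L[ℝ] E := fderiv ℝ g
  have hgD : ∀ x ∈ B, HasFDerivAt g (D x) x := fun x hx =>
    ((hg x hx).differentiableAt one_ne_zero).hasFDerivAt
  have hDc : ContinuousOn D B := fun x hx =>
    (((hg x hx).fderiv_right (m := 0) (by norm_num)).continuousAt).continuousWithinAt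
  obtain ⟨K, hK⟩ := hBc.exists_bound_of_continuousOn hDc
  have hK0 : 0 ≤ K := (norm_nonneg _).trans (hK 0 (by simp [B]))
  obtain ⟨P, hPl, hPB, hPid, hPv⟩ := exists_convex_retraction hBc (convex_closedBall 0 1)
    ⟨0, Metric.mem_closedBall_self zero_le_one⟩
  have hPs : ∀ x ∉ U, ‖P x‖ = 1 := by
    intro x hx
    have hx1 : 1 ≤ ‖x‖ := by simpa [U, Metric.mem_ball] using hx
    have hx0 : 0 < ‖x‖ := by linarith
    have hp1 : ‖P x‖ ≤ 1 := mem_closedBall_zero_iff.1 (hPB x)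
    rcases hx1.eq_or_lt with h | h
    · rw [hPid x (by simp [B, ← h]), ← h]
    · have hv := hPv x (‖x‖⁻¹ • x) (by simp [B, norm_smul, hx0.ne'])
      have e : inner ℝ (x - P x) (‖x‖⁻¹ • x - P x)
          = ‖x‖ - inner ℝ x (P x) - ‖x‖⁻¹ * inner ℝ x (P x) + ‖P x‖ ^ 2 := by
        rw [inner_sub_left, inner_sub_right, inner_sub_right, inner_smul_right, inner_smul_right,
          real_inner_self_eq_norm_sq, real_inner_self_eq_norm_sq, real_inner_comm x (P x)]
        field_simp
        ring
      rw [e] at hv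
      have h1 := real_inner_le_norm x (P x)
      have h2 : ‖x‖⁻¹ * inner ℝ x (P x) ≤ ‖P x‖ := by
        rw [inv_mul_le_iff₀ hx0]; exact h1
      nlinarith [norm_nonneg (P x)]
  -- Points outside the open ball project to the sphere, where `g` vanishes. Thus `p` extends `g` by
  -- zero and remains globally `K`-Lipschitz.
  set p : E → E := fun x => g (P x)
  have hp0 : ∀ x ∉ U, p x = 0 := fun x hx => by
    simp only [p, g]; rw [hb _ (hPs x hx), sub_self]
  have hpl : ∀ x y, ‖p x - p y‖ ≤ K * ‖x - y‖ := by
    intro x y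
    have h1 := (convex_closedBall (0 : E) 1).norm_image_sub_le_of_norm_hasFDerivWithin_le
      (fun z hz => (hgD z hz).hasFDerivWithinAt) hK (hPB y) (hPB x)
    refine h1.trans (mul_le_mul_of_nonneg_left ?_ hK0)
    have := hPl.dist_le_mul x y
    simpa [dist_eq_norm] using this
  have hpg : ∀ x ∈ U, p x = g x := fun x hx => by simp only [p]; rw [hPid x (hUB hx)]
  have hdetc : ∀ t : ℝ, ContinuousOn (fun x => (1 + t • D x).det) B := fun t =>
    ContinuousLinearMap.continuous_det.comp_continuousOn
      (continuousOn_const.add (hDc.const_smul t))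
  have hint : ∀ t : ℝ, IntegrableOn (fun x => (1 + t • D x).det) U := fun t =>
    ((hdetc t).integrableOn_compact hBc).mono_set hUB
  -- For small `t` the map `x + t p x` is a bijection of the ball with positive Jacobian, so the
  -- change of variables formula gives the volume of the ball.
  have hvol : ∀ t : ℝ, 0 ≤ t → t * (K + 1) ≤ 1 / 2 →
      ∫ x in U, (1 + t • D x).det = (volume U).toReal := by
    intro t ht htK
    have htK' : t * K < 1 := by nlinarith
    have hlip : LipschitzWith (t * K).toNNReal (fun x => t • p x) := by
      refine LipschitzWith.of_dist_le_mul fun x y => ?_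
      rw [Real.coe_toNNReal _ (mul_nonneg ht hK0), dist_eq_norm, dist_eq_norm, ← smul_sub,
        norm_smul, Real.norm_of_nonneg ht, mul_assoc]
      exact mul_le_mul_of_nonneg_left (hpl x y) ht
    obtain ⟨hinj, himg⟩ := image_id_add_contraction (U := U)
      (by rw [Real.toNNReal_lt_one]; exact htK') hlip (fun x hx => by simp [hp0 x hx])
    have hder : ∀ x ∈ U, HasFDerivWithinAt (fun x => x + t • p x) (1 + t • D x) U x := by
      intro x hx
      have h1 : HasFDerivAt (fun x => x + t • g x) (1 + t • D x) x :=
        (hasFDerivAt_id x).add ((hgD x (hUB hx)).const_smul t)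
      exact h1.hasFDerivWithinAt.congr (fun y hy => by rw [hpg y hy]) (by rw [hpg x hx])
    have hpos : ∀ x ∈ U, 0 < (1 + t • D x).det := fun x hx =>
      det_one_add_smul_pos ht
        (lt_of_le_of_lt (mul_le_mul_of_nonneg_left (hK x (hUB hx)) ht) htK')
    have hcv := lintegral_abs_det_fderiv_eq_addHaar_image volume
      (Metric.isOpen_ball.measurableSet) hder hinj.injOn
    rw [himg] at hcv
    rw [integral_eq_lintegral_of_nonneg_ae, ← hcv]
    · congr 1
      refine setLIntegral_congr_fun Metric.isOpen_ball.measurableSet fun x hx => ?_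
      rw [abs_of_pos (hpos x hx)]
    · filter_upwards [ae_restrict_mem Metric.isOpen_ball.measurableSet] with x hx using
        (hpos x hx).le
    · exact (hint t).aestronglyMeasurable
  -- All `dim + 1` nodes `i δ` lie in the range of small `t`; `K + 1` in place of `K` keeps the
  -- quotient meaningful when `K = 0`.
  set δ : ℝ := 1 / (2 * (K + 1) * (Module.finrank ℝ E + 1))
  have hδ : 0 < δ := by positivity
  let τ : Fin (Module.finrank ℝ E + 1) → ℝ := fun i => i * δ
  have hτ : Function.Injective τ := fun i j hij => by
    have : (i : ℝ) = j := mul_right_cancel₀ hδ.ne' hij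
    exact Fin.ext (by exact_mod_cast this)
  obtain ⟨l, hl1, hl⟩ := exists_det_interpolation (E := E) τ hτ 1
  -- The integral is a polynomial in `t` of degree at most `dim`, constant at `dim + 1` nodes, hence
  -- also constant up to `t = 1`.
  have hone : ∫ x in U, (1 + (1 : ℝ) • D x).det = (volume U).toReal := by
    simp_rw [hl]
    rw [integral_finsetSum _ fun i _ => (hint (τ i)).const_mul (l i)]
    have : ∀ i, ∫ x in U, l i * (1 + τ i • D x).det = l i * (volume U).toReal := by
      intro i
      rw [integral_const_mul, hvol (τ i) (by positivity)]
      have hi : (i : ℝ) ≤ Module.finrank ℝ E + 1 := by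
        have := i.2.le
        exact_mod_cast this
      have : (i : ℝ) * δ * (K + 1) = (i / (Module.finrank ℝ E + 1)) * (1 / 2) := by
        simp only [δ]; field_simp
      change (i : ℝ) * δ * (K + 1) ≤ 1 / 2
      rw [this]
      have : (i : ℝ) / (Module.finrank ℝ E + 1) ≤ 1 := (div_le_one (by positivity)).2 hi
      linarith
    simp_rw [this]
    rw [← Finset.sum_mul, hl1, one_mul]
  -- At `t = 1` the derivative is that of `r`. Were it invertible, some direction would be sent to
  -- `r x`, and `‖r‖²` would have derivative 2 there, although it is constant.
  have hzero : ∀ x ∈ U, (1 + (1 : ℝ) • D x).det = 0 := by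
    intro x hx
    by_contra hne
    have hrx : HasFDerivAt r (1 + (1 : ℝ) • D x) x := by
      have h1 : HasFDerivAt (fun x => x + g x) (1 + D x) x :=
        (hasFDerivAt_id x).add (hgD x (hUB hx))
      rw [one_smul]
      exact h1.congr_of_eventuallyEq (Eventually.of_forall fun y => by simp [g])
    have hconst : (fun y => ‖r y‖ ^ 2) =ᶠ[𝓝 x] fun _ => 1 := by
      filter_upwards [Metric.isOpen_ball.mem_nhds hx] with y hy
      rw [hn y (hUB hy), one_pow]
    have h0 := (hrx.norm_sq.congr_of_eventuallyEq hconst.symm).unique (hasFDerivAt_const 1 x)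
    let e := LinearMap.equivOfDetNeZero _ hne
    have hv := congrArg (fun A : E →L[ℝ] ℝ => A (e.symm (r x))) h0
    have he : (1 + (1 : ℝ) • D x) (e.symm (r x)) = r x := e.apply_symm_apply (r x)
    simp only [smul_apply, ContinuousLinearMap.comp_apply, he,
      innerSL_apply_apply, real_inner_self_eq_norm_sq, hn x (hUB hx),
      zero_apply] at hv
    norm_num at hv
  rw [setIntegral_congr_fun Metric.isOpen_ball.measurableSet (g := fun _ => (0 : ℝ)) hzero,
    integral_zero] at hone
  have hpos : 0 < (volume U).toReal :=
    ENNReal.toReal_pos (Metric.measure_ball_pos volume _ one_pos).ne' measure_ball_lt_top.ne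
  exact hpos.ne hone

/-- A smooth map of norm less than one has a fixed point in the closed unit ball. -/
theorem exists_fixedPoint_of_contDiff [InnerProductSpace ℝ E] [FiniteDimensional ℝ E] {g : E → E}
    (hg : ContDiff ℝ 1 g) (hg1 : ∀ x, ‖g x‖ < 1) : ∃ x, ‖x‖ ≤ 1 ∧ g x = x := by
  by_contra hc
  push Not at hc
  set u : E → E := fun x => x - g x
  have hu : ContDiff ℝ 1 u := contDiff_id.sub hg
  have hu0 : ∀ x, ‖x‖ ≤ 1 → 0 < ‖u x‖ := fun x hx =>
    norm_pos_iff.2 (sub_ne_zero.2 (hc x hx).symm)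
  -- This is a quarter of the discriminant of `‖x + t u‖² = 1` in `t`. The retraction follows the
  -- ray from `g x` through `x` to the sphere, so `t` below is the larger root; on the sphere `⟨x,
  -- u⟩ > 0` makes that root zero.
  set Δ : E → ℝ := fun x => (inner ℝ x (u x)) ^ 2 + ‖u x‖ ^ 2 * (1 - ‖x‖ ^ 2)
  have hiu : ∀ x, ‖x‖ = 1 → 0 < inner ℝ x (u x) := fun x hx => by
    have h1 := real_inner_le_norm x (g x)
    rw [hx, one_mul] at h1
    simp only [u]
    rw [inner_sub_right, real_inner_self_eq_norm_sq, hx]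
    linarith [hg1 x]
  have hΔ : ∀ x, ‖x‖ ≤ 1 → 0 < Δ x := fun x hx => by
    rcases hx.lt_or_eq with h | h
    · have h1 : 0 < 1 - ‖x‖ ^ 2 := by nlinarith [norm_nonneg x]
      have h2 := pow_pos (hu0 x hx) 2
      simp only [Δ]
      positivity
    · have := hiu x h
      simp only [Δ, h]
      norm_num
      exact pow_pos this 2
  set t : E → ℝ := fun x => (-inner ℝ x (u x) + √(Δ x)) / ‖u x‖ ^ 2
  refine no_smooth_retraction (r := fun x => x + t x • u x) (fun x hx => ?_) (fun x hx => ?_)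
    (fun x hx => ?_)
  · have hx1 : ‖x‖ ≤ 1 := mem_closedBall_zero_iff.1 hx
    have hin : ContDiff ℝ 1 fun x => inner ℝ x (u x) := contDiff_id.inner ℝ hu
    have hun : ContDiff ℝ 1 fun x => ‖u x‖ ^ 2 := hu.norm_sq ℝ
    have hΔc : ContDiff ℝ 1 Δ :=
      (hin.pow 2).add (hun.mul (contDiff_const.sub (contDiff_id.norm_sq ℝ)))
    have ht : ContDiffAt ℝ 1 t x :=
      (hin.neg.contDiffAt.add (hΔc.contDiffAt.sqrt (hΔ x hx1).ne')).div hun.contDiffAt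
        (pow_pos (hu0 x hx1) 2).ne'
    exact contDiffAt_id.add (ht.smul hu.contDiffAt)
  · have hx1 : ‖x‖ ≤ 1 := mem_closedBall_zero_iff.1 hx
    have hn := hu0 x hx1
    have hs := Real.sq_sqrt (hΔ x hx1).le
    have hsq : ‖x + t x • u x‖ ^ 2 = 1 := by
      rw [norm_add_sq_real, inner_smul_right, norm_smul, mul_pow, Real.norm_eq_abs, sq_abs]
      simp only [t]
      generalize √(Δ x) = s at hs
      simp only [Δ] at hs
      field_simp
      linear_combination hs
    exact (sq_eq_sq₀ (norm_nonneg _) zero_le_one).1 (by rw [hsq, one_pow])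
  · have : t x = 0 := by
      simp only [t, Δ, hx]
      norm_num
      rw [Real.sqrt_sq (hiu x hx).le]
      simp
    simp [this]

/-- **Brouwer's fixed point theorem** for compact convex sets. -/
theorem brouwer [InnerProductSpace ℝ E] [FiniteDimensional ℝ E] {K : Set E} (hK : IsCompact K)
    (hconv : Convex ℝ K) (hne : K.Nonempty) {T : E → E} (hT : ContinuousOn T K)
    (hTK : Set.MapsTo T K K) : ∃ x ∈ K, T x = x := by
  by_contra hc
  push Not at hc
  obtain ⟨P, hPl, hPK, hPid, -⟩ := exists_convex_retraction hK hconv hne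
  obtain ⟨C, hC⟩ := hK.exists_bound_of_continuousOn continuousOn_id
  -- Scaling by `R` brings the values of `T ∘ P` into the ball of radius 1/2, which leaves room for
  -- a smooth approximation of norm below 1.
  set R : ℝ := 2 * (|C| + 1)
  have hR : 0 < R := by positivity
  have hTR : ∀ x, ‖T (P x)‖ ≤ R / 2 := fun x => by
    have := hC _ (hTK (hPK x))
    simp only [id] at this
    simp only [R]
    linarith [le_abs_self C]
  have hTu : UniformContinuous fun x => T (P x) := by
    have h1 := Metric.uniformContinuousOn_iff.1 (hK.uniformContinuousOn_of_continuous hT)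
    rw [Metric.uniformContinuous_iff]
    intro ε hε
    obtain ⟨δ, hδ, h⟩ := h1 ε hε
    refine ⟨δ, hδ, fun {a b} hab => h _ (hPK a) _ (hPK b) (lt_of_le_of_lt ?_ hab)⟩
    simpa using hPl.dist_le_mul a b
  set Q : E → E := fun x => R⁻¹ • T (P (R • x))
  have hQu : UniformContinuous Q :=
    (uniformContinuous_const_smul R⁻¹).comp (hTu.comp (uniformContinuous_const_smul R))
  have hQn : ∀ x, ‖Q x‖ ≤ 1 / 2 := fun x => by
    simp only [Q]
    rw [norm_smul, norm_inv, Real.norm_of_nonneg hR.le, inv_mul_le_iff₀ hR]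
    linarith [hTR (R • x)]
  have hQf : ∀ x, Q x ≠ x := fun x hx => by
    have h1 : T (P (R • x)) = R • x := by
      conv_rhs => rw [← hx]
      simp only [Q]
      rw [smul_smul, mul_inv_cancel₀ hR.ne', one_smul]
    have h2 : R • x ∈ K := h1 ▸ hTK (hPK _)
    rw [hPid _ h2] at h1
    exact hc _ h2 h1
  obtain ⟨x₀, -, hx₀⟩ := (isCompact_closedBall (0 : E) 1).exists_isMinOn
    ⟨0, Metric.mem_closedBall_self zero_le_one⟩
    (f := fun x => ‖Q x - x‖) (hQu.continuous.sub continuous_id).norm.continuousOn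
  have hδ : 0 < ‖Q x₀ - x₀‖ := norm_pos_iff.2 (sub_ne_zero.2 (hQf x₀))
  -- Error 1/2 keeps `‖g‖ < 1`; error half the minimal displacement of `Q` on the ball contradicts
  -- the fixed point of `g`.
  obtain ⟨g, hg, hgQ⟩ := hQu.exists_contDiff_dist_le (lt_min (half_pos hδ) one_half_pos)
  obtain ⟨x, hx1, hx⟩ := exists_fixedPoint_of_contDiff (hg.of_le (by exact_mod_cast le_top))
    (fun x => by
      have h1 := hgQ x
      rw [dist_eq_norm] at h1
      have h2 := norm_sub_norm_le (g x) (Q x)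
      linarith [hQn x, min_le_right (‖Q x₀ - x₀‖ / 2) (1 / 2)])
  have h1 := isMinOn_iff.1 hx₀ x (mem_closedBall_zero_iff.2 hx1)
  have h2 := hgQ x
  rw [hx, dist_comm, dist_eq_norm] at h2
  linarith [min_le_left (‖Q x₀ - x₀‖ / 2) (1 / 2)]

/-- Existence of solutions of mixed variational inequalities over compact convex sets. -/
theorem exists_variational_solution [InnerProductSpace ℝ E] [FiniteDimensional ℝ E] {K : Set E}
    (hK : IsCompact K) (hne : K.Nonempty) {h : E → ℝ} (hh : ConvexOn ℝ K h)
    (hl : LowerSemicontinuousOn h K) {F : E → E} (hF : ContinuousOn F K) :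
    ∃ x ∈ K, ∀ y ∈ K, h x ≤ inner ℝ (F x) (y - x) + h y := by
  choose p hpK hp using fun v => exists_prox hK hne hl 1 v
  have hv : ∀ v, ∀ y ∈ K, h (p v) + inner ℝ (v - p v) (y - p v) / 1 ≤ h y := fun v y hy =>
    prox_variational hh.1 hh one_pos (hpK v) (hp v) hy
  have hpc : LipschitzWith 1 p := LipschitzWith.of_dist_le_mul fun x y => by
    rw [NNReal.coe_one, one_mul, dist_eq_norm, dist_eq_norm]
    exact prox_nonexpansive one_pos (hv x _ (hpK y)) (hv y _ (hpK x))
  -- A fixed point of `x ↦ prox(x - F x)` solves the variational inequality, by the inequality that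
  -- characterizes the prox.
  obtain ⟨x, hx, hfix⟩ := brouwer hK hh.1 hne (T := fun x => p (x - F x))
    (hpc.continuous.comp_continuousOn (continuousOn_id.sub hF)) (fun x _ => hpK _)
  refine ⟨x, hx, fun y hy => ?_⟩
  have h1 := hv (x - F x) y hy
  change p (x - F x) = x at hfix
  rw [hfix, div_one, sub_sub_cancel_left, inner_neg_left] at h1
  linarith

end Brouwer

/-! ### Lagrange multipliers by separation -/

section Multipliers

/-- Lagrange multipliers for a convex program satisfying Slater's condition. -/
theorem exists_multiplier {E ι : Type*} [AddCommGroup E] [Module ℝ E] [Fintype ι] {K : Set E}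
    {h : E → ℝ} (hh : ConvexOn ℝ K h) {c : E → ι → ℝ} (hc : ∀ r, ConvexOn ℝ K fun x => c x r)
    {x₀ : E} (hx₀ : x₀ ∈ K) (hsl : ∀ r, c x₀ r < 0) {xs : E} (hxs : xs ∈ K)
    (hcs : ∀ r, c xs r ≤ 0) (hmin : ∀ x ∈ K, (∀ r, c x r ≤ 0) → h xs ≤ h x) :
    ∃ l : ι → ℝ, (∀ r, 0 ≤ l r) ∧ ∑ r, l r * c xs r = 0 ∧
      ∀ x ∈ K, h xs ≤ h x + ∑ r, l r * c x r := by
  classical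
  -- Constraint levels and cost gaps strictly dominated by some point of `K`. Optimality of `xs`
  -- keeps the origin out of this open convex set.
  set s : Set ((ι → ℝ) × ℝ) := {p | ∃ x ∈ K, (∀ r, c x r < p.1 r) ∧ h x - h xs < p.2}
  have hso : IsOpen s := by
    have : s = ⋃ x ∈ K, {p : (ι → ℝ) × ℝ | (∀ r, c x r < p.1 r) ∧ h x - h xs < p.2} := by
      ext p
      simp only [s, Set.mem_iUnion, exists_prop]
      exact Iff.rfl
    rw [this]
    refine isOpen_biUnion fun x _ => IsOpen.and ?_ (isOpen_lt continuous_const continuous_snd)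
    simp only [Set.ofPred_forall]
    exact isOpen_iInter_of_finite fun r => isOpen_lt continuous_const (by fun_prop)
  have hsc : Convex ℝ s := by
    rintro ⟨p, q⟩ ⟨x, hx, hxp, hxq⟩ ⟨p', q'⟩ ⟨y, hy, hyp, hyq⟩ a b ha hb hab
    refine ⟨a • x + b • y, hh.1 hx hy ha hb hab, fun r => ?_, ?_⟩
    · have h1 := (hc r).2 hx hy ha hb hab
      have h2 := hxp r
      have h3 := hyp r
      simp only [smul_eq_mul] at h1
      simp only [Prod.smul_mk, Prod.mk_add_mk, Pi.add_apply, Pi.smul_apply, smul_eq_mul]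
        at h2 h3 ⊢
      rcases ha.eq_or_lt with rfl | ha
      · have : b = 1 := by linarith
        subst this; linarith
      · nlinarith [mul_lt_mul_of_pos_left h2 ha, mul_le_mul_of_nonneg_left h3.le hb]
    · have h1 := hh.2 hx hy ha hb hab
      simp only [smul_eq_mul] at h1
      simp only [Prod.smul_mk, Prod.mk_add_mk, smul_eq_mul] at hxq hyq ⊢
      have e : h xs = a * h xs + b * h xs := by rw [← add_mul, hab, one_mul]
      rcases ha.eq_or_lt with rfl | ha
      · have : b = 1 := by linarith
        subst this; linarith
      · nlinarith [mul_lt_mul_of_pos_left hxq ha, mul_le_mul_of_nonneg_left hyq.le hb]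
  have h0 : (0 : (ι → ℝ) × ℝ) ∉ s := by
    rintro ⟨x, hx, hx1, hx2⟩
    have := hmin x hx fun r => (hx1 r).le
    simp only [Prod.snd_zero] at hx2
    linarith
  obtain ⟨f, hf⟩ := geometric_hahn_banach_open_point hsc hso h0
  rw [map_zero] at hf
  set l : ι → ℝ := fun r => - f (Pi.single r 1, 0)
  set κ : ℝ := - f (0, 1)
  have hfe : ∀ p : ι → ℝ, ∀ q : ℝ, f (p, q) = -(∑ r, l r * p r + κ * q) := by
    intro p q
    have e : (p, q) = ∑ r, p r • ((Pi.single r 1, 0) : (ι → ℝ) × ℝ) +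
        q • ((0, 1) : (ι → ℝ) × ℝ) := by
      ext r
      · simp [Prod.fst_sum, Finset.sum_apply, Pi.single_apply]
      · simp [Prod.snd_sum]
    rw [e, map_add, map_sum, map_smul]
    simp only [map_smul, smul_eq_mul, l, κ]
    simp only [neg_mul, Finset.sum_neg_distrib]
    rw [Finset.sum_congr rfl fun r _ => mul_comm (p r) _]
    ring
  have hmem : ∀ ε > 0, ∀ x ∈ K, ((fun r => c x r + ε, h x - h xs + ε) : (ι → ℝ) × ℝ) ∈ s :=
    fun ε hε x hx => ⟨x, hx, fun r => by simpa using hε, by simpa using hε⟩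
  -- The set `s` is stable under increasing any coordinate. A negative coefficient would make `f`
  -- nonnegative far enough along that ray, against the separation.
  have hl : ∀ r, 0 ≤ l r := by
    intro r
    by_contra hneg
    push Not at hneg
    obtain ⟨T, hT, hT2⟩ : ∃ T : ℝ, 0 ≤ T ∧
        f (fun r => c x₀ r + 1, h x₀ - h xs + 1) - l r * T ≥ 0 := by
      refine ⟨|f (fun r => c x₀ r + 1, h x₀ - h xs + 1)| / (-l r), by
        have : 0 < -l r := by linarith
        positivity, ?_⟩
      have : l r * (|f (fun r => c x₀ r + 1, h x₀ - h xs + 1)| / (-l r))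
        = -|f (fun r => c x₀ r + 1, h x₀ - h xs + 1)| := by
        rw [div_neg, mul_neg, mul_div_cancel₀ _ hneg.ne]
      rw [this]
      linarith [neg_abs_le (f (fun r => c x₀ r + 1, h x₀ - h xs + 1))]
    have hm : ((fun r => c x₀ r + 1, h x₀ - h xs + 1) + T • (Pi.single r 1, 0) :
        (ι → ℝ) × ℝ) ∈ s := by
      refine ⟨x₀, hx₀, fun r' => ?_, by simp⟩
      have : 0 ≤ T * (Pi.single r (1 : ℝ) : ι → ℝ) r' := by
        refine mul_nonneg hT ?_
        by_cases hr : r' = r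
        · subst hr; simp
        · simp [hr]
      simp only [Prod.fst_add, Prod.smul_fst, Pi.add_apply, Pi.smul_apply, smul_eq_mul]
      linarith
    have := hf _ hm
    rw [map_add, map_smul, smul_eq_mul] at this
    simp only [l] at hT2
    linarith
  have hκ0 : 0 ≤ κ := by
    by_contra hneg
    push Not at hneg
    set A := f (fun r => c x₀ r + 1, h x₀ - h xs + 1) with hA
    have hm : ((fun r => c x₀ r + 1, h x₀ - h xs + 1) + (|A| / (-κ)) • (0, 1) :
        (ι → ℝ) × ℝ) ∈ s := by
      have : 0 ≤ |A| / (-κ) := div_nonneg (abs_nonneg _) (by linarith)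
      refine ⟨x₀, hx₀, fun r' => by simp, ?_⟩
      simp only [Prod.snd_add, Prod.smul_snd, smul_eq_mul, mul_one]
      linarith
    have h1 := hf _ hm
    rw [map_add, map_smul, smul_eq_mul, ← hA] at h1
    have h2 : |A| / (-κ) * f (0, 1) = |A| := by
      have : f (0, 1) = -κ := by simp [κ]
      rw [this, div_mul_cancel₀ _ (neg_ne_zero.2 hneg.ne)]
    rw [h2] at h1
    linarith [neg_abs_le A]
  have hlag : ∀ x ∈ K, 0 ≤ ∑ r, l r * c x r + κ * (h x - h xs) := by
    intro x hx
    refine nonneg_of_forall_add_mul_nonneg (Q := ∑ r, l r + κ) fun t ht _ => ?_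
    have := hf _ (hmem t ht x hx)
    rw [hfe] at this
    simp only [mul_add, Finset.sum_add_distrib, ← Finset.sum_mul] at this
    linarith
  -- If `κ = 0`, the Slater point forces every `l r` to vanish, and then `f = 0` cannot separate
  -- strictly.
  have hκ : 0 < κ := by
    refine lt_of_le_of_ne hκ0 fun hκ => ?_
    have h1 := hlag x₀ hx₀
    rw [← hκ, zero_mul, add_zero] at h1
    have h2 : ∀ r ∈ Finset.univ, l r * c x₀ r ≤ 0 := fun r _ =>
      mul_nonpos_of_nonneg_of_nonpos (hl r) (hsl r).le
    have h3 := (Finset.sum_eq_zero_iff_of_nonpos h2).1 (le_antisymm (Finset.sum_nonpos h2) h1)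
    have h4 : ∀ r, l r = 0 := fun r =>
      (mul_eq_zero.1 (h3 r (Finset.mem_univ r))).resolve_right (hsl r).ne
    have h5 := hf _ (hmem 1 one_pos x₀ hx₀)
    rw [hfe] at h5
    simp [h4, ← hκ] at h5
  have hfin : ∀ x ∈ K, h xs ≤ h x + ∑ r, l r / κ * c x r := by
    intro x hx
    have e : ∑ r, l r / κ * c x r = (∑ r, l r * c x r) / κ := by
      rw [Finset.sum_div]
      exact Finset.sum_congr rfl fun r _ => by ring
    rw [e]
    have h1 := div_nonneg (hlag x hx) hκ.le
    rw [add_div, mul_div_cancel_left₀ _ hκ.ne'] at h1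
    linarith
  refine ⟨fun r => l r / κ, fun r => div_nonneg (hl r) hκ.le, le_antisymm ?_ ?_, hfin⟩
  · exact Finset.sum_nonpos fun r _ =>
      mul_nonpos_of_nonneg_of_nonpos (div_nonneg (hl r) hκ.le) (hcs r)
  · have := hfin xs hxs
    linarith

end Multipliers

/-! ### Perturbed preconditioned forward-backward splitting, deterministic part -/

section ForwardBackward

variable {E : Type*} [NormedAddCommGroup E] [InnerProductSpace ℝ E]

/-- One step of the perturbed preconditioned forward-backward iteration is quasi-Fejér. -/
theorem forwardBackward_descent {Φ : E →L[ℝ] E}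
    (hΦs : ∀ x y, inner ℝ (Φ x) y = inner ℝ x (Φ y)) {τ θ δ : ℝ} (hτ : 0 < τ) (hθ : 0 < θ)
    (hδ : 0 < δ) (hδτ : 2 * δ = 1 / τ - 1 / (2 * θ)) (hΦ : ∀ v, ‖v‖ ^ 2 ≤ τ * inner ℝ (Φ v) v)
    {u u' w e p q : E} (hmono : 0 ≤ inner ℝ (Φ (u - u') - p - e + q) (u' - w))
    (hco : θ * ‖p - q‖ ^ 2 ≤ inner ℝ (p - q) (u - w)) :
    inner ℝ (Φ (u' - w)) (u' - w) ≤ inner ℝ (Φ (u - w)) (u - w) - δ * ‖u' - u‖ ^ 2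
      + (‖e‖ ^ 2 / δ - 2 * inner ℝ e (u - w)) := by
  have hexp : inner ℝ (Φ (u - w)) (u - w) = inner ℝ (Φ (u' - w)) (u' - w)
      + 2 * inner ℝ (Φ (u - u')) (u' - w) + inner ℝ (Φ (u - u')) (u - u') := by
    have h1 : u - w = (u - u') + (u' - w) := by abel
    rw [h1, map_add, inner_add_left, inner_add_right, inner_add_right,
      hΦs (u' - w) (u - u'), real_inner_comm (Φ (u - u')) (u' - w)]
    ring
  -- The error is moved from the new iterate to `u - w`, at the price of `⟨e, u' - u⟩`. This keeps
  -- the surviving product conditionally centred.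
  have hsplit : inner ℝ (Φ (u - u') - p - e + q) (u' - w)
      = inner ℝ (Φ (u - u')) (u' - w) - inner ℝ (p - q) (u - w) - inner ℝ (p - q) (u' - u)
        - inner ℝ e (u' - u) - inner ℝ e (u - w) := by
    have h1 : Φ (u - u') - p - e + q = Φ (u - u') - (p - q) - e := by abel
    have h2 : u' - w = (u' - u) + (u - w) := by abel
    have h3 : inner ℝ (p - q) (u' - w) = _ := congrArg (inner ℝ (p - q)) h2
    have h4 : inner ℝ e (u' - w) = _ := congrArg (inner ℝ e) h2
    rw [inner_add_right] at h3 h4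
    rw [h1, inner_sub_left, inner_sub_left, h3, h4]
    ring
  rw [hsplit] at hmono
  have hQ := hΦ (u - u')
  rw [norm_sub_rev] at hQ
  have hQ' : ‖u' - u‖ ^ 2 / τ ≤ inner ℝ (Φ (u - u')) (u - u') := by
    rwa [div_le_iff₀' hτ]
  have hcs := abs_le.1 (abs_real_inner_le_norm (p - q) (u' - u))
  have hcs2 := abs_le.1 (abs_real_inner_le_norm e (u' - u))
  -- Young's weight is chosen so that `θ‖p - q‖²` is exactly what cocoercivity supplies. The
  -- remaining multiple of `‖u' - u‖²` is `1/τ - 1/(2θ) = 2δ`, of which one `δ` pays for the error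
  -- in `hy2`.
  have hy1 : ‖p - q‖ * ‖u' - u‖ ≤ θ * ‖p - q‖ ^ 2 + ‖u' - u‖ ^ 2 / (4 * θ) := by
    have : θ * ‖p - q‖ ^ 2 + ‖u' - u‖ ^ 2 / (4 * θ) - ‖p - q‖ * ‖u' - u‖
      = (2 * θ * ‖p - q‖ - ‖u' - u‖) ^ 2 / (4 * θ) := by field_simp; ring
    have h2 : 0 ≤ (2 * θ * ‖p - q‖ - ‖u' - u‖) ^ 2 / (4 * θ) := by positivity
    linarith
  have hy2 : 2 * (‖e‖ * ‖u' - u‖) ≤ ‖e‖ ^ 2 / δ + δ * ‖u' - u‖ ^ 2 := by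
    have : ‖e‖ ^ 2 / δ + δ * ‖u' - u‖ ^ 2 - 2 * (‖e‖ * ‖u' - u‖)
      = (‖e‖ - δ * ‖u' - u‖) ^ 2 / δ := by field_simp; ring
    have h2 : 0 ≤ (‖e‖ - δ * ‖u' - u‖) ^ 2 / δ := by positivity
    linarith
  have hd : 2 * δ * ‖u' - u‖ ^ 2 = ‖u' - u‖ ^ 2 / τ - 2 * (‖u' - u‖ ^ 2 / (4 * θ)) := by
    rw [hδτ]; field_simp; ring
  linarith [hcs.1, hcs.2, hcs2.1, hcs2.2]

/-- A nonnegative sequence decreasing up to the increments of a convergent sequence converges, and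
its decrements vanish. -/
theorem tendsto_of_quasiFejer {V ρ s : ℕ → ℝ} {l : ℝ} (hV : ∀ k, 0 ≤ V k) (hρ : ∀ k, 0 ≤ ρ k)
    (hs : Tendsto s atTop (𝓝 l)) (h : ∀ k, V (k + 1) ≤ V k - ρ k + (s (k + 1) - s k)) :
    (∃ L, Tendsto V atTop (𝓝 L)) ∧ Tendsto ρ atTop (𝓝 0) := by
  have hanti : Antitone fun k => V k - s k := antitone_nat_of_succ_le fun k => by
    linarith [h k, hρ k]
  obtain ⟨C, hC⟩ := hs.bddAbove_range
  have hbdd : BddBelow (Set.range fun k => V k - s k) := ⟨-C, by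
    rintro _ ⟨k, rfl⟩
    have := hC ⟨k, rfl⟩
    simp only
    linarith [hV k]⟩
  have hX := tendsto_atTop_ciInf hanti hbdd
  set L := ⨅ k, (V k - s k)
  refine ⟨⟨L + l, by simpa using hX.add hs⟩, ?_⟩
  have hX' := hX.sub (hX.comp (tendsto_add_atTop_nat 1))
  rw [sub_self] at hX'
  refine squeeze_zero hρ (fun k => ?_) hX'
  simp only [Function.comp]
  linarith [h k]

/-- Convergence of the perturbed preconditioned forward-backward iteration for a monotone operator
with closed graph and an operator that is cocoercive with respect to the zeros. -/
theorem forwardBackward_tendsto [FiniteDimensional ℝ E] {Φ : E →L[ℝ] E}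
    (hΦs : ∀ x y, inner ℝ (Φ x) y = inner ℝ x (Φ y)) {τ θ : ℝ} (hτ : 0 < τ) (hθ : 0 < θ)
    (hτθ : τ < 2 * θ) (hΦ : ∀ v, ‖v‖ ^ 2 ≤ τ * inner ℝ (Φ v) v)
    {D : Set E} (hD : IsClosed D) {C : E → E} (hC : ContinuousOn C D) {B : E → E → Prop}
    (hBm : ∀ u v u' v', B u v → B u' v' → 0 ≤ inner ℝ (v - v') (u - u'))
    (hBc : ∀ (u v : ℕ → E) u' v', (∀ k, B (u k) (v k)) → Tendsto u atTop (𝓝 u') →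
      Tendsto v atTop (𝓝 v') → B u' v')
    (hco : ∀ u ∈ D, ∀ w, B w (-C w) → θ * ‖C u - C w‖ ^ 2 ≤ inner ℝ (C u - C w) (u - w))
    (hne : ∃ w, B w (-C w)) {u e : ℕ → E} (huD : ∀ k, u k ∈ D)
    (hstep : ∀ k, B (u (k + 1)) (Φ (u k - u (k + 1)) - C (u k) - e k))
    (he : Summable fun k => ‖e k‖ ^ 2)
    (hes : ∃ l, Tendsto (fun n => ∑ k ∈ Finset.range n, e k) atTop (𝓝 l))
    (heu : ∃ l, Tendsto (fun n => ∑ k ∈ Finset.range n, inner ℝ (e k) (u k)) atTop (𝓝 l)) :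
    ∃ w, B w (-C w) ∧ Tendsto u atTop (𝓝 w) := by
  set δ : ℝ := (1 / τ - 1 / (2 * θ)) / 2
  have hδ : 0 < δ := by
    have : 1 / (2 * θ) < 1 / τ := one_div_lt_one_div_of_lt hτ hτθ
    simp only [δ]; linarith
  have hfej : ∀ w, B w (-C w) → (∃ L, Tendsto (fun k => inner ℝ (Φ (u k - w)) (u k - w)) atTop
      (𝓝 L)) ∧ Tendsto (fun k => δ * ‖u (k + 1) - u k‖ ^ 2) atTop (𝓝 0) := by
    intro w hw
    obtain ⟨l₁, h₁⟩ := hes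
    obtain ⟨l₂, h₂⟩ := heu
    have h₃ : Tendsto (fun n => ∑ k ∈ Finset.range n, ‖e k‖ ^ 2) atTop _ :=
      he.hasSum.tendsto_sum_nat
    -- Splitting `⟨e, u - w⟩` into `⟨e, u⟩ - ⟨e, w⟩` makes the accumulated error converge for every
    -- `w` from series that do not involve `w`.
    have h₄ := (h₃.div_const δ).sub ((h₂.sub (h₁.inner (tendsto_const_nhds (x := w)))).const_mul 2)
    refine tendsto_of_quasiFejer (fun k => ?_) (fun k => by positivity) h₄ fun k => ?_
    · have h1 := hΦ (u k - w)
      by_contra hc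
      push Not at hc
      nlinarith [sq_nonneg ‖u k - w‖]
    · have hm := hBm _ _ _ _ (hstep k) hw
      rw [sub_neg_eq_add] at hm
      refine (forwardBackward_descent hΦs hτ hθ hδ (by simp only [δ]; ring) hΦ hm
        (hco _ (huD k) w hw)).trans (le_of_eq ?_)
      rw [Finset.sum_range_succ, Finset.sum_range_succ, Finset.sum_range_succ, inner_add_left,
        inner_sub_right (e k)]
      ring
  have hsub : ∀ w, ∀ k, ‖u k - w‖ ^ 2 ≤ τ * inner ℝ (Φ (u k - w)) (u k - w) :=
    fun w k => hΦ _
  obtain ⟨w₀, hw₀⟩ := hne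
  obtain ⟨⟨L, hL⟩, hρ⟩ := hfej w₀ hw₀
  have hρ' : Tendsto (fun k => u (k + 1) - u k) atTop (𝓝 0) := by
    rw [tendsto_zero_iff_norm_tendsto_zero]
    have h1 := (hρ.const_mul δ⁻¹).sqrt
    simp only [inv_mul_cancel_left₀ hδ.ne', Real.sqrt_sq (norm_nonneg _), mul_zero,
      Real.sqrt_zero] at h1
    exact h1
  have hbdd : ∃ R, ∀ k, u k ∈ Metric.closedBall w₀ R := by
    obtain ⟨M, hM⟩ := hL.bddAbove_range
    refine ⟨√(τ * M), fun k => ?_⟩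
    rw [mem_closedBall_iff_norm]
    refine Real.le_sqrt_of_sq_le ((hsub w₀ k).trans ?_)
    exact mul_le_mul_of_nonneg_left (hM ⟨k, rfl⟩) hτ.le
  obtain ⟨R, hR⟩ := hbdd
  obtain ⟨w, -, φ, hφ, hlim⟩ := tendsto_subseq_of_bounded Metric.isBounded_closedBall hR
  have hwD : w ∈ D := hD.mem_of_tendsto hlim (Eventually.of_forall fun k => huD _)
  have hρφ := hρ'.comp hφ.tendsto_atTop
  have hlim' : Tendsto (fun j => u (φ j + 1)) atTop (𝓝 w) := by
    have := hρφ.add hlim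
    simpa using this
  have heφ : Tendsto (fun j => e (φ j)) atTop (𝓝 0) := by
    have h1 : Tendsto e atTop (𝓝 0) := by
      rw [tendsto_zero_iff_norm_tendsto_zero]
      have h1 := he.tendsto_atTop_zero.sqrt
      simpa [Real.sqrt_sq (norm_nonneg _)] using h1
    exact h1.comp hφ.tendsto_atTop
  have hCφ : Tendsto (fun j => C (u (φ j))) atTop (𝓝 (C w)) :=
    (hC w hwD).tendsto.comp (tendsto_nhdsWithin_iff.2 ⟨hlim, Eventually.of_forall fun j => huD _⟩)
  -- The increments and errors vanish, so the closed graph of `B` identifies the cluster point as a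
  -- zero.
  have hw : B w (-C w) := by
    refine hBc _ _ w (-C w) (fun j => hstep (φ j)) hlim' ?_
    have h1 := ((Φ.continuous.tendsto _).comp (hlim.sub hlim')).sub hCφ |>.sub heφ
    simpa using h1
  refine ⟨w, hw, ?_⟩
  -- With the cluster point itself as reference, the distance converges along the whole sequence,
  -- and its limit is 0 along the subsequence.
  obtain ⟨⟨L', hL'⟩, -⟩ := hfej w hw
  have hL0 : L' = 0 := by
    refine tendsto_nhds_unique (hL'.comp hφ.tendsto_atTop) ?_
    have h1 := hlim.sub (tendsto_const_nhds (x := w))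
    have h2 := ((Φ.continuous.tendsto _).comp h1).inner (𝕜 := ℝ) h1
    simpa [Function.comp_def] using h2
  subst hL0
  rw [tendsto_iff_norm_sub_tendsto_zero]
  have h1 : Tendsto (fun k => ‖u k - w‖ ^ 2) atTop (𝓝 0) :=
    squeeze_zero (fun k => by positivity) (hsub w) (by simpa using hL'.const_mul τ)
  simpa [Real.sqrt_sq (norm_nonneg _)] using h1.sqrt

end ForwardBackward

/-! ### Martingale convergence and independence tools -/

section Stochastic

variable {Ω : Type*} {mΩ : MeasurableSpace Ω} {μ : Measure Ω} [IsProbabilityMeasure μ]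

omit [IsProbabilityMeasure μ] in
theorem memLp_two_of_lintegral_le {f : Ω → ℝ} (hf : AEStronglyMeasurable f μ) {C : ENNReal}
    (hC : C ≠ ⊤) (h : ∫⁻ ω, ‖f ω‖ₑ ^ 2 ∂μ ≤ C) : MemLp f 2 μ := by
  refine ⟨hf, ?_⟩
  rw [eLpNorm_lt_top_iff_lintegral_rpow_enorm_lt_top two_ne_zero ENNReal.ofNat_ne_top]
  simpa using lt_of_le_of_lt h hC.lt_top

omit [IsProbabilityMeasure μ] in
theorem ofReal_integral_sq {f : Ω → ℝ} (hf : MemLp f 2 μ) :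
    ENNReal.ofReal (∫ ω, f ω ^ 2 ∂μ) = ∫⁻ ω, ‖f ω‖ₑ ^ 2 ∂μ := by
  rw [ofReal_integral_eq_lintegral_ofReal hf.integrable_sq
    (Eventually.of_forall fun ω => sq_nonneg _)]
  refine lintegral_congr fun ω => ?_
  rw [Real.enorm_eq_ofReal_abs, ← ENNReal.ofReal_pow (abs_nonneg _), sq_abs]

/-- Series of orthogonal martingale differences with summable second moments converge almost
surely. -/
theorem ae_tendsto_sum_of_orthogonal {ℱ : Filtration ℕ mΩ} {D : ℕ → Ω → ℝ}
    (hD : ∀ k, Measurable[ℱ (k + 1)] (D k)) (hL : ∀ k, MemLp (D k) 2 μ)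
    (horth : ∀ k (Z : Ω → ℝ), Measurable[ℱ k] Z → MemLp Z 2 μ → ∫ ω, Z ω * D k ω ∂μ = 0)
    (hsum : Summable fun k => ∫ ω, D k ω ^ 2 ∂μ) :
    ∀ᵐ ω ∂μ, ∃ l, Tendsto (fun n => ∑ k ∈ Finset.range n, D k ω) atTop (𝓝 l) := by
  set M : ℕ → Ω → ℝ := fun n ω => ∑ k ∈ Finset.range n, D k ω
  have hMm : ∀ n, Measurable[ℱ n] (M n) := fun n =>
    Finset.measurable_fun_sum _ fun k hk =>
      (hD k).mono (ℱ.mono (Nat.succ_le_of_lt (Finset.mem_range.1 hk))) le_rfl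
  have hML : ∀ n, MemLp (M n) 2 μ := fun n => memLp_finsetSum _ fun k _ => hL k
  have hMi : ∀ n, Integrable (M n) μ := fun n => (hML n).integrable one_le_two
  have hsucc : ∀ n ω, M (n + 1) ω = M n ω + D n ω := fun n ω => Finset.sum_range_succ _ _
  have hmart : Martingale M ℱ μ := by
    refine martingale_of_setIntegral_eq_succ (fun n => (hMm n).stronglyMeasurable) hMi
      fun n s hs => ?_
    have hs' : MeasurableSet s := ℱ.le n s hs
    -- Indicators of past events as test variables give the martingale property; the partial sum
    -- itself as test variable gives Pythagoras in `hsq`.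
    have h0 := horth n (s.indicator fun _ => 1) (measurable_const.indicator hs)
      ((memLp_const (1 : ℝ)).indicator hs')
    have h1 : ∫ ω in s, D n ω ∂μ = 0 := by
      rw [← h0, ← integral_indicator hs']
      congr 1
      ext ω
      by_cases hω : ω ∈ s <;> simp [hω]
    simp_rw [hsucc]
    rw [integral_add (hMi n).integrableOn ((hL n).integrable one_le_two).integrableOn, h1,
      add_zero]
  have hsq : ∀ n, ∫ ω, M n ω ^ 2 ∂μ = ∑ k ∈ Finset.range n, ∫ ω, D k ω ^ 2 ∂μ := by
    intro n
    induction n with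
    | zero => simp [M]
    | succ n ih =>
      rw [Finset.sum_range_succ, ← ih]
      have e : ∀ ω, M (n + 1) ω ^ 2 = M n ω ^ 2 + 2 * (M n ω * D n ω) + D n ω ^ 2 := fun ω => by
        rw [hsucc]; ring
      have hi : Integrable (fun ω => M n ω * D n ω) μ := (hML n).integrable_mul (hL n)
      simp_rw [e]
      have hi' : Integrable (fun ω => M n ω ^ 2 + 2 * (M n ω * D n ω)) μ :=
        (hML n).integrable_sq.add (hi.const_mul 2)
      rw [integral_add hi' (hL n).integrable_sq,
        integral_add (hML n).integrable_sq (hi.const_mul 2), integral_const_mul,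
        horth n _ (hMm n) (hML n)]
      ring
  set T := ∑' k, ∫ ω, D k ω ^ 2 ∂μ
  have hbd : ∀ n, eLpNorm (M n) 1 μ ≤ ((√T).toNNReal : ENNReal) := by
    intro n
    refine (eLpNorm_le_eLpNorm_of_exponent_le one_le_two
      (hML n).aestronglyMeasurable).trans ?_
    rw [(hML n).eLpNorm_eq_integral_rpow_norm two_ne_zero ENNReal.ofNat_ne_top]
    refine ENNReal.ofReal_le_ofReal ?_
    have h2 : ∫ ω, ‖M n ω‖ ^ (ENNReal.toReal 2) ∂μ = ∫ ω, M n ω ^ 2 ∂μ := by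
      congr 1; ext ω; simp
    rw [h2, hsq]
    have h3 : (ENNReal.toReal 2)⁻¹ = 1 / 2 := by norm_num
    rw [h3, ← Real.sqrt_eq_rpow]
    exact Real.sqrt_le_sqrt (hsum.sum_le_tsum _ fun k _ => integral_nonneg fun ω => sq_nonneg _)
  exact hmart.submartingale.exists_ae_tendsto_of_bdd hbd

omit [IsProbabilityMeasure μ] in
/-- A series of nonnegative random variables with summable expectations is almost surely
summable. -/
theorem ae_summable_sq {D : ℕ → Ω → ℝ} (hL : ∀ k, MemLp (D k) 2 μ)
    (hsum : Summable fun k => ∫ ω, D k ω ^ 2 ∂μ) : ∀ᵐ ω ∂μ, Summable fun k => D k ω ^ 2 := by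
  have h1 : ∫⁻ ω, ∑' k, ‖D k ω‖ₑ ^ 2 ∂μ ≠ ⊤ := by
    rw [lintegral_tsum fun k => ((hL k).aestronglyMeasurable.enorm.pow_const 2)]
    simp_rw [← ofReal_integral_sq (hL _)]
    exact hsum.tsum_ofReal_ne_top
  have h2 := ae_lt_top' (AEMeasurable.tsum fun k =>
    ((hL k).aestronglyMeasurable.enorm.pow_const 2)) h1
  filter_upwards [h2] with ω hω
  have h3 := ENNReal.summable_toReal hω.ne
  refine h3.congr fun k => ?_
  rw [ENNReal.toReal_pow, toReal_enorm, Real.norm_eq_abs, sq_abs]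

variable {α β : Type*} [MeasurableSpace α] [MeasurableSpace β]

/-- Fubini under the product law: with `X` and `Z` frozen, the integral over `Y` vanishes. This
replaces a computation with conditional expectations. -/
theorem integral_mul_eq_zero_of_indepFun {X : Ω → α} {Z : Ω → ℝ} {Y : Ω → β} (hX : Measurable X)
    (hZ : Measurable Z) (hY : Measurable Y) (hind : IndepFun (fun ω => (X ω, Z ω)) Y μ)
    {φ : α × β → ℝ} (hφ : Measurable φ) (h0 : ∀ a, ∫ y, φ (a, y) ∂(μ.map Y) = 0)
    (hint : Integrable (fun ω => Z ω * φ (X ω, Y ω)) μ) :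
    ∫ ω, Z ω * φ (X ω, Y ω) ∂μ = 0 := by
  have hlaw := hind.map_prod_eq_prod_map_map (hX.prodMk hZ).aemeasurable hY.aemeasurable
  set ψ : (α × ℝ) × β → ℝ := fun p => p.1.2 * φ (p.1.1, p.2)
  have hψ : Measurable ψ := by fun_prop
  have hm : Measurable fun ω => ((X ω, Z ω), Y ω) := (hX.prodMk hZ).prodMk hY
  have h1 : ∫ ω, Z ω * φ (X ω, Y ω) ∂μ = ∫ p, ψ p ∂(μ.map fun ω => ((X ω, Z ω), Y ω)) := by
    rw [integral_map hm.aemeasurable hψ.aestronglyMeasurable]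
  have h2 : Integrable ψ (μ.map fun ω => ((X ω, Z ω), Y ω)) :=
    (integrable_map_measure hψ.aestronglyMeasurable hm.aemeasurable).2 hint
  have := Measure.isProbabilityMeasure_map (μ := μ) hY.aemeasurable
  rw [h1, hlaw]
  rw [hlaw] at h2
  rw [integral_prod _ h2]
  have : ∀ x : α × ℝ, ∫ y, ψ (x, y) ∂(μ.map Y) = 0 := fun x => by
    simp only [ψ]
    rw [integral_const_mul, h0, mul_zero]
  simp [this]

/-- A bound uniform in the frozen value survives when that value is replaced by an independent
random one. -/
theorem lintegral_comp_le_of_indepFun {X : Ω → α} {Y : Ω → β} (hX : Measurable X)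
    (hY : Measurable Y) (hind : IndepFun X Y μ) {φ : α × β → ENNReal} (hφ : Measurable φ)
    {C : ENNReal} (hC : ∀ a, ∫⁻ y, φ (a, y) ∂(μ.map Y) ≤ C) :
    ∫⁻ ω, φ (X ω, Y ω) ∂μ ≤ C := by
  have hlaw := hind.map_prod_eq_prod_map_map hX.aemeasurable hY.aemeasurable
  have h1 : ∫⁻ ω, φ (X ω, Y ω) ∂μ = ∫⁻ p, φ p ∂(μ.map fun ω => (X ω, Y ω)) := by
    rw [lintegral_map hφ (hX.prodMk hY)]
  have := Measure.isProbabilityMeasure_map (μ := μ) hY.aemeasurable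
  have := Measure.isProbabilityMeasure_map (μ := μ) hX.aemeasurable
  rw [h1, hlaw, lintegral_prod _ hφ.aemeasurable]
  refine (lintegral_mono fun a => hC a).trans ?_
  simp

/-- Square integrability of a sum of two independent variables passes to the summands. -/
theorem memLp_two_of_indepFun_add {X Y : Ω → ℝ} (hX : Measurable X) (hY : Measurable Y)
    (hind : IndepFun X Y μ) (h : MemLp (fun ω => X ω + Y ω) 2 μ) : MemLp X 2 μ := by
  have hlaw := hind.map_prod_eq_prod_map_map hX.aemeasurable hY.aemeasurable
  have hPX := Measure.isProbabilityMeasure_map (μ := μ) hX.aemeasurable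
  have hPY := Measure.isProbabilityMeasure_map (μ := μ) hY.aemeasurable
  have hφ : Measurable fun p : ℝ × ℝ => ‖p.1 + p.2‖ₑ ^ 2 := by fun_prop
  -- By Tonelli, `X + y` is square integrable for some constant `y`; subtracting the constant leaves
  -- `X`.
  have h1 : ∫⁻ y, ∫⁻ x, ‖x + y‖ₑ ^ 2 ∂(μ.map X) ∂(μ.map Y) ≠ ⊤ := by
    rw [← lintegral_prod_symm' _ hφ, ← hlaw, lintegral_map hφ (hX.prodMk hY),
      ← ofReal_integral_sq h]
    exact ENNReal.ofReal_ne_top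
  have h2 := ae_lt_top (hφ.lintegral_prod_left') h1
  obtain ⟨y, hy⟩ := h2.exists
  rw [lintegral_map (by fun_prop) hX] at hy
  have h3 : MemLp (fun ω => X ω + y) 2 μ :=
    memLp_two_of_lintegral_le (hX.add_const y).aestronglyMeasurable hy.ne le_rfl
  exact (h3.sub (memLp_const y)).ae_eq (Eventually.of_forall fun ω => add_sub_cancel_right _ _)

omit [IsProbabilityMeasure μ] in
/-- Adjoining to an independent family a variable independent of the whole family. -/
theorem iIndep_option {ι I V : Type*} [MeasurableSpace I] [MeasurableSpace V] {X : Ω → I}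
    {Y : ι → Ω → V} (hi : iIndepFun Y μ)
    (hXY : IndepFun X (fun ω i => Y i ω) μ) :
    iIndep (fun o : Option ι => o.elim (MeasurableSpace.comap X inferInstance)
      fun i => MeasurableSpace.comap (Y i) inferInstance) μ := by
  classical
  rw [iIndep_iff]
  intro s f hf
  -- The events indexed by `some i` are gathered into one event of the whole family, from which the
  -- event of the adjoined variable splits off.
  set B : Set Ω := ⋂ i ∈ s.eraseNone, f (some i)
  have hfB : ∀ i ∈ s.eraseNone, MeasurableSet[MeasurableSpace.comap (Y i) inferInstance]
      (f (some i)) := fun i his => hf (some i) (Finset.mem_eraseNone.1 his)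
  have hB : MeasurableSet[MeasurableSpace.comap (fun ω i => Y i ω) inferInstance] B := by
    refine Finset.measurableSet_biInter _ fun i his => ?_
    obtain ⟨t, ht, hte⟩ := hfB i his
    exact ⟨(fun y : ι → V => y i) ⁻¹' t, measurable_pi_apply i ht, hte⟩
  have hμB : μ B = ∏ i ∈ s.eraseNone, μ (f (some i)) :=
    iIndep.meas_biInter (m := fun i => MeasurableSpace.comap (Y i) inferInstance) hi hfB
  by_cases hn : none ∈ s
  · have hs : s = insert none (s.eraseNone.map Function.Embedding.some) := by
      rw [Finset.map_some_eraseNone, Finset.insert_erase hn]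
    have hAB : ⋂ o ∈ s, f o = f none ∩ B := by
      ext ω
      simp [B, Option.forall, hn]
    have h1 := (Indep_iff _ _ μ).1 hXY (f none) B (hf none hn) hB
    rw [hAB, h1, hμB]
    conv_rhs => rw [hs]
    rw [Finset.prod_insert (by simp), Finset.prod_map]
    rfl
  · have hs : s = s.eraseNone.map Function.Embedding.some := by
      rw [Finset.map_some_eraseNone, Finset.erase_eq_of_notMem hn]
    have hAB : ⋂ o ∈ s, f o = B := by
      ext ω
      simp [B, Option.forall, hn]
    rw [hAB, hμB]
    conv_rhs => rw [hs]
    rw [Finset.prod_map]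
    rfl

end Stochastic

/-! ### Constraint and Laplacian operators -/

section Operators

theorem act_apply {p q : ℕ} (M : Matrix (Fin p) (Fin q) ℝ) (v : Vec q) (r : Fin p) :
    act M v r = ∑ c, M r c * v c := rfl

theorem act_add {p q : ℕ} (M : Matrix (Fin p) (Fin q) ℝ) (v w : Vec q) :
    act M (v + w) = act M v + act M w := by
  ext r; simp [act_apply, mul_add, Finset.sum_add_distrib]

theorem act_smul {p q : ℕ} (M : Matrix (Fin p) (Fin q) ℝ) (a : ℝ) (v : Vec q) :
    act M (a • v) = a • act M v := by
  ext r; simp [act_apply, Finset.mul_sum, mul_left_comm]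

theorem inner_act {p q : ℕ} (M : Matrix (Fin p) (Fin q) ℝ) (v : Vec q) (w : Vec p) :
    inner ℝ (act M v) w = inner ℝ v (act Mᵀ w) := by
  simp only [PiLp.inner_apply, act_apply, RCLike.inner_apply, conj_trivial, Finset.mul_sum,
    Finset.sum_mul, Matrix.transpose_apply]
  rw [Finset.sum_comm]
  exact Finset.sum_congr rfl fun i _ => Finset.sum_congr rfl fun j _ => by ring

/-- Dual profiles: a vector of `ℝᵐ` for each of the `N` agents. -/
abbrev Dual (N m : ℕ) := Profile (fun _ : Fin N => m)

variable {N m d : ℕ} {n : Fin N → ℕ}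

/-- The operator `x ↦ col(Aᵢ xᵢ)`. -/
def Game.localMap (G : Game N m d n) : Profile n →L[ℝ] Dual N m :=
  LinearMap.toContinuousLinearMap
    { toFun := fun x => WithLp.toLp 2 fun i => act (G.A i) (x i)
      map_add' := fun x y => by
        refine PiLp.ext fun i => ?_
        exact act_add _ _ _
      map_smul' := fun a x => by
        refine PiLp.ext fun i => ?_
        exact act_smul _ _ _ }

/-- The operator `λ ↦ col(Aᵢᵀ λᵢ)`. -/
def Game.localMapT (G : Game N m d n) : Dual N m →L[ℝ] Profile n :=
  LinearMap.toContinuousLinearMap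
    { toFun := fun x => WithLp.toLp 2 fun i => act (G.A i)ᵀ (x i)
      map_add' := fun x y => by
        refine PiLp.ext fun i => ?_
        exact act_add _ _ _
      map_smul' := fun a x => by
        refine PiLp.ext fun i => ?_
        exact act_smul _ _ _ }

/-- The Laplacian acting on dual profiles. -/
def lapMap (m : ℕ) (W : Matrix (Fin N) (Fin N) ℝ) : Dual N m →L[ℝ] Dual N m :=
  LinearMap.toContinuousLinearMap
    { toFun := fun z => WithLp.toLp 2 fun i => ∑ j, W i j • (z i - z j)
      map_add' := fun x y => by
        refine PiLp.ext fun i => ?_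
        simp only [PiLp.add_apply, ← Finset.sum_add_distrib]
        exact Finset.sum_congr rfl fun j _ => by module
      map_smul' := fun a x => by
        refine PiLp.ext fun i => ?_
        simp only [PiLp.smul_apply, RingHom.id_apply, Finset.smul_sum]
        exact Finset.sum_congr rfl fun j _ => by module }

theorem Game.localMap_apply (G : Game N m d n) (x : Profile n) (i : Fin N) :
    G.localMap x i = act (G.A i) (x i) := rfl

theorem Game.localMapT_apply (G : Game N m d n) (l : Dual N m) (i : Fin N) :
    G.localMapT l i = act (G.A i)ᵀ (l i) := rfl

theorem lapMap_apply (W : Matrix (Fin N) (Fin N) ℝ) (z : Dual N m) (i : Fin N) :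
    lapMap m W z i = ∑ j, W i j • (z i - z j) := rfl

theorem Game.inner_localMap (G : Game N m d n) (x : Profile n) (l : Dual N m) :
    inner ℝ (G.localMap x) l = inner ℝ x (G.localMapT l) := by
  simp only [PiLp.inner_apply (𝕜 := ℝ) (ι := Fin N)]
  exact Finset.sum_congr rfl fun i _ => inner_act _ _ _

theorem Game.coupling_eq_sum_localMap (G : Game N m d n) (x : Profile n) :
    G.coupling x = ∑ i, G.localMap x i := rfl

variable {Γ : SimpleGraph (Fin N)} {W : Matrix (Fin N) (Fin N) ℝ}

theorem IsWeightedAdj.nonneg (hW : IsWeightedAdj Γ W) (i j : Fin N) : 0 ≤ W i j := by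
  by_cases h : Γ.Adj i j
  · exact (hW.pos i j h).le
  · exact (hW.zero i j h).ge

theorem IsWeightedAdj.comm (hW : IsWeightedAdj Γ W) (i j : Fin N) : W i j = W j i :=
  hW.symm.apply j i

/-- Exchanging `i` and `j` and averaging gives the Dirichlet form over the edges, from which
symmetry, cocoercivity and the kernel of the Laplacian are read off. -/
theorem IsWeightedAdj.inner_lapMap (hW : IsWeightedAdj Γ W) (z w : Dual N m) :
    inner ℝ (lapMap m W z) w = (∑ i, ∑ j, W i j * inner ℝ (z i - z j) (w i - w j)) / 2 := by
  have h1 : inner ℝ (lapMap m W z) w = ∑ i, ∑ j, W i j * inner ℝ (z i - z j) (w i) := by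
    rw [PiLp.inner_apply]
    refine Finset.sum_congr rfl fun i _ => ?_
    rw [lapMap_apply, sum_inner]
    exact Finset.sum_congr rfl fun j _ => real_inner_smul_left _ _ _
  have h2 : inner ℝ (lapMap m W z) w = -∑ i, ∑ j, W i j * inner ℝ (z i - z j) (w j) := by
    rw [h1, Finset.sum_comm, ← Finset.sum_neg_distrib]
    refine Finset.sum_congr rfl fun i _ => ?_
    rw [← Finset.sum_neg_distrib]
    refine Finset.sum_congr rfl fun j _ => ?_
    rw [hW.comm j i, ← neg_sub (z i) (z j), inner_neg_left, mul_neg]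
  have h3 : ∑ i, ∑ j, W i j * inner ℝ (z i - z j) (w i - w j)
      = ∑ i, ∑ j, W i j * inner ℝ (z i - z j) (w i)
        - ∑ i, ∑ j, W i j * inner ℝ (z i - z j) (w j) := by
    simp only [inner_sub_right, mul_sub, Finset.sum_sub_distrib]
  rw [h3]
  linarith

theorem IsWeightedAdj.lapMap_symm (hW : IsWeightedAdj Γ W) (z w : Dual N m) :
    inner ℝ (lapMap m W z) w = inner ℝ z (lapMap m W w) := by
  rw [real_inner_comm (lapMap m W w) z, hW.inner_lapMap, hW.inner_lapMap]
  congr 1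
  exact Finset.sum_congr rfl fun i _ => Finset.sum_congr rfl fun j _ => by
    rw [real_inner_comm]

/-- Weighted Cauchy–Schwarz gives `‖(Lz)_i‖² ≤ d_i ∑_j w_ij ‖z_i - z_j‖²`, and these inner sums add
up over `i` to `2⟨Lz, z⟩`. Hence the constant `1/(2d*)`. -/
theorem IsWeightedAdj.lapMap_cocoercive (hW : IsWeightedAdj Γ W) {θ : ℝ} (hθ : 0 ≤ θ)
    (hθd : ∀ i, θ * (2 * deg W i) ≤ 1) (z : Dual N m) :
    θ * ‖lapMap m W z‖ ^ 2 ≤ inner ℝ (lapMap m W z) z := by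
  rw [hW.inner_lapMap, PiLp.norm_sq_eq_of_L2, Finset.mul_sum, Finset.sum_div]
  refine Finset.sum_le_sum fun i _ => ?_
  set q := ∑ j, W i j * ‖z i - z j‖ ^ 2
  have hq : ∑ j, W i j * inner ℝ (z i - z j) (z i - z j) = q :=
    Finset.sum_congr rfl fun j _ => by rw [real_inner_self_eq_norm_sq]
  have hq0 : 0 ≤ q := Finset.sum_nonneg fun j _ => mul_nonneg (hW.nonneg i j) (sq_nonneg _)
  have h1 : ‖lapMap m W z i‖ ≤ ∑ j, W i j * ‖z i - z j‖ := by
    rw [lapMap_apply]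
    refine (norm_sum_le _ _).trans (Finset.sum_le_sum fun j _ => ?_)
    rw [norm_smul, Real.norm_of_nonneg (hW.nonneg i j)]
  have h2 : (∑ j, W i j * ‖z i - z j‖) ^ 2 ≤ deg W i * q :=
    Finset.sum_sq_le_sum_mul_sum_of_sq_le_mul _ (fun j _ => hW.nonneg i j)
      (fun j _ => mul_nonneg (hW.nonneg i j) (sq_nonneg _)) fun j _ => le_of_eq (by ring)
  have h3 : ‖lapMap m W z i‖ ^ 2 ≤ deg W i * q :=
    (pow_le_pow_left₀ (norm_nonneg _) h1 2).trans h2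
  rw [hq]
  calc θ * ‖lapMap m W z i‖ ^ 2 ≤ θ * (deg W i * q) := mul_le_mul_of_nonneg_left h3 hθ
    _ = (θ * (2 * deg W i)) * q / 2 := by ring
    _ ≤ q / 2 := by
      have := mul_le_mul_of_nonneg_right (hθd i) hq0
      linarith

/-- A vanishing Dirichlet form forces equality across each edge, and connectedness propagates it
along walks. -/
theorem IsWeightedAdj.eq_of_lapMap_eq_zero (hW : IsWeightedAdj Γ W) (hΓ : Γ.Connected)
    {z : Dual N m} (hz : lapMap m W z = 0) (i j : Fin N) : z i = z j := by
  have h0 : ∑ i, ∑ j, W i j * inner ℝ (z i - z j) (z i - z j) = 0 := by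
    have := hW.inner_lapMap z z
    rw [hz, inner_zero_left] at this
    linarith
  have hnn : ∀ i j, 0 ≤ W i j * inner ℝ (z i - z j) (z i - z j) := fun i j =>
    mul_nonneg (hW.nonneg i j) real_inner_self_nonneg
  have hadj : ∀ i j, Γ.Adj i j → z i = z j := by
    intro i j hij
    have h1 := (Finset.sum_eq_zero_iff_of_nonneg fun i _ =>
      Finset.sum_nonneg fun j _ => hnn i j).1 h0 i (Finset.mem_univ i)
    have h2 := (Finset.sum_eq_zero_iff_of_nonneg fun j _ => hnn i j).1 h1 j (Finset.mem_univ j)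
    have h3 := (mul_eq_zero.1 h2).resolve_left (hW.pos i j hij).ne'
    exact sub_eq_zero.1 (inner_self_eq_zero.1 h3)
  obtain ⟨p⟩ := hΓ.preconnected i j
  induction p with
  | nil => rfl
  | cons h _ ih => exact (hadj _ _ h).trans ih

theorem lapMap_const (v : Vec m) :
    lapMap m W (WithLp.toLp 2 fun _ => v : Dual N m) = 0 := by
  refine PiLp.ext fun i => ?_
  simp [lapMap_apply]

/-- On a connected graph the range of the Laplacian is the set of profiles with zero sum. -/
theorem IsWeightedAdj.exists_lapMap_eq (hW : IsWeightedAdj Γ W) (hΓ : Γ.Connected)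
    {v : Dual N m} (hv : ∑ i, v i = 0) : ∃ z, lapMap m W z = v := by
  have hsymm : ((lapMap m W : Dual N m →L[ℝ] Dual N m) : Dual N m →ₗ[ℝ] Dual N m).IsSymmetric :=
    fun x y => hW.lapMap_symm x y
  have hmem : v ∈ LinearMap.range ((lapMap m W : Dual N m →L[ℝ] Dual N m) :
      Dual N m →ₗ[ℝ] Dual N m) := by
    -- The range of a symmetric operator is the orthogonal complement of its kernel, here the
    -- consensual profiles.
    rw [← Submodule.orthogonal_orthogonal (LinearMap.range _), hsymm.orthogonal_range,
      Submodule.mem_orthogonal]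
    intro u hu
    have hu' : lapMap m W u = 0 := hu
    obtain ⟨i₀⟩ := hΓ.nonempty
    rw [PiLp.inner_apply]
    have : ∀ i, inner ℝ (u i) (v i) = inner ℝ (u i₀) (v i) := fun i => by
      rw [hW.eq_of_lapMap_eq_zero hΓ hu' i i₀]
    rw [Finset.sum_congr rfl fun i _ => this i, ← inner_sum, hv, inner_zero_right]
  obtain ⟨z, hz⟩ := hmem
  exact ⟨z, hz⟩

end Operators

/-! ### Positive definiteness of the preconditioner -/

section Preconditioner

/-- A matrix with dominant diagonal has a positive definite quadratic form. -/
theorem dominant_quadratic_form {ι : Type*} [Fintype ι] [DecidableEq ι] {δ : ι → ℝ}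
    {R : Matrix ι ι ℝ} (hR : R.IsSymm) {γ : ℝ} (hd : ∀ i, γ + ∑ j, |R i j| ≤ δ i) (y : ι → ℝ) :
    γ * (y ⬝ᵥ y) ≤ y ⬝ᵥ ((Matrix.diagonal δ + R) *ᵥ y) := by
  have h1 : y ⬝ᵥ (R *ᵥ y) = ∑ i, ∑ j, R i j * (y i * y j) := by
    simp only [dotProduct, Matrix.mulVec, Finset.mul_sum]
    exact Finset.sum_congr rfl fun i _ => Finset.sum_congr rfl fun j _ => by ring
  -- Each product `y_i y_j` is charged half to each index; by symmetry of `R` the total charge to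
  -- `y_i²` is the absolute row sum.
  have h2 : -∑ i, ∑ j, |R i j| * ((y i ^ 2 + y j ^ 2) / 2) ≤ y ⬝ᵥ (R *ᵥ y) := by
    rw [h1, ← Finset.sum_neg_distrib]
    refine Finset.sum_le_sum fun i _ => ?_
    rw [← Finset.sum_neg_distrib]
    refine Finset.sum_le_sum fun j _ => ?_
    have h3 : |y i * y j| ≤ (y i ^ 2 + y j ^ 2) / 2 := by
      rw [abs_le]
      constructor <;> nlinarith [sq_nonneg (y i + y j), sq_nonneg (y i - y j)]
    have h4 := mul_le_mul_of_nonneg_left h3 (abs_nonneg (R i j))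
    rw [← abs_mul] at h4
    linarith [neg_abs_le (R i j * (y i * y j))]
  have h3 : ∑ i, ∑ j, |R i j| * y j ^ 2 = ∑ i, ∑ j, |R i j| * y i ^ 2 := by
    rw [Finset.sum_comm]
    exact Finset.sum_congr rfl fun i _ => Finset.sum_congr rfl fun j _ => by rw [hR.apply]
  have h4 : ∑ i, ∑ j, |R i j| * ((y i ^ 2 + y j ^ 2) / 2) = ∑ i, (∑ j, |R i j|) * y i ^ 2 := by
    simp only [Finset.sum_mul]
    have : ∀ i j, |R i j| * ((y i ^ 2 + y j ^ 2) / 2)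
        = |R i j| * y i ^ 2 / 2 + |R i j| * y j ^ 2 / 2 := fun i j => by ring
    simp only [this, Finset.sum_add_distrib, ← Finset.sum_div, h3]
    ring
  have h5 : y ⬝ᵥ (Matrix.diagonal δ *ᵥ y) = ∑ i, δ i * y i ^ 2 := by
    simp only [dotProduct, Matrix.mulVec_diagonal]
    exact Finset.sum_congr rfl fun i _ => by ring
  have h6 : γ * (y ⬝ᵥ y) = ∑ i, γ * y i ^ 2 := by
    simp only [dotProduct, Finset.mul_sum]
    exact Finset.sum_congr rfl fun i _ => by ring
  have h7 : ∑ i, (γ * y i ^ 2 + (∑ j, |R i j|) * y i ^ 2) ≤ ∑ i, δ i * y i ^ 2 :=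
    Finset.sum_le_sum fun i _ => by
      rw [← add_mul]
      exact mul_le_mul_of_nonneg_right (hd i) (sq_nonneg _)
  rw [Finset.sum_add_distrib] at h7
  rw [Matrix.add_mulVec, dotProduct_add, h5, h6]
  linarith

/-- A positive definite quadratic form is bounded below by the norm of the inverse matrix. -/
theorem norm_inv_quadratic_form {ι : Type*} [Fintype ι] [DecidableEq ι] {P : Matrix ι ι ℝ}
    (hP : P.IsSymm) {γ : ℝ} (hγ : 0 < γ) (hpos : ∀ y, γ * (y ⬝ᵥ y) ≤ y ⬝ᵥ (P *ᵥ y))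
    (y : ι → ℝ) : y ⬝ᵥ y ≤ ‖Matrix.toEuclideanCLM (𝕜 := ℝ) P⁻¹‖ * (y ⬝ᵥ (P *ᵥ y)) := by
  have hnn : ∀ v : ι → ℝ, 0 ≤ v ⬝ᵥ v := fun v =>
    Finset.sum_nonneg fun i _ => mul_self_nonneg _
  have hinj : Function.Injective P.mulVec := by
    intro v w hvw
    have h1 : P *ᵥ (v - w) = 0 := by rw [Matrix.mulVec_sub]; exact sub_eq_zero.2 hvw
    have h2 := hpos (v - w)
    rw [h1, dotProduct_zero] at h2
    have h3 : (v - w) ⬝ᵥ (v - w) = 0 := le_antisymm (by nlinarith [hnn (v - w)]) (hnn _)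
    exact sub_eq_zero.1 (dotProduct_self_eq_zero.1 h3)
  have hdet : IsUnit P.det := (Matrix.isUnit_iff_isUnit_det _).1
    (Matrix.mulVec_injective_iff_isUnit.1 hinj)
  set τ := ‖Matrix.toEuclideanCLM (𝕜 := ℝ) P⁻¹‖
  set w := P⁻¹ *ᵥ y
  have hPw : P *ᵥ w = y := by
    rw [Matrix.mulVec_mulVec, Matrix.mul_nonsing_inv _ hdet, Matrix.one_mulVec]
  have hyw : y ⬝ᵥ w ≤ τ * (y ⬝ᵥ y) := by
    have h1 : y ⬝ᵥ w = inner ℝ (WithLp.toLp 2 y)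
        (Matrix.toEuclideanCLM (𝕜 := ℝ) P⁻¹ (WithLp.toLp 2 y)) :=
      (Matrix.inner_toEuclideanCLM _ _ _).symm
    have h2 : ‖(WithLp.toLp 2 y : EuclideanSpace ℝ ι)‖ ^ 2 = y ⬝ᵥ y := by
      rw [EuclideanSpace.norm_sq_eq]
      exact Finset.sum_congr rfl fun i _ => by simp [sq]
    rw [h1, ← h2]
    refine (real_inner_le_norm _ _).trans ?_
    have := (Matrix.toEuclideanCLM (𝕜 := ℝ) P⁻¹).le_opNorm (WithLp.toLp 2 y)
    nlinarith [norm_nonneg (WithLp.toLp 2 y : EuclideanSpace ℝ ι)]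
  have hsym : ∀ a b : ι → ℝ, a ⬝ᵥ (P *ᵥ b) = b ⬝ᵥ (P *ᵥ a) := fun a b => by
    rw [Matrix.dotProduct_mulVec, ← Matrix.mulVec_transpose, hP.eq, dotProduct_comm]
  -- The form is nonnegative at `y - t P⁻¹y`. The choice `t = 1/τ` with `⟨y, P⁻¹y⟩ ≤ τ‖y‖²` gives
  -- the bound without diagonalizing `P`.
  have hexp : ∀ t : ℝ, 0 ≤ y ⬝ᵥ (P *ᵥ y) - 2 * t * (y ⬝ᵥ y) + t ^ 2 * (y ⬝ᵥ w) := by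
    intro t
    have h1 := (mul_nonneg hγ.le (hnn (y - t • w))).trans (hpos (y - t • w))
    rw [Matrix.mulVec_sub, Matrix.mulVec_smul, hPw, sub_dotProduct, dotProduct_sub,
      dotProduct_sub, smul_dotProduct, smul_dotProduct, dotProduct_smul, dotProduct_smul,
      hsym w y, hPw, dotProduct_comm w y] at h1
    simp only [smul_eq_mul] at h1
    linarith
  have hτ : 0 ≤ τ := norm_nonneg _
  rcases hτ.eq_or_lt with h0 | h0
  · rw [← h0, zero_mul] at hyw
    have h1 : w ⬝ᵥ (P *ᵥ w) ≤ 0 := by rw [hPw, dotProduct_comm]; exact hyw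
    have h2 := hpos w
    have h3 : w ⬝ᵥ w = 0 := le_antisymm (by nlinarith [hnn w]) (hnn w)
    have h4 : w = 0 := dotProduct_self_eq_zero.1 h3
    have h5 : y = 0 := by rw [← hPw, h4, Matrix.mulVec_zero]
    simp [h5]
  · have h1 := hexp τ⁻¹
    have h2 : τ⁻¹ ^ 2 * (y ⬝ᵥ w) ≤ τ⁻¹ * (y ⬝ᵥ y) := by
      have := mul_le_mul_of_nonneg_left hyw (sq_nonneg τ⁻¹)
      refine this.trans (le_of_eq ?_)
      field_simp
    have h3 : τ⁻¹ * (y ⬝ᵥ y) ≤ y ⬝ᵥ (P *ᵥ y) := by linarith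
    rwa [inv_mul_le_iff₀ h0] at h3

variable {N m d : ℕ} {n : Fin N → ℕ}

/-- The space of triples `(x, z, λ)`, with its Euclidean structure. -/
abbrev PrimalDual (n : Fin N → ℕ) (m : ℕ) := WithLp 2 (Profile n × WithLp 2 (Dual N m × Dual N m))

/-- The triple `(x, z, λ)`. -/
def triple (x : Profile n) (z l : Dual N m) : PrimalDual n m :=
  WithLp.toLp 2 (x, WithLp.toLp 2 (z, l))

/-- The strategies in `(x, z, λ)`. -/
def primal : PrimalDual n m →L[ℝ] Profile n :=
  LinearMap.toContinuousLinearMap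
    { toFun := fun u => u.ofLp.1, map_add' := fun _ _ => rfl, map_smul' := fun _ _ => rfl }

/-- The auxiliary variables in `(x, z, λ)`. -/
def auxil : PrimalDual n m →L[ℝ] Dual N m :=
  LinearMap.toContinuousLinearMap
    { toFun := fun u => u.ofLp.2.ofLp.1, map_add' := fun _ _ => rfl, map_smul' := fun _ _ => rfl }

/-- The multipliers in `(x, z, λ)`. -/
def dual : PrimalDual n m →L[ℝ] Dual N m :=
  LinearMap.toContinuousLinearMap
    { toFun := fun u => u.ofLp.2.ofLp.2, map_add' := fun _ _ => rfl, map_smul' := fun _ _ => rfl }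

@[simp] theorem primal_triple (x : Profile n) (z l : Dual N m) : primal (triple x z l) = x := rfl

@[simp] theorem auxil_triple (x : Profile n) (z l : Dual N m) : auxil (triple x z l) = z := rfl

@[simp] theorem dual_triple (x : Profile n) (z l : Dual N m) : dual (triple x z l) = l := rfl

theorem triple_add (x x' : Profile n) (z z' l l' : Dual N m) :
    triple x z l + triple x' z' l' = triple (x + x') (z + z') (l + l') := rfl

theorem triple_smul (a : ℝ) (x : Profile n) (z l : Dual N m) :
    a • triple x z l = triple (a • x) (a • z) (a • l) := rfl

theorem inner_primalDual (u v : PrimalDual n m) :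
    inner ℝ u v = inner ℝ (primal u) (primal v) + inner ℝ (auxil u) (auxil v)
      + inner ℝ (dual u) (dual v) := by
  rw [add_assoc]; rfl

theorem continuous_triple {X : Type*} [TopologicalSpace X] {f : X → Profile n} {g h : X → Dual N m}
    {s : Set X} (hf : ContinuousOn f s) (hg : ContinuousOn g s) (hh : ContinuousOn h s) :
    ContinuousOn (fun a => triple (f a) (g a) (h a)) s :=
  (WithLp.prod_continuous_toLp 2 _ _).comp_continuousOn
    (hf.prodMk ((WithLp.prod_continuous_toLp 2 _ _).comp_continuousOn (hg.prodMk hh)))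

/-- Blockwise scaling of a profile. -/
def scaleMap {n : Fin N → ℕ} (a : Fin N → ℝ) : Profile n →L[ℝ] Profile n :=
  LinearMap.toContinuousLinearMap
    { toFun := fun x => WithLp.toLp 2 fun i => a i • x i
      map_add' := fun _ _ => PiLp.ext fun _ => smul_add _ _ _
      map_smul' := fun c x => PiLp.ext fun i => smul_comm (a i) c (x i) }

theorem scaleMap_apply (a : Fin N → ℝ) (x : Profile n) (i : Fin N) :
    scaleMap a x i = a i • x i := rfl

theorem inner_scaleMap (a : Fin N → ℝ) (x y : Profile n) :
    inner ℝ (scaleMap a x) y = inner ℝ x (scaleMap a y) := by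
  simp only [PiLp.inner_apply (𝕜 := ℝ) (ι := Fin N), scaleMap_apply, real_inner_smul_left,
    real_inner_smul_right]

/-- The preconditioner as an operator on triples. -/
def Game.precondMap (G : Game N m d n) (W : Matrix (Fin N) (Fin N) ℝ) (s : Steps N) :
    PrimalDual n m →L[ℝ] PrimalDual n m :=
  LinearMap.toContinuousLinearMap
    { toFun := fun u => triple
        (scaleMap (fun i => (s.α i)⁻¹) (primal u) - G.localMapT (dual u))
        (scaleMap (fun i => (s.ν i)⁻¹) (auxil u) - lapMap m W (dual u))
        (scaleMap (fun i => (s.σ i)⁻¹) (dual u) - G.localMap (primal u) - lapMap m W (auxil u))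
      map_add' := fun u v => by
        simp only [map_add, triple_add]
        congr 1 <;> abel
      map_smul' := fun a u => by
        simp only [map_smul, triple_smul, smul_sub, RingHom.id_apply] }

variable (G : Game N m d n) {Γ : SimpleGraph (Fin N)} {W : Matrix (Fin N) (Fin N) ℝ} (s : Steps N)

theorem Game.precondMap_eq (u : PrimalDual n m) : G.precondMap W s u = triple
    (scaleMap (fun i => (s.α i)⁻¹) (primal u) - G.localMapT (dual u))
    (scaleMap (fun i => (s.ν i)⁻¹) (auxil u) - lapMap m W (dual u))
    (scaleMap (fun i => (s.σ i)⁻¹) (dual u) - G.localMap (primal u) - lapMap m W (auxil u)) := rfl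

theorem Game.precondMap_symm (hW : IsWeightedAdj Γ W) (u v : PrimalDual n m) :
    inner ℝ (G.precondMap W s u) v = inner ℝ u (G.precondMap W s v) := by
  simp only [inner_primalDual, Game.precondMap_eq, primal_triple, auxil_triple, dual_triple,
    inner_sub_left, inner_sub_right, inner_scaleMap, hW.lapMap_symm, Game.inner_localMap]
  rw [real_inner_comm (primal v) (G.localMapT (dual u)), ← Game.inner_localMap,
    real_inner_comm (dual u) (G.localMap (primal v))]
  ring

/-- Coordinates of a triple, indexed as the rows of the preconditioning matrix. -/
def coords (u : PrimalDual n m) :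
    ((i : Fin N) × Fin (n i)) ⊕ ((Fin N × Fin m) ⊕ (Fin N × Fin m)) → ℝ :=
  Sum.elim (fun q => primal u q.1 q.2)
    (Sum.elim (fun p => auxil u p.1 p.2) (fun p => dual u p.1 p.2))

theorem Profile.inner_eq_sum (x y : Profile n) : inner ℝ x y = ∑ i, ∑ c, x i c * y i c := by
  rw [PiLp.inner_apply]
  refine Finset.sum_congr rfl fun i _ => ?_
  rw [PiLp.inner_apply]
  exact Finset.sum_congr rfl fun c _ => mul_comm _ _

theorem coords_dotProduct (u v : PrimalDual n m) : coords u ⬝ᵥ coords v = inner ℝ u v := by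
  rw [inner_primalDual, add_assoc, Profile.inner_eq_sum, Profile.inner_eq_sum,
    Profile.inner_eq_sum]
  simp only [coords, dotProduct, Fintype.sum_sum_type, Sum.elim_inl, Sum.elim_inr,
    Fintype.sum_sigma, Fintype.sum_prod_type]

theorem Lbold_mulVec (z : Dual N m) (p : Fin N × Fin m) :
    (Game.Lbold m W *ᵥ fun p => z p.1 p.2) p = lapMap m W z p.1 p.2 := by
  rcases p with ⟨i, r⟩
  have h1 : lapMap m W z i r = ∑ j, W i j * (z i r - z j r) := by
    rw [lapMap_apply]; simp
  rw [h1]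
  simp only [Matrix.mulVec, dotProduct, Game.Lbold, Fintype.sum_prod_type,
    Matrix.kroneckerMap_apply, Matrix.one_apply, lap, Matrix.sub_apply, Matrix.diagonal_apply, deg]
  simp [mul_sub, sub_mul, Finset.sum_mul, Finset.sum_sub_distrib]

theorem Game.Abold_mulVec (x : Profile n) (p : Fin N × Fin m) :
    (G.Abold *ᵥ fun q => x q.1 q.2) p = G.localMap x p.1 p.2 := by
  rcases p with ⟨i, r⟩
  rw [Game.localMap_apply, act_apply]
  simp only [Matrix.mulVec, dotProduct, Game.Abold, Fintype.sum_sigma, ite_mul, zero_mul]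
  rw [Finset.sum_eq_single i]
  · simp
  · intro j _ hj
    simp [hj.symm]
  · simp

theorem Game.Abold_transpose_mulVec (l : Dual N m) (q : (i : Fin N) × Fin (n i)) :
    (G.Aboldᵀ *ᵥ fun p => l p.1 p.2) q = G.localMapT l q.1 q.2 := by
  rcases q with ⟨i, c⟩
  rw [Game.localMapT_apply, act_apply]
  simp only [Matrix.mulVec, dotProduct, Game.Abold, Fintype.sum_prod_type, ite_mul, zero_mul,
    Matrix.transpose_apply]
  rw [Finset.sum_eq_single i]
  · simp
  · intro j _ hj
    simp [hj]
  · simp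

/-- Links the matrix whose inverse norm is assumed small with the operator that acts on triples. -/
theorem Game.precond_mulVec_coords (u : PrimalDual n m) :
    G.precond W s *ᵥ coords u = coords (G.precondMap W s u) := by
  rw [Game.precond, coords, Matrix.fromBlocks_mulVec]
  simp only [Sum.elim_comp_inl, Sum.elim_comp_inr, Matrix.fromCols_mulVec, Matrix.fromRows_mulVec,
    Matrix.fromBlocks_mulVec, Matrix.zero_mulVec, Matrix.neg_mulVec, Game.precondMap_eq]
  ext p
  rcases p with q | p | p
  · simp only [Sum.elim_inl, Pi.add_apply, Pi.neg_apply, Matrix.mulVec_diagonal, coords,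
      primal_triple, Game.Abold_transpose_mulVec, zero_add]
    exact (sub_eq_add_neg _ _).symm
  · simp only [Sum.elim_inl, Sum.elim_inr, Pi.add_apply, Pi.neg_apply, Matrix.mulVec_diagonal,
      coords, auxil_triple, Lbold_mulVec, Pi.zero_apply, zero_add]
    exact (sub_eq_add_neg _ _).symm
  · simp only [Sum.elim_inr, Pi.add_apply, Pi.neg_apply, Matrix.mulVec_diagonal,
      coords, dual_triple, Lbold_mulVec, Game.Abold_mulVec, PiLp.sub_apply, scaleMap_apply,
      PiLp.smul_apply, smul_eq_mul]
    ring

theorem lap_symm (hW : IsWeightedAdj Γ W) : (lap W).IsSymm := by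
  rw [Matrix.IsSymm, lap, Matrix.transpose_sub, Matrix.diagonal_transpose, hW.symm.eq]

theorem Lbold_symm (hW : IsWeightedAdj Γ W) : (Game.Lbold m W).IsSymm := by
  ext p q
  have := (lap_symm hW).apply p.1 q.1
  simp only [Matrix.transpose_apply, Game.Lbold, Matrix.kroneckerMap_apply, Matrix.one_apply]
  rw [this]
  simp only [eq_comm]

/-- The graph has no loops, so the diagonal contributes `d_i` and the other entries contribute `d_i`
again. This is the `2 d_i` in the step-size bounds. -/
theorem sum_abs_lap (hW : IsWeightedAdj Γ W) (i : Fin N) : ∑ j, |lap W i j| = 2 * deg W i := by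
  have hd : 0 ≤ deg W i := Finset.sum_nonneg fun j _ => hW.nonneg i j
  have hii : W i i = 0 := hW.zero i i (Γ.loopless.irrefl i)
  have h1 : ∀ j, |lap W i j| = (if i = j then deg W i else 0) + W i j := by
    intro j
    rw [lap, Matrix.sub_apply, Matrix.diagonal_apply]
    split_ifs with h
    · subst h
      rw [hii, sub_zero, add_zero, abs_of_nonneg hd]
    · rw [zero_sub, abs_neg, abs_of_nonneg (hW.nonneg i j), zero_add]
  simp only [h1, Finset.sum_add_distrib]
  simp only [Finset.sum_ite_eq, Finset.mem_univ, if_true]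
  change deg W i + deg W i = _
  ring

theorem sum_abs_Lbold (hW : IsWeightedAdj Γ W) (p : Fin N × Fin m) :
    ∑ q, |Game.Lbold m W p q| = 2 * deg W p.1 := by
  rw [← sum_abs_lap hW, Fintype.sum_prod_type]
  refine Finset.sum_congr rfl fun j _ => ?_
  simp [Game.Lbold, Matrix.kroneckerMap_apply, Matrix.one_apply, apply_ite abs]

theorem Game.sum_abs_Abold (p : Fin N × Fin m) :
    ∑ q, |G.Abold p q| = ∑ c, |G.A p.1 p.2 c| := by
  rcases p with ⟨i, r⟩
  simp only [Game.Abold, Fintype.sum_sigma]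
  rw [Finset.sum_eq_single i]
  · simp
  · intro j _ hj
    simp [hj.symm]
  · simp

theorem Game.sum_abs_Abold_transpose (q : (i : Fin N) × Fin (n i)) :
    ∑ p, |G.Abold p q| = ∑ r, |G.A q.1 r q.2| := by
  rcases q with ⟨i, c⟩
  simp only [Game.Abold, Fintype.sum_prod_type]
  rw [Finset.sum_eq_single i]
  · simp
  · intro j _ hj
    simp [hj]
  · simp

/-- The bounds on `α`, `ν`, `σ` say that each row of `Φ` is diagonally dominant with margin `γ`.
Thus `Φ` is positive definite, and the norm of its inverse controls the form from below. -/
theorem Game.norm_sq_le_precondMap (hW : IsWeightedAdj Γ W) {γ θ : ℝ} (hγ : 0 < γ) {s : Steps N}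
    (hs : G.StepBounds W γ θ s) (u : PrimalDual n m) :
    ‖u‖ ^ 2 ≤ ‖Matrix.toEuclideanCLM (𝕜 := ℝ) (G.precond W s)⁻¹‖
      * inner ℝ (G.precondMap W s u) u := by
  classical
  set δ : ((i : Fin N) × Fin (n i)) ⊕ ((Fin N × Fin m) ⊕ (Fin N × Fin m)) → ℝ :=
    Sum.elim (fun q => (s.α q.1)⁻¹) (Sum.elim (fun p => (s.ν p.1)⁻¹) fun p => (s.σ p.1)⁻¹)
  set R : Matrix (((i : Fin N) × Fin (n i)) ⊕ ((Fin N × Fin m) ⊕ (Fin N × Fin m)))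
      (((i : Fin N) × Fin (n i)) ⊕ ((Fin N × Fin m) ⊕ (Fin N × Fin m))) ℝ :=
    Matrix.fromBlocks 0 (Matrix.fromCols 0 (-(G.Abold)ᵀ)) (Matrix.fromRows 0 (-G.Abold))
      (Matrix.fromBlocks 0 (-Lbold m W) (-Lbold m W) 0)
  have hP : G.precond W s = Matrix.diagonal δ + R := by
    simp only [Game.precond, δ, R, ← Matrix.fromBlocks_diagonal, Matrix.fromBlocks_add, add_zero,
      zero_add]
  have hL := Lbold_symm (m := m) hW
  have hR : R.IsSymm := by
    have h1 : (Matrix.fromBlocks 0 (-Lbold m W) (-Lbold m W) 0 :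
        Matrix ((Fin N × Fin m) ⊕ (Fin N × Fin m)) _ ℝ).IsSymm := by
      rw [Matrix.IsSymm, Matrix.fromBlocks_transpose, Matrix.transpose_neg, hL.eq]
      simp
    rw [Matrix.IsSymm, Matrix.fromBlocks_transpose, h1.eq, Matrix.transpose_fromCols,
      Matrix.transpose_fromRows]
    simp [R]
  have hdeg : ∀ i, 0 ≤ deg W i := fun i => Finset.sum_nonneg fun j _ => hW.nonneg i j
  have hd : ∀ i, γ + ∑ j, |R i j| ≤ δ i := by
    rintro (q | p | p)
    · have h1 : ∑ j, |R (Sum.inl q) j| = ∑ r, |G.A q.1 r q.2| := by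
        simp only [R, Fintype.sum_sum_type, Matrix.fromBlocks_apply₁₁, Matrix.fromBlocks_apply₁₂,
          Matrix.fromCols_apply_inl, Matrix.fromCols_apply_inr, Matrix.zero_apply, abs_zero,
          Finset.sum_const_zero, zero_add, Matrix.neg_apply, Matrix.transpose_apply, abs_neg,
          Game.sum_abs_Abold_transpose]
      have h2 : ∑ r, |G.A q.1 r q.2| ≤ ⨆ c : Fin (n q.1), ∑ r : Fin m, |(G.A q.1)ᵀ c r| :=
        le_ciSup (f := fun c : Fin (n q.1) => ∑ r : Fin m, |(G.A q.1)ᵀ c r|)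
          (Set.finite_range _).bddAbove q.2
      have h3 : 0 ≤ ∑ r, |G.A q.1 r q.2| := Finset.sum_nonneg fun _ _ => abs_nonneg _
      have h4 := (le_inv_comm₀ (hs.α_pos q.1) (by linarith)).1 (hs.α_le q.1)
      rw [h1]
      change _ ≤ (s.α q.1)⁻¹
      linarith
    · have h1 : ∑ j, |R (Sum.inr (Sum.inl p)) j| = 2 * deg W p.1 := by
        simp only [R, Fintype.sum_sum_type, Matrix.fromBlocks_apply₂₁, Matrix.fromBlocks_apply₂₂,
          Matrix.fromBlocks_apply₁₁, Matrix.fromBlocks_apply₁₂,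
          Matrix.fromRows_apply_inl, Matrix.zero_apply, abs_zero,
          Finset.sum_const_zero, zero_add, Matrix.neg_apply, abs_neg, sum_abs_Lbold hW]
      have h4 := (le_inv_comm₀ (hs.ν_pos p.1) (by linarith [hdeg p.1])).1 (hs.ν_le p.1)
      rw [h1]
      exact h4
    · have h1 : ∑ j, |R (Sum.inr (Sum.inr p)) j| = ∑ c, |G.A p.1 p.2 c| + 2 * deg W p.1 := by
        simp only [R, Fintype.sum_sum_type, Matrix.fromBlocks_apply₂₁, Matrix.fromBlocks_apply₂₂,
          Matrix.fromRows_apply_inr, Matrix.zero_apply, abs_zero,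
          Finset.sum_const_zero, add_zero, Matrix.neg_apply, abs_neg, sum_abs_Lbold hW,
          Game.sum_abs_Abold]
      have h2 : ∑ c, |G.A p.1 p.2 c| ≤ ⨆ r : Fin m, ∑ c : Fin (n p.1), |G.A p.1 r c| :=
        le_ciSup (f := fun r : Fin m => ∑ c : Fin (n p.1), |G.A p.1 r c|)
          (Set.finite_range _).bddAbove p.2
      have h3 : 0 ≤ ∑ c, |G.A p.1 p.2 c| := Finset.sum_nonneg fun _ _ => abs_nonneg _
      have h4 := (le_inv_comm₀ (hs.σ_pos p.1) (by linarith [hdeg p.1])).1 (hs.σ_le p.1)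
      rw [h1]
      change _ ≤ (s.σ p.1)⁻¹
      linarith
  have hsymm : (G.precond W s).IsSymm := by
    rw [hP]; exact (Matrix.isSymm_diagonal δ).add hR
  have h1 := norm_inv_quadratic_form hsymm hγ
    (fun y => by rw [hP]; exact dominant_quadratic_form hR hd y) (coords u)
  rw [Game.precond_mulVec_coords, coords_dotProduct, coords_dotProduct,
    real_inner_self_eq_norm_sq, real_inner_comm] at h1
  exact h1

end Preconditioner

/-! ### Convex structure of the game and the KKT operator -/

section ConvexGame

variable {N m d : ℕ} {n : Fin N → ℕ} {G : Game N m d n}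

namespace Game

/-- The local cost `gᵢ` as a real-valued function, meaningful on its domain. -/
def gReal (G : Game N m d n) (i : Fin N) (y : Vec (n i)) : ℝ := (G.g i y).toReal

/-- The total cost `∑ᵢ gᵢ(xᵢ)` as a real-valued function, meaningful on `Ω`. -/
def gSum (G : Game N m d n) (x : Profile n) : ℝ := ∑ i, G.gReal i (x i)

namespace Standing

theorem coe_gReal (hG : G.Standing) {i : Fin N} {y : Vec (n i)} (hy : y ∈ G.dom i) :
    (G.gReal i y : EReal) = G.g i y :=
  EReal.coe_toReal (ne_of_lt hy) (hG.g_ne_bot i y)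

theorem gReal_le_of_le (hG : G.Standing) {i : Fin N} {y : Vec (n i)} {c : ℝ}
    (h : G.g i y ≤ (c : EReal)) : y ∈ G.dom i ∧ G.gReal i y ≤ c := by
  have hy : y ∈ G.dom i := lt_of_le_of_lt h (EReal.coe_lt_top c)
  refine ⟨hy, ?_⟩
  rw [← hG.coe_gReal hy] at h
  exact_mod_cast h

theorem convexOn_gReal (hG : G.Standing) (i : Fin N) : ConvexOn ℝ (G.dom i) (G.gReal i) := by
  have key : ∀ y ∈ G.dom i, ∀ z ∈ G.dom i, ∀ a b : ℝ, 0 ≤ a → 0 ≤ b → a + b = 1 →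
      a • y + b • z ∈ G.dom i ∧
        G.gReal i (a • y + b • z) ≤ a • G.gReal i y + b • G.gReal i z := by
    intro y hy z hz a b ha hb hab
    have h1 := hG.g_convex i (x := (y, G.gReal i y)) (hG.coe_gReal hy).ge
      (y := (z, G.gReal i z)) (hG.coe_gReal hz).ge ha hb hab
    exact hG.gReal_le_of_le h1
  exact ⟨fun y hy z hz a b ha hb hab => (key y hy z hz a b ha hb hab).1,
    fun y hy z hz a b ha hb hab => (key y hy z hz a b ha hb hab).2⟩

theorem lowerSemicontinuousOn_gReal (hG : G.Standing) (i : Fin N) :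
    LowerSemicontinuousOn (G.gReal i) (G.dom i) := by
  intro y hy c hc
  have h1 : (c : EReal) < G.g i y := by
    rw [← hG.coe_gReal hy]; exact_mod_cast hc
  filter_upwards [mem_nhdsWithin_of_mem_nhds (hG.g_lsc i y _ h1), self_mem_nhdsWithin] with z hz hzd
  rw [← hG.coe_gReal hzd] at hz
  exact_mod_cast hz

/-- The proximal point is attained in the domain and minimizes the real-valued objective. -/
theorem prox_spec (hG : G.Standing) (i : Fin N) (a : ℝ) (v : Vec (n i)) :
    prox a (G.g i) v ∈ G.dom i ∧ ∀ w ∈ G.dom i,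
      G.gReal i (prox a (G.g i) v) + ‖prox a (G.g i) v - v‖ ^ 2 / (2 * a)
        ≤ G.gReal i w + ‖w - v‖ ^ 2 / (2 * a) := by
  obtain ⟨u, hu, hmin⟩ := exists_prox (hG.dom_compact i) (hG.dom_nonempty i)
    (hG.lowerSemicontinuousOn_gReal i) a v
  -- The choice operator in `prox` returns a minimizer only once one is known to exist; outside the
  -- domain the objective is `⊤`, so the real-valued minimizer is global.
  have hex : ∃ u, ∀ w, G.g i u + ((‖u - v‖ ^ 2 / (2 * a) : ℝ) : EReal)
      ≤ G.g i w + ((‖w - v‖ ^ 2 / (2 * a) : ℝ) : EReal) := by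
    refine ⟨u, fun w => ?_⟩
    by_cases hw : w ∈ G.dom i
    · rw [← hG.coe_gReal hu, ← hG.coe_gReal hw]
      exact_mod_cast hmin w hw
    · have : G.g i w = ⊤ := not_lt_top_iff.1 hw
      rw [this, EReal.top_add_coe]
      exact le_top
  have hspec : ∀ w, G.g i (prox a (G.g i) v) + ((‖prox a (G.g i) v - v‖ ^ 2 / (2 * a) : ℝ) : EReal)
      ≤ G.g i w + ((‖w - v‖ ^ 2 / (2 * a) : ℝ) : EReal) := Classical.epsilon_spec hex
  have hmem : prox a (G.g i) v ∈ G.dom i := by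
    by_contra hc
    have h1 : G.g i (prox a (G.g i) v) = ⊤ := not_lt_top_iff.1 hc
    have h2 := hspec u
    rw [h1, EReal.top_add_coe, ← hG.coe_gReal hu, ← EReal.coe_add, top_le_iff] at h2
    exact EReal.coe_ne_top _ h2
  refine ⟨hmem, fun w hw => ?_⟩
  have h2 := hspec w
  rw [← hG.coe_gReal hmem, ← hG.coe_gReal hw] at h2
  exact_mod_cast h2

theorem prox_inequality (hG : G.Standing) (i : Fin N) {a : ℝ} (ha : 0 < a) (v : Vec (n i))
    {y : Vec (n i)} (hy : y ∈ G.dom i) : G.gReal i (prox a (G.g i) v)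
      + inner ℝ (v - prox a (G.g i) v) (y - prox a (G.g i) v) / a ≤ G.gReal i y :=
  prox_variational (hG.convexOn_gReal i).1 (hG.convexOn_gReal i) ha (hG.prox_spec i a v).1
    (hG.prox_spec i a v).2 hy

theorem continuous_prox (hG : G.Standing) (i : Fin N) {a : ℝ} (ha : 0 < a) :
    Continuous (prox a (G.g i)) := by
  have : LipschitzWith 1 (prox a (G.g i)) := LipschitzWith.of_dist_le_mul fun v w => by
    rw [NNReal.coe_one, one_mul, dist_eq_norm, dist_eq_norm]
    exact prox_nonexpansive ha (hG.prox_inequality i ha v (hG.prox_spec i a w).1)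
      (hG.prox_inequality i ha w (hG.prox_spec i a v).1)
  exact this.continuous

theorem isCompact_domAll (hG : G.Standing) : IsCompact G.domAll := by
  have h1 := (isCompact_univ_pi hG.dom_compact).image
    (PiLp.continuous_toLp 2 fun i : Fin N => Vec (n i))
  convert h1 using 1
  ext x
  constructor
  · intro hx
    exact ⟨x.ofLp, fun i _ => hx i, rfl⟩
  · rintro ⟨y, hy, rfl⟩
    exact fun i => hy i (Set.mem_univ i)

theorem convexOn_gSum (hG : G.Standing) : ConvexOn ℝ G.domAll G.gSum := by
  refine ⟨fun x hx y hy a b ha hb hab i => (hG.convexOn_gReal i).1 (hx i) (hy i) ha hb hab,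
    fun x hx y hy a b ha hb hab => ?_⟩
  simp only [gSum, Finset.smul_sum, ← Finset.sum_add_distrib]
  exact Finset.sum_le_sum fun i _ => (hG.convexOn_gReal i).2 (hx i) (hy i) ha hb hab

theorem lowerSemicontinuousOn_gSum (hG : G.Standing) :
    LowerSemicontinuousOn G.gSum G.domAll := by
  change LowerSemicontinuousOn (fun x : Profile n => ∑ i, G.gReal i (x i)) _
  refine lowerSemicontinuousOn_sum fun i _ => ?_
  intro x hx c hc
  have hc1 : Continuous fun x : Profile n => x i := PiLp.continuous_apply 2 _ i
  exact (hc1.continuousWithinAt.tendsto_nhdsWithin fun y (hy : y ∈ G.domAll) => hy i).eventually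
    (hG.lowerSemicontinuousOn_gReal i (x i) (hx i) c hc)

theorem coe_gSum (hG : G.Standing) {x : Profile n} (hx : x ∈ G.domAll) :
    ∑ i, G.g i (x i) = (G.gSum x : EReal) := by
  have key : ∀ s : Finset (Fin N),
      ∑ i ∈ s, G.g i (x i) = ((∑ i ∈ s, G.gReal i (x i) : ℝ) : EReal) := by
    intro s
    induction s using Finset.induction_on with
    | empty => simp
    | insert i s hi ih =>
      rw [Finset.sum_insert hi, Finset.sum_insert hi, EReal.coe_add, ih, hG.coe_gReal (hx i)]
  exact key _

theorem mem_sol_iff (hG : G.Standing) {xs : Profile n} : xs ∈ G.sol ↔ xs ∈ G.feasible ∧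
    ∀ x ∈ G.feasible, G.gSum xs ≤ inner ℝ (G.pseudograd xs) (x - xs) + G.gSum x := by
  refine and_congr_right fun hxs => forall₂_congr fun x hx => ?_
  rw [hG.coe_gSum hxs.1, hG.coe_gSum hx.1]
  exact_mod_cast Iff.rfl

theorem coupling_apply (x : Profile n) (r : Fin m) :
    G.coupling x r = ∑ i, ∑ c, G.A i r c * x i c := by
  simp [coupling, act_apply]

theorem isCompact_feasible (hG : G.Standing) : IsCompact G.feasible := by
  have h1 : IsClosed {x : Profile n | ∀ r, G.coupling x r ≤ G.bTot r} := by
    simp only [Set.ofPred_forall]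
    refine isClosed_iInter fun r => isClosed_le ?_ continuous_const
    simp only [coupling_apply]
    fun_prop
  exact hG.isCompact_domAll.inter_right h1

theorem convexOn_coupling (hG : G.Standing) (r : Fin m) :
    ConvexOn ℝ G.domAll fun x => G.coupling x r - G.bTot r := by
  refine ⟨hG.convexOn_gSum.1, fun x _ y _ a b _ _ hab => le_of_eq ?_⟩
  have h1 : G.coupling (a • x + b • y) r = a * G.coupling x r + b * G.coupling y r := by
    simp only [coupling_apply, Finset.mul_sum, ← Finset.sum_add_distrib]
    refine Finset.sum_congr rfl fun i _ => Finset.sum_congr rfl fun c _ => ?_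
    simp
    ring
  simp only [h1, smul_eq_mul]
  linear_combination (G.bTot r) * hab

theorem convex_feasible (hG : G.Standing) : Convex ℝ G.feasible := by
  have h1 : G.feasible = G.domAll ∩ ⋂ r, {x ∈ G.domAll | G.coupling x r - G.bTot r ≤ 0} := by
    ext x
    simp only [feasible, Set.mem_inter_iff, Set.mem_iInter]
    refine and_congr_right fun hx => forall_congr' fun r => ?_
    change _ ↔ x ∈ G.domAll ∧ G.coupling x r - G.bTot r ≤ 0
    simp [hx]
  rw [h1]
  exact hG.convexOn_gSum.1.inter (convex_iInter fun r => (hG.convexOn_coupling r).convex_le 0)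

/-- Restricted cocoercivity and Fejér monotonicity need a solution as reference point. Compactness
of the feasible set, nonempty by Slater's condition, provides one. -/
theorem exists_mem_sol (hG : G.Standing) : ∃ xs, xs ∈ G.sol := by
  have hsub : G.feasible ⊆ G.domAll := fun x hx => hx.1
  obtain ⟨x₀, hx₀, hsl⟩ := hG.slater
  obtain ⟨xs, hxs, hv⟩ := exists_variational_solution hG.isCompact_feasible
    ⟨x₀, hx₀, fun r => (hsl r).le⟩ (hG.convexOn_gSum.subset hsub hG.convex_feasible)
    (hG.lowerSemicontinuousOn_gSum.mono hsub) (hG.pseudograd_continuous.mono hsub)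
  exact ⟨xs, hG.mem_sol_iff.2 ⟨hxs, hv⟩⟩

end Standing

/-- The maximally monotone part of the KKT operator, as a relation. -/
def MonotonePart (G : Game N m d n) (W : Matrix (Fin N) (Fin N) ℝ) (u v : PrimalDual n m) : Prop :=
  primal u ∈ G.domAll ∧
  (∀ y ∈ G.domAll, G.gSum (primal u)
    + inner ℝ (primal v - G.localMapT (dual u)) (y - primal u) ≤ G.gSum y) ∧
  auxil v = lapMap m W (dual u) ∧
  (∀ i r, 0 ≤ dual u i r) ∧
  ∀ l : Dual N m, (∀ i r, 0 ≤ l i r) →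
    inner ℝ (dual v + G.localMap (primal u) + lapMap m W (auxil u)) (l - dual u) ≤ 0

/-- The single-valued part of the KKT operator. -/
def smoothPart (G : Game N m d n) (W : Matrix (Fin N) (Fin N) ℝ) (u : PrimalDual n m) :
    PrimalDual n m :=
  triple (G.pseudograd (primal u)) 0 (lapMap m W (dual u) + WithLp.toLp 2 G.b)

variable {Γ : SimpleGraph (Fin N)} {W : Matrix (Fin N) (Fin N) ℝ}

/-- Each variational inequality is tested at the other point. Adding them cancels the costs, and the
`A` and `L` terms cancel in pairs by adjointness: the coupling is skew. -/
theorem MonotonePart.monotone (hW : IsWeightedAdj Γ W) {u v u' v' : PrimalDual n m}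
    (h : G.MonotonePart W u v) (h' : G.MonotonePart W u' v') : 0 ≤ inner ℝ (v - v') (u - u') := by
  obtain ⟨hx, hg, hz, hl, hp⟩ := h
  obtain ⟨hx', hg', hz', hl', hp'⟩ := h'
  have h1 := hg _ hx'
  have h2 := hg' _ hx
  have h3 := hp _ hl'
  have h4 := hp' _ hl
  rw [inner_primalDual]
  simp only [map_sub, hz, hz']
  have e1 : inner ℝ (G.localMap (primal u)) (dual u' - dual u)
      = inner ℝ (primal u) (G.localMapT (dual u')) - inner ℝ (primal u) (G.localMapT (dual u)) := by
    rw [G.inner_localMap, map_sub, inner_sub_right]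
  have e2 : inner ℝ (G.localMap (primal u')) (dual u - dual u')
      = inner ℝ (primal u') (G.localMapT (dual u))
        - inner ℝ (primal u') (G.localMapT (dual u')) := by
    rw [G.inner_localMap, map_sub, inner_sub_right]
  have e3 : inner ℝ (lapMap m W (auxil u)) (dual u' - dual u)
      = inner ℝ (auxil u) (lapMap m W (dual u')) - inner ℝ (auxil u) (lapMap m W (dual u)) := by
    rw [hW.lapMap_symm, map_sub, inner_sub_right]
  have e4 : inner ℝ (lapMap m W (auxil u')) (dual u - dual u')
      = inner ℝ (auxil u') (lapMap m W (dual u)) - inner ℝ (auxil u') (lapMap m W (dual u')) := by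
    rw [hW.lapMap_symm, map_sub, inner_sub_right]
  rw [inner_add_left, inner_add_left, e1, e3] at h3
  rw [inner_add_left, inner_add_left, e2, e4] at h4
  simp only [inner_sub_left, inner_sub_right] at h1 h2 h3 h4 ⊢
  rw [real_inner_comm (primal u) (G.localMapT (dual u)),
    real_inner_comm (primal u') (G.localMapT (dual u))] at h1
  rw [real_inner_comm (primal u) (G.localMapT (dual u')),
    real_inner_comm (primal u') (G.localMapT (dual u'))] at h2
  rw [real_inner_comm (auxil u) (lapMap m W (dual u)),
    real_inner_comm (auxil u') (lapMap m W (dual u)),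
    real_inner_comm (auxil u) (lapMap m W (dual u')),
    real_inner_comm (auxil u') (lapMap m W (dual u'))]
  linarith

/-- All conditions are closed under limits. Lower semicontinuity of `∑ g_i` suffices because its
value at the moving point stands on the smaller side. -/
theorem MonotonePart.of_tendsto (hG : G.Standing) {u v : ℕ → PrimalDual n m}
    {u' v' : PrimalDual n m} (h : ∀ k, G.MonotonePart W (u k) (v k))
    (hu : Tendsto u atTop (𝓝 u')) (hv : Tendsto v atTop (𝓝 v')) : G.MonotonePart W u' v' := by
  have tx := (primal.continuous.tendsto u').comp hu
  have tz := (auxil.continuous.tendsto u').comp hu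
  have tl := (dual.continuous.tendsto u').comp hu
  have sx := (primal.continuous.tendsto v').comp hv
  have sz := (auxil.continuous.tendsto v').comp hv
  have sl := (dual.continuous.tendsto v').comp hv
  have hx' : primal u' ∈ G.domAll :=
    hG.isCompact_domAll.isClosed.mem_of_tendsto tx (Eventually.of_forall fun k => (h k).1)
  refine ⟨hx', fun y hy => ?_, ?_, fun i r => ?_, fun l hl => ?_⟩
  · have t1 := (sx.sub ((G.localMapT.continuous.tendsto _).comp tl)).inner (𝕜 := ℝ)
      ((tendsto_const_nhds (x := y)).sub tx)
    have t2 : Tendsto (fun k => G.gSum y - inner ℝ (primal (v k) - G.localMapT (dual (u k)))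
        (y - primal (u k))) atTop
        (𝓝 (G.gSum y - inner ℝ (primal v' - G.localMapT (dual u')) (y - primal u'))) :=
      tendsto_const_nhds.sub t1
    by_contra hc
    push Not at hc
    obtain ⟨c, hc1, hc2⟩ := exists_between (sub_lt_iff_lt_add.2 hc)
    have h1 : ∀ᶠ k in atTop, c < G.gSum (primal (u k)) :=
      (tendsto_nhdsWithin_iff.2 ⟨tx, Eventually.of_forall fun k => (h k).1⟩).eventually
        (hG.lowerSemicontinuousOn_gSum _ hx' c hc2)
    have h2 := t2.eventually_lt_const hc1
    obtain ⟨k, hk1, hk2⟩ := (h1.and h2).exists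
    linarith [(h k).2.1 y hy]
  · exact tendsto_nhds_unique sz
      (((lapMap m W).continuous.tendsto _).comp tl |>.congr fun k => ((h k).2.2.1).symm)
  · have t1 : Tendsto (fun k => dual (u k) i r) atTop (𝓝 (dual u' i r)) := by
      have c1 : Continuous fun l : Dual N m => l i r := by fun_prop
      exact (c1.tendsto _).comp tl
    exact ge_of_tendsto' t1 fun k => (h k).2.2.2.1 i r
  · have t1 := ((sl.add ((G.localMap.continuous.tendsto _).comp tx)).add
      (((lapMap m W).continuous.tendsto _).comp tz)).inner (𝕜 := ℝ)
      ((tendsto_const_nhds (x := l)).sub tl)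
    exact le_of_tendsto' t1 fun k => (h k).2.2.2.2 l hl

theorem smoothPart_continuousOn (hG : G.Standing) :
    ContinuousOn (G.smoothPart W) {u | primal u ∈ G.domAll} :=
  continuous_triple (hG.pseudograd_continuous.comp primal.continuous.continuousOn fun _ hu => hu)
    continuousOn_const (by fun_prop)

end Game

end ConvexGame

/-! ### Zeros of the KKT operator and the algorithm as a splitting step -/

section Optimality

variable {N m d : ℕ} {n : Fin N → ℕ} {G : Game N m d n} {Γ : SimpleGraph (Fin N)}
  {W : Matrix (Fin N) (Fin N) ℝ}

namespace Game

/-- Stacked local constraint vectors. -/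
def bStack (G : Game N m d n) : Dual N m := WithLp.toLp 2 G.b

theorem sum_localMap_sub_bStack (x : Profile n) (r : Fin m) :
    ∑ i, (G.localMap x - G.bStack) i r = G.coupling x r - G.bTot r := by
  have h1 : G.coupling x r = ∑ i, G.localMap x i r := by
    rw [coupling_eq_sum_localMap]; simp
  have h2 : G.bTot r = ∑ i, G.b i r := by simp [bTot]
  rw [h1, h2, ← Finset.sum_sub_distrib]
  rfl

/-- Pairing of a consensual multiplier with the constraints. -/
theorem inner_const_localMap_sub (l : Vec m) (x : Profile n) :
    inner ℝ (WithLp.toLp 2 fun _ => l : Dual N m) (G.localMap x - G.bStack)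
      = ∑ r, l r * (G.coupling x r - G.bTot r) := by
  rw [Profile.inner_eq_sum, Finset.sum_comm]
  refine Finset.sum_congr rfl fun r _ => ?_
  rw [← sum_localMap_sub_bStack, Finset.mul_sum]

/-- Zeros of the KKT operator have strategies solving the variational inequality. -/
theorem MonotonePart.primal_mem_sol (hG : G.Standing) (hW : IsWeightedAdj Γ W)
    (hΓ : Γ.Connected) {w : PrimalDual n m} (h : G.MonotonePart W w (-G.smoothPart W w)) :
    primal w ∈ G.sol := by
  obtain ⟨hx, hg, hz, hl, hp⟩ := h
  rw [map_neg] at hg hz hp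
  have hL : lapMap m W (dual w) = 0 := by
    rw [← hz]; exact neg_zero
  obtain ⟨i₀⟩ := hΓ.nonempty
  have hcons : dual w = (WithLp.toLp 2 fun _ => dual w i₀ : Dual N m) :=
    PiLp.ext fun i => hW.eq_of_lapMap_eq_zero hΓ hL i i₀
  have hdual : -dual (G.smoothPart W w) + G.localMap (primal w) + lapMap m W (auxil w)
      = (G.localMap (primal w) - G.bStack) + lapMap m W (auxil w) := by
    have : dual (G.smoothPart W w) = lapMap m W (dual w) + G.bStack := rfl
    rw [this, hL, zero_add]
    abel
  rw [hdual] at hp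
  -- Pairing with a consensual profile removes `Lz` and adds the local constraints up to the shared
  -- one.
  have hcp : ∀ (l : Vec m), inner ℝ (G.localMap (primal w) - G.bStack + lapMap m W (auxil w))
      (WithLp.toLp 2 fun _ => l : Dual N m)
        = ∑ r, l r * (G.coupling (primal w) r - G.bTot r) := by
    intro l
    rw [inner_add_left, hW.lapMap_symm, lapMap_const, inner_zero_right, add_zero,
      real_inner_comm, inner_const_localMap_sub]
  have hfeas : ∀ r, G.coupling (primal w) r ≤ G.bTot r := by
    intro r
    -- Raising coordinate `r` of all multipliers by one yields the `r`-th constraint.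
    have h1 := hp (dual w + WithLp.toLp 2 fun _ => EuclideanSpace.single r (1 : ℝ))
      fun i r' => add_nonneg (hl i r') (by
        change 0 ≤ (EuclideanSpace.single r (1 : ℝ) : Vec m) r'
        by_cases hr : r' = r <;> simp [hr])
    rw [add_sub_cancel_left, hcp] at h1
    simp at h1
    linarith
  have hcomp : ∑ r, dual w i₀ r * (G.coupling (primal w) r - G.bTot r) = 0 := by
    -- The tests `0` and `2λ` give both signs, hence complementary slackness.
    have h1 := hp 0 fun _ _ => le_rfl
    have h2 := hp (dual w + dual w) fun i r => add_nonneg (hl i r) (hl i r)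
    rw [zero_sub, inner_neg_right, hcons, hcp] at h1
    rw [add_sub_cancel_right, hcons, hcp] at h2
    linarith
  refine hG.mem_sol_iff.2 ⟨⟨hx, hfeas⟩, fun y hy => ?_⟩
  have h1 := hg y hy.1
  have h2 : inner ℝ (G.localMapT (dual w)) (y - primal w)
      = ∑ r, dual w i₀ r * (G.coupling y r - G.bTot r) := by
    have h3 : inner ℝ (G.localMapT (dual w)) (y - primal w)
        = inner ℝ (dual w) (G.localMap y - G.bStack)
          - inner ℝ (dual w) (G.localMap (primal w) - G.bStack) := by
      rw [real_inner_comm, ← G.inner_localMap, real_inner_comm, ← inner_sub_right, map_sub]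
      congr 1; abel
    rw [h3, hcons, inner_const_localMap_sub, inner_const_localMap_sub, hcomp, sub_zero]
  have h3 : ∑ r, dual w i₀ r * (G.coupling y r - G.bTot r) ≤ 0 :=
    Finset.sum_nonpos fun r _ => mul_nonpos_of_nonneg_of_nonpos (hl i₀ r) (by linarith [hy.2 r])
  have h4 : primal (G.smoothPart W w) = G.pseudograd (primal w) := rfl
  rw [h4, inner_sub_left, inner_neg_left, h2] at h1
  linarith

/-- Solutions of the variational inequality extend to zeros of the KKT operator. -/
theorem exists_zero_of_mem_sol (hG : G.Standing) (hW : IsWeightedAdj Γ W) (hΓ : Γ.Connected)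
    {xs : Profile n} (hxs : xs ∈ G.sol) :
    ∃ w : PrimalDual n m, G.MonotonePart W w (-G.smoothPart W w) := by
  obtain ⟨hfeas, hvi⟩ := hG.mem_sol_iff.1 hxs
  obtain ⟨x₀, hx₀, hsl⟩ := hG.slater
  have hlin : ConvexOn ℝ G.domAll fun x => inner ℝ (G.pseudograd xs) x :=
    ⟨hG.convexOn_gSum.1, fun x _ y _ a b _ _ _ => le_of_eq (by
      simp only [inner_add_right, inner_smul_right, smul_eq_mul])⟩
  -- With `𝔽` frozen at `xs`, the solution minimizes the convex cost `⟨𝔽(xs), ·⟩ + ∑ g_i` over the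
  -- feasible set, so ordinary multipliers apply.
  obtain ⟨l, hl, hlc, hlm⟩ := exists_multiplier (hlin.add hG.convexOn_gSum)
    (c := fun x r => G.coupling x r - G.bTot r) hG.convexOn_coupling hx₀
    (fun r => by linarith [hsl r]) hfeas.1 (fun r => by linarith [hfeas.2 r])
    (fun x hx hc => by
      have h1 := hvi x ⟨hx, fun r => by linarith [hc r]⟩
      rw [inner_sub_right] at h1
      simp only [Pi.add_apply]
      linarith)
  set lv : Vec m := WithLp.toLp 2 l
  set lam : Dual N m := WithLp.toLp 2 fun _ => lv
  obtain ⟨i₀⟩ := hΓ.nonempty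
  have hN : (N : ℝ) ≠ 0 := by
    have := i₀.pos
    positivity
  -- The residual `A xs - b` shared equally among the agents. Its difference from the local
  -- residuals has zero sum, so some `z` realizes it as `Lz`; every agent then sees the same
  -- nonpositive residual.
  set e : Vec m := WithLp.toLp 2 fun r => (N : ℝ)⁻¹ * (G.coupling xs r - G.bTot r)
  have hsum : ∑ i, ((WithLp.toLp 2 fun _ => e : Dual N m) - (G.localMap xs - G.bStack)) i = 0 := by
    ext r
    have h1 : (∑ i, ((WithLp.toLp 2 fun _ => e : Dual N m) - (G.localMap xs - G.bStack)) i) r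
        = ∑ _i : Fin N, e r - ∑ i, (G.localMap xs - G.bStack) i r := by
      rw [← Finset.sum_sub_distrib]
      simp
    rw [h1, sum_localMap_sub_bStack]
    simp [e, hN]
  obtain ⟨z, hz⟩ := hW.exists_lapMap_eq hΓ hsum
  refine ⟨triple xs z lam, ?_, fun y hy => ?_, ?_, fun i r => hl r, fun μ hμ => ?_⟩
  · exact hfeas.1
  · have h1 := hlm y hy
    simp only [Pi.add_apply] at h1
    have h2 : inner ℝ (G.localMapT lam) (y - xs) = ∑ r, l r * (G.coupling y r - G.bTot r) := by
      have h3 : inner ℝ (G.localMapT lam) (y - xs)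
          = inner ℝ lam (G.localMap y - G.bStack) - inner ℝ lam (G.localMap xs - G.bStack) := by
        rw [real_inner_comm, ← G.inner_localMap, real_inner_comm, ← inner_sub_right, map_sub]
        congr 1; abel
      rw [h3, inner_const_localMap_sub, inner_const_localMap_sub]
      change _ - ∑ r, l r * (G.coupling xs r - G.bTot r) = _
      rw [hlc, sub_zero]
    have h4 : primal (-G.smoothPart W (triple xs z lam)) = -G.pseudograd xs := rfl
    rw [h4, primal_triple, dual_triple, inner_sub_left, inner_neg_left, h2, inner_sub_right]
    linarith
  · rw [map_neg, dual_triple]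
    change -(0 : Dual N m) = _
    rw [lapMap_const, neg_zero]
  · have h1 : dual (-G.smoothPart W (triple xs z lam)) = -(lapMap m W lam + G.bStack) := rfl
    rw [h1, lapMap_const, primal_triple, auxil_triple, dual_triple, hz]
    have h2 : -(0 + G.bStack) + G.localMap xs
        + ((WithLp.toLp 2 fun _ => e : Dual N m) - (G.localMap xs - G.bStack))
        = (WithLp.toLp 2 fun _ => e : Dual N m) := by abel
    rw [h2, inner_sub_right]
    have h3 : inner ℝ (WithLp.toLp 2 fun _ => e : Dual N m) lam = 0 := by
      rw [Profile.inner_eq_sum, Finset.sum_congr rfl fun i _ => ?_, Finset.sum_const_zero]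
      have : ∀ c, e c * l c = (N : ℝ)⁻¹ * (l c * (G.coupling xs c - G.bTot c)) := fun c => by
        simp only [e]; ring
      change ∑ c, e c * l c = 0
      simp only [this]
      rw [← Finset.mul_sum, hlc, mul_zero]
    rw [h3, sub_zero, Profile.inner_eq_sum]
    refine Finset.sum_nonpos fun i _ => Finset.sum_nonpos fun r _ => ?_
    refine mul_nonpos_of_nonpos_of_nonneg ?_ (hμ i r)
    exact mul_nonpos_of_nonneg_of_nonpos (by positivity) (by linarith [hfeas.2 r])

/-- The strategies of a zero lie in `SOL`, exactly where cocoercivity of `𝔽` is assumed. The `λ`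
block contributes cocoercivity of the Laplacian, and `θ` is below both constants. -/
theorem smoothPart_cocoercive (hG : G.Standing) (hW : IsWeightedAdj Γ W) (hΓ : Γ.Connected)
    {β θ : ℝ} (hcoco : G.RestrictedCocoercive β) (hθ : 0 ≤ θ) (hθβ : θ ≤ β)
    (hθd : ∀ i, θ * (2 * deg W i) ≤ 1) {u w : PrimalDual n m} (hu : primal u ∈ G.domAll)
    (hw : G.MonotonePart W w (-G.smoothPart W w)) :
    θ * ‖G.smoothPart W u - G.smoothPart W w‖ ^ 2
      ≤ inner ℝ (G.smoothPart W u - G.smoothPart W w) (u - w) := by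
  have h1 := hcoco _ hu _ (hw.primal_mem_sol hG hW hΓ)
  have h2 := hW.lapMap_cocoercive hθ hθd (dual u - dual w)
  have e1 : G.smoothPart W u - G.smoothPart W w = triple
      (G.pseudograd (primal u) - G.pseudograd (primal w)) 0 (lapMap m W (dual u - dual w)) := by
    rw [sub_eq_iff_eq_add, smoothPart, smoothPart, triple_add, map_sub]
    congr 1 <;> abel
  rw [e1, ← real_inner_self_eq_norm_sq, inner_primalDual, inner_primalDual]
  simp only [primal_triple, auxil_triple, dual_triple, map_sub, inner_zero_left, add_zero,
    real_inner_self_eq_norm_sq] at h1 h2 ⊢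
  nlinarith [mul_le_mul_of_nonneg_right hθβ
    (sq_nonneg ‖G.pseudograd (primal u) - G.pseudograd (primal w)‖)]

/-- The state of the algorithm as a triple. -/
def toTriple (w : State n m) : PrimalDual n m :=
  triple w.x (WithLp.toLp 2 w.z) (WithLp.toLp 2 w.lam)

theorem step_mem (hG : G.Standing) (W : Matrix (Fin N) (Fin N) ℝ) (s : Steps N)
    (Fh : Profile n) (w : State n m) : (G.step W s Fh w).x ∈ G.domAll := fun i => (hG.prox_spec i _ _).1

theorem inner_sub_projNonneg_le {p : ℕ} (v l : Vec p) (hl : ∀ r, 0 ≤ l r) :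
    inner ℝ (v - projNonneg v) (l - projNonneg v) ≤ 0 := by
  rw [PiLp.inner_apply]
  refine Finset.sum_nonpos fun r _ => ?_
  change (l r - max (v r) 0) * (v r - max (v r) 0) ≤ 0
  rcases le_total (v r) 0 with h | h
  · rw [max_eq_right h, sub_zero, sub_zero]
    exact mul_nonpos_of_nonneg_of_nonpos (hl r) h
  · rw [max_eq_left h, sub_self, mul_zero]

/-- One iteration as a preconditioned forward-backward step with a perturbed operator. -/
theorem step_monotonePart (hG : G.Standing) {s : Steps N} (hα : ∀ i, 0 < s.α i)
    (hν : ∀ i, 0 < s.ν i) (hσ : ∀ i, 0 < s.σ i) (Fh : Profile n) (w : State n m) :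
    G.MonotonePart W (toTriple (G.step W s Fh w))
      (G.precondMap W s (toTriple w - toTriple (G.step W s Fh w)) - G.smoothPart W (toTriple w)
        - triple (Fh - G.pseudograd w.x) 0 0) := by
  set w' := G.step W s Fh w
  set x' := w'.x
  set z' : Dual N m := WithLp.toLp 2 w'.z
  set l' : Dual N m := WithLp.toLp 2 w'.lam
  set z : Dual N m := WithLp.toLp 2 w.z
  set l : Dual N m := WithLp.toLp 2 w.lam
  have hx' : ∀ i, x' i = prox (s.α i) (G.g i)
      (w.x i - s.α i • (Fh i + G.localMapT l i)) := fun i => rfl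
  have hz' : ∀ i, z' i = z i - s.ν i • lapMap m W l i := fun i => rfl
  have hl' : ∀ i, l' i = projNonneg (l i
      + s.σ i • (act (G.A i) ((2 : ℝ) • x' i - w.x i) - G.b i)
      + s.σ i • ∑ j, W i j • ((2 : ℝ) • (z' i - z' j) - (z i - z j))
      - s.σ i • lapMap m W l i) := fun i => rfl
  have hmap : G.precondMap W s (toTriple w - toTriple w') = triple
      (scaleMap (fun i => (s.α i)⁻¹) (w.x - x') - G.localMapT (l - l'))
      (scaleMap (fun i => (s.ν i)⁻¹) (z - z') - lapMap m W (l - l'))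
      (scaleMap (fun i => (s.σ i)⁻¹) (l - l') - G.localMap (w.x - x') - lapMap m W (z - z')) := rfl
  rw [hmap]
  refine ⟨step_mem hG W s Fh w, fun y hy => ?_, ?_, fun i r => le_max_right _ _, fun μ hμ => ?_⟩
  -- The block `-𝐀ᵀ` of `Φ` trades the new multiplier for the old one: `-𝐀ᵀ(λ - λ') - 𝐀ᵀλ' = -𝐀ᵀλ`.
  -- This makes the prox step explicit.
  · have h1 : primal (triple
        (scaleMap (fun i => (s.α i)⁻¹) (w.x - x') - G.localMapT (l - l'))
        (scaleMap (fun i => (s.ν i)⁻¹) (z - z') - lapMap m W (l - l'))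
        (scaleMap (fun i => (s.σ i)⁻¹) (l - l') - G.localMap (w.x - x') - lapMap m W (z - z'))
        - G.smoothPart W (toTriple w) - triple (Fh - G.pseudograd w.x) 0 0)
        - G.localMapT (dual (toTriple w'))
        = scaleMap (fun i => (s.α i)⁻¹) (w.x - x') - G.localMapT l - Fh := by
      change scaleMap (fun i => (s.α i)⁻¹) (w.x - x') - G.localMapT (l - l')
        - G.pseudograd w.x - (Fh - G.pseudograd w.x) - G.localMapT l' = _
      rw [map_sub G.localMapT]
      abel
    rw [h1]
    change ∑ i, G.gReal i (x' i) + inner ℝ _ (y - x') ≤ ∑ i, G.gReal i (y i)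
    rw [PiLp.inner_apply, ← Finset.sum_add_distrib]
    refine Finset.sum_le_sum fun i _ => ?_
    have h2 := hG.prox_inequality i (hα i) (w.x i - s.α i • (Fh i + G.localMapT l i)) (hy i)
    rw [← hx' i] at h2
    refine le_trans (le_of_eq ?_) h2
    congr 1
    rw [div_eq_inv_mul, ← real_inner_smul_left]
    congr 1
    change (s.α i)⁻¹ • (w.x i - x' i) - G.localMapT l i - Fh i = _
    rw [smul_sub, smul_sub, smul_sub, smul_smul, inv_mul_cancel₀ (hα i).ne', one_smul]
    abel
  · change scaleMap (fun i => (s.ν i)⁻¹) (z - z') - lapMap m W (l - l') - 0 - 0 = lapMap m W l'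
    rw [map_sub (lapMap m W)]
    have h1 : scaleMap (fun i => (s.ν i)⁻¹) (z - z') = lapMap m W l := by
      refine PiLp.ext fun i => ?_
      rw [scaleMap_apply, PiLp.sub_apply, hz', sub_sub_cancel, smul_smul,
        inv_mul_cancel₀ (hν i).ne', one_smul]
    rw [h1]
    abel
  -- Here the off-diagonal blocks produce the extrapolations: `-A(x - x') + Ax' = A(2x' - x)`, and
  -- likewise for `Lz`.
  · change inner ℝ (scaleMap (fun i => (s.σ i)⁻¹) (l - l') - G.localMap (w.x - x')
      - lapMap m W (z - z') - (lapMap m W l + G.bStack) - 0 + G.localMap x' + lapMap m W z')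
      (μ - l') ≤ 0
    rw [PiLp.inner_apply]
    refine Finset.sum_nonpos fun i _ => ?_
    have h1 := inner_sub_projNonneg_le (l i
      + s.σ i • (act (G.A i) ((2 : ℝ) • x' i - w.x i) - G.b i)
      + s.σ i • ∑ j, W i j • ((2 : ℝ) • (z' i - z' j) - (z i - z j))
      - s.σ i • lapMap m W l i) (μ i) (hμ i)
    rw [← hl'] at h1
    have h2 := mul_nonpos_of_nonneg_of_nonpos (inv_nonneg.2 (hσ i).le) h1
    rw [← real_inner_smul_left] at h2
    refine le_trans (le_of_eq ?_) h2
    congr 1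
    have h3 : act (G.A i) ((2 : ℝ) • x' i - w.x i)
        = (2 : ℝ) • G.localMap x' i - G.localMap w.x i := by
      change G.localMap ((2 : ℝ) • x' - w.x) i = _
      rw [map_sub, map_smul]
      rfl
    have h4 : ∑ j, W i j • ((2 : ℝ) • (z' i - z' j) - (z i - z j))
        = (2 : ℝ) • lapMap m W z' i - lapMap m W z i := by
      rw [lapMap_apply, lapMap_apply, Finset.smul_sum, ← Finset.sum_sub_distrib]
      exact Finset.sum_congr rfl fun j _ => by module
    rw [h3, h4, map_sub G.localMap, map_sub (lapMap m W)]
    change (s.σ i)⁻¹ • (l i - l' i) - (G.localMap w.x i - G.localMap x' i)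
      - (lapMap m W z i - lapMap m W z' i) - (lapMap m W l i + G.b i) - 0 + G.localMap x' i
      + lapMap m W z' i = _
    have h5 := (hσ i).ne'
    simp only [smul_sub, smul_add, smul_smul, inv_mul_cancel₀ h5, ← mul_assoc, one_smul, one_mul]
    module

end Game

end Optimality

/-! ### Sampled gradients: measurability, integrability, equilibria -/

section SampledGradients

variable {N m d : ℕ} {n : Fin N → ℕ} {G : Game N m d n}

theorem Profile.upd_self (x : Profile n) (i : Fin N) : x.upd i (x i) = x := by
  refine PiLp.ext fun j => ?_
  simp [Profile.upd]

theorem Profile.upd_same (x : Profile n) (i : Fin N) (y : Vec (n i)) : x.upd i y i = y := by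
  simp [Profile.upd]

theorem Profile.upd_of_ne (x : Profile n) {i j : Fin N} (y : Vec (n i)) (h : j ≠ i) :
    x.upd i y j = x j := by
  simp [Profile.upd, h]

theorem Profile.continuous_upd (i : Fin N) :
    Continuous fun p : Profile n × Vec (n i) => p.1.upd i p.2 := by
  refine (PiLp.continuous_toLp 2 _).comp ?_
  exact ((PiLp.continuous_ofLp 2 _).comp continuous_fst).update i continuous_snd

theorem Profile.inner_upd_sub (u x : Profile n) (i : Fin N) (y : Vec (n i)) :
    inner ℝ u (x.upd i y - x) = inner ℝ (u i) (y - x i) := by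
  rw [PiLp.inner_apply, Finset.sum_eq_single i]
  · rw [PiLp.sub_apply, upd_same]
  · intro j _ hj
    rw [PiLp.sub_apply, upd_of_ne x y hj, sub_self, inner_zero_right]
  · simp

theorem tendsto_norm_natCast_add_one : Tendsto (fun k : ℕ => ‖(k : ℝ) + 1‖) atTop atTop :=
  tendsto_norm_atTop_atTop.comp (tendsto_natCast_atTop_atTop.atTop_add tendsto_const_nhds)

namespace Game

namespace Standing

theorem hasFDerivAt_partialGrad (hG : G.Standing) (i : Fin N) {x : Profile n} (hx : x ∈ G.domAll)
    (ξ : Vec d) : HasFDerivAt (fun y => G.f i (x.upd i y) ξ)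
      (innerSL ℝ (G.partialGrad i x ξ)) (x i) := by
  obtain ⟨U, hUo, -, hdU, hU⟩ := hG.f_regular i
  obtain ⟨ell, -, hell⟩ := hU x hx
  have h1 : DifferentiableAt ℝ (fun y => G.f i (x.upd i y) ξ) (x i) :=
    ((hell ξ).2.1.contDiffAt (hUo.mem_nhds (hdU (hx i)))).differentiableAt one_ne_zero
  exact h1.hasGradientAt.hasFDerivAt

/-- The neighbourhood `U` is open, so the Lipschitz constant bounds the gradient even at boundary
points of `Ω_i`. -/
theorem exists_integrable_bound (hG : G.Standing) (i : Fin N) {x : Profile n}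
    (hx : x ∈ G.domAll) : ∃ ell : Vec d → ℝ, Integrable ell G.law ∧
      ∀ ξ, ‖G.partialGrad i x ξ‖ ≤ ell ξ := by
  obtain ⟨U, hUo, -, hdU, hU⟩ := hG.f_regular i
  obtain ⟨ell, hi, hell⟩ := hU x hx
  refine ⟨fun ξ => ell ξ, hi, fun ξ => ?_⟩
  have h1 := norm_fderiv_le_of_lipschitzOn ℝ (hUo.mem_nhds (hdU (hx i))) (hell ξ).2.2
  rwa [(hG.hasFDerivAt_partialGrad i hx ξ).fderiv, innerSL_apply_norm] at h1

/-- The convexity inequality for the sampled costs. -/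
theorem partialGrad_inequality (hG : G.Standing) (i : Fin N) {x : Profile n} (hx : x ∈ G.domAll)
    (ξ : Vec d) {y : Vec (n i)} (hy : y ∈ G.dom i) :
    inner ℝ (G.partialGrad i x ξ) (y - x i) ≤ G.f i (x.upd i y) ξ - G.f i x ξ := by
  -- Convexity bounds each difference quotient with step `1/(k+1)` by the full increment; the
  -- quotients converge to the derivative.
  have hlim := (hG.hasFDerivAt_partialGrad i hx ξ).lim (y - x i) tendsto_norm_natCast_add_one
  obtain ⟨U, -, -, hdU, hU⟩ := hG.f_regular i
  obtain ⟨ell, -, hell⟩ := hU x hx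
  refine le_of_tendsto' hlim fun k => ?_
  have hk : (0 : ℝ) < (k : ℝ) + 1 := by positivity
  have hk1 : ((k : ℝ) + 1)⁻¹ ≤ 1 := inv_le_one_of_one_le₀ (by linarith [k.cast_nonneg (α := ℝ)])
  have h1 := (hell ξ).1.2 (hdU (hx i)) (hdU hy) (sub_nonneg.2 hk1) (inv_nonneg.2 hk.le)
    (sub_add_cancel 1 ((k : ℝ) + 1)⁻¹)
  have h2 : (1 - ((k : ℝ) + 1)⁻¹) • x i + ((k : ℝ) + 1)⁻¹ • y
      = x i + ((k : ℝ) + 1)⁻¹ • (y - x i) := by module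
  rw [h2] at h1
  simp only [Profile.upd_self, smul_eq_mul] at h1 ⊢
  have h3 := mul_le_mul_of_nonneg_left h1 hk.le
  have h4 : ((k : ℝ) + 1) * ((1 - ((k : ℝ) + 1)⁻¹) * G.f i x ξ
      + ((k : ℝ) + 1)⁻¹ * G.f i (x.upd i y) ξ)
      = k * G.f i x ξ + G.f i (x.upd i y) ξ := by field_simp; ring
  rw [h4] at h3
  linarith

end Standing

/-- The sampled partial gradient, set to zero outside `Ω`. -/
def gradOn (G : Game N m d n) (i : Fin N) (p : Profile n × Vec d) : Vec (n i) :=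
  (G.domAll ×ˢ (Set.univ : Set (Vec d))).indicator (fun p => G.partialGrad i p.1 p.2) p

theorem gradOn_of_mem (i : Fin N) {x : Profile n} (hx : x ∈ G.domAll) (ξ : Vec d) :
    G.gradOn i (x, ξ) = G.partialGrad i x ξ :=
  Set.indicator_of_mem (s := G.domAll ×ˢ (Set.univ : Set (Vec d))) (a := (x, ξ))
    ⟨hx, Set.mem_univ _⟩ fun p => G.partialGrad i p.1 p.2

theorem gradOn_of_notMem (i : Fin N) {x : Profile n} (hx : x ∉ G.domAll) (ξ : Vec d) :
    G.gradOn i (x, ξ) = 0 :=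
  Set.indicator_of_notMem (s := G.domAll ×ˢ (Set.univ : Set (Vec d))) (a := (x, ξ))
    (fun h => hx h.1) fun p => G.partialGrad i p.1 p.2

namespace Standing

theorem measurableSet_domAll (hG : G.Standing) : MeasurableSet G.domAll :=
  hG.isCompact_domAll.isClosed.measurableSet

/-- Each coordinate is a pointwise limit of difference quotients of the jointly measurable `f`. The
indicator confines the limit to `Ω`, where differentiability is known. -/
theorem measurable_gradOn (hG : G.Standing) (i : Fin N) : Measurable (G.gradOn i) := by
  have hcoord : ∀ c, Measurable fun p => G.gradOn i p c := by
    intro c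
    set e : Vec (n i) := EuclideanSpace.single c 1
    refine measurable_of_tendsto_metrizable (f := fun (k : ℕ) (p : Profile n × Vec d) =>
      (G.domAll ×ˢ (Set.univ : Set (Vec d))).indicator (fun p => ((k : ℝ) + 1) •
        (G.f i (p.1.upd i (p.1 i + ((k : ℝ) + 1)⁻¹ • e)) p.2
          - G.f i p.1 p.2)) p) (fun k => ?_) ?_
    · refine Measurable.indicator ?_ (hG.measurableSet_domAll.prod MeasurableSet.univ)
      have hf : Measurable fun p : Profile n × Vec d => G.f i p.1 p.2 := hG.f_measurable i
      have hu : Measurable fun p : Profile n × Vec d =>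
          (p.1.upd i (p.1 i + ((k : ℝ) + 1)⁻¹ • e), p.2) := by
        refine Measurable.prodMk ?_ measurable_snd
        exact (Profile.continuous_upd i).measurable.comp
          (measurable_fst.prodMk (by fun_prop))
      exact ((hf.comp hu).sub hf).const_mul ((k : ℝ) + 1)
    · rw [tendsto_pi_nhds]
      rintro ⟨x, ξ⟩
      by_cases hx : x ∈ G.domAll
      · have hlim := (hG.hasFDerivAt_partialGrad i hx ξ).lim e tendsto_norm_natCast_add_one
        simp only [Set.indicator, Set.mem_prod, hx, Set.mem_univ, and_self, if_true,
          G.gradOn_of_mem i hx]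
        simp only [Profile.upd_self] at hlim
        convert hlim using 2
        simp [e, EuclideanSpace.inner_single_right]
      · simp only [Set.indicator, Set.mem_prod, hx, false_and, if_false,
          G.gradOn_of_notMem i hx]
        exact tendsto_const_nhds
  exact (PiLp.continuous_toLp 2 fun _ : Fin (n i) => ℝ).measurable.comp
    (measurable_pi_lambda (fun p c => G.gradOn i p c) hcoord)

theorem measurable_partialGrad (hG : G.Standing) (i : Fin N) {x : Profile n}
    (hx : x ∈ G.domAll) : Measurable (G.partialGrad i x) := by
  have h1 : Measurable fun ξ => G.gradOn i (x, ξ) :=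
    (hG.measurable_gradOn i).comp measurable_prodMk_left
  simpa only [G.gradOn_of_mem i hx] using h1

theorem integrable_partialGrad (hG : G.Standing) (i : Fin N) {x : Profile n}
    (hx : x ∈ G.domAll) : Integrable (G.partialGrad i x) G.law := by
  obtain ⟨ell, hi, hb⟩ := hG.exists_integrable_bound i hx
  exact hi.mono' (hG.measurable_partialGrad i hx).aestronglyMeasurable (Eventually.of_forall hb)

/-- Solutions of the variational inequality are equilibria. -/
theorem isVSGNE_of_mem_sol (hG : G.Standing) {xs : Profile n} (hxs : xs ∈ G.sol) :
    G.IsVSGNE xs := by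
  obtain ⟨hfeas, hvi⟩ := hG.mem_sol_iff.1 hxs
  refine ⟨hxs, hfeas, fun i y hy => ?_⟩
  have hmem : xs.upd i y ∈ G.domAll := fun j => by
    by_cases hj : j = i
    · subst hj; rw [Profile.upd_same]; exact hy.1
    · rw [Profile.upd_of_ne xs y hj]; exact hfeas.1 j
  have hcoup : ∀ r, G.coupling (xs.upd i y) r ≤ G.bTot r := by
    intro r
    have h1 : G.coupling (xs.upd i y) r
        = act (G.A i) y r + ∑ j ∈ Finset.univ.erase i, act (G.A j) (xs j) r := by
      rw [coupling, ← Finset.add_sum_erase _ _ (Finset.mem_univ i), Profile.upd_same,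
        PiLp.add_apply, Finset.sum_congr rfl fun j hj => by
          rw [Profile.upd_of_ne xs y (Finset.ne_of_mem_erase hj)]]
      simp
    rw [h1]
    linarith [hy.2 r]
  have h1 := hvi _ ⟨hmem, hcoup⟩
  rw [Profile.inner_upd_sub] at h1
  have h2 : G.gSum (xs.upd i y) - G.gSum xs = G.gReal i y - G.gReal i (xs i) := by
    rw [gSum, gSum, ← Finset.sum_sub_distrib, Finset.sum_eq_single i]
    · rw [Profile.upd_same]
    · intro j _ hj
      rw [Profile.upd_of_ne xs y hj, sub_self]
    · simp
  have hint := hG.integrable_partialGrad i hfeas.1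
  have h3 : inner ℝ (G.pseudograd xs i) (y - xs i)
      = ∫ ξ, inner ℝ (y - xs i) (G.partialGrad i xs ξ) ∂G.law := by
    rw [integral_inner hint, real_inner_comm]
    rfl
  have hfi := hG.f_integrable i
  -- Integrating the gradient inequality turns the first-order condition for a unilateral deviation
  -- into a comparison of expected costs.
  have h4 : ∫ ξ, inner ℝ (y - xs i) (G.partialGrad i xs ξ) ∂G.law
      ≤ ∫ ξ, (G.f i (xs.upd i y) ξ - G.f i xs ξ) ∂G.law := by
    refine integral_mono (hint.const_inner _) ((hfi _ ⟨hmem, hcoup⟩).sub (hfi _ hfeas))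
      fun ξ => ?_
    simp only
    rw [real_inner_comm]
    exact hG.partialGrad_inequality i hfeas.1 ξ hy.1
  rw [integral_sub (hfi _ ⟨hmem, hcoup⟩) (hfi _ hfeas)] at h4
  rw [cost, cost, Profile.upd_same, ← hG.coe_gReal hy.1, ← hG.coe_gReal (hfeas.1 i)]
  have h5 : (∫ ξ, G.f i xs ξ ∂G.law) + G.gReal i (xs i)
      ≤ (∫ ξ, G.f i (xs.upd i y) ξ ∂G.law) + G.gReal i y := by linarith
  exact_mod_cast h5

end Standing

end Game

end SampledGradients

/-! ### Variance of batch errors -/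

section BatchNoise

variable {Ω : Type*} [MeasurableSpace Ω] {μ : Measure Ω} [IsProbabilityMeasure μ]

/-- The first term is independent of the sum of the others, so square integrability of the whole
passes to it. The moment condition concerns only averages; this extracts single samples. -/
theorem memLp_two_of_iIndepFun_sum {X : ℕ → Ω → ℝ} (hX : ∀ t, Measurable (X t))
    (hi : iIndepFun X μ) {S : ℕ} (hS : S ≠ 0)
    (h : MemLp (fun ω => ∑ t ∈ Finset.range S, X t ω) 2 μ) : MemLp (X 0) 2 μ := by
  obtain ⟨r, rfl⟩ := Nat.exists_eq_succ_of_ne_zero hS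
  set Y : Ω → ℝ := ∑ t ∈ (Finset.range (r + 1)).erase 0, X t
  have hY : Measurable Y := by
    have hYe : Y = fun ω => ∑ t ∈ (Finset.range (r + 1)).erase 0, X t ω := by ext ω; simp [Y]
    rw [hYe]
    exact Finset.measurable_fun_sum _ fun t _ => hX t
  refine memLp_two_of_indepFun_add (hX 0) hY
    (hi.indepFun_finsetSum_of_notMem hX (Finset.notMem_erase 0 _)).symm ?_
  convert h using 2 with ω
  rw [← Finset.add_sum_erase _ (fun t => X t ω) (Finset.mem_range.2 r.succ_pos)]
  simp [Y]

theorem integral_sq_sum_of_iIndepFun {X : ℕ → Ω → ℝ} (hi : iIndepFun X μ)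
    (hL : ∀ t, MemLp (X t) 2 μ) (h0 : ∀ t, ∫ ω, X t ω ∂μ = 0) (S : ℕ) :
    ∫ ω, (∑ t ∈ Finset.range S, X t ω) ^ 2 ∂μ = ∑ t ∈ Finset.range S, ∫ ω, X t ω ^ 2 ∂μ := by
  have h1 := IndepFun.variance_sum (s := Finset.range S) (fun t _ => hL t)
    fun a _ b _ hab => hi.indepFun hab
  have hint : ∀ t, Integrable (X t) μ := fun t => (hL t).integrable one_le_two
  rw [variance_of_integral_eq_zero] at h1
  · rw [Finset.sum_congr rfl fun t _ =>
      variance_of_integral_eq_zero (hL t).aestronglyMeasurable.aemeasurable (h0 t)] at h1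
    simpa using h1
  · exact Finset.aemeasurable_sum _ fun t _ => (hL t).aestronglyMeasurable.aemeasurable
  · simp only [Finset.sum_apply]
    rw [integral_finsetSum _ fun t _ => hint t]
    simp [h0]

variable {N m d : ℕ} {n : Fin N → ℕ} {G : Game N m d n}

namespace Game

variable (G) in
/-- Coordinate `c` of the error of a sampled gradient of agent `i`; zero outside `Ω`. -/
def gradError (i : Fin N) (c : Fin (n i)) (p : Profile n × Vec d) : ℝ :=
  G.gradOn i p c - ∫ ξ, G.gradOn i (p.1, ξ) c ∂G.law

variable (G) in
/-- Coordinate `c` of the error of the average of `S` sampled gradients of agent `i`. -/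
def batchError (S : ℕ) (i : Fin N) (c : Fin (n i))
    (p : Profile n × (ℕ → Fin N → Vec d)) : ℝ :=
  (S : ℝ)⁻¹ * ∑ t ∈ Finset.range S, G.gradError i c (p.1, p.2 t i)

namespace Standing

theorem measurable_gradError (hG : G.Standing) (i : Fin N) (c : Fin (n i)) :
    Measurable (G.gradError i c) := by
  have := hG.prob
  have h1 : Measurable fun p : Profile n × Vec d => G.gradOn i p c :=
    (EuclideanSpace.proj (𝕜 := ℝ) c).continuous.measurable.comp (hG.measurable_gradOn i)
  have h2 : Measurable fun x : Profile n => ∫ ξ, G.gradOn i (x, ξ) c ∂G.law :=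
    (h1.stronglyMeasurable.integral_prod_right' (ν := G.law)).measurable
  exact h1.sub (h2.comp measurable_fst)

theorem measurable_batchError (hG : G.Standing) (S : ℕ) (i : Fin N) (c : Fin (n i)) :
    Measurable (G.batchError S i c) := by
  refine Measurable.const_mul (Finset.measurable_fun_sum _ fun t _ => ?_) _
  refine (hG.measurable_gradError i c).comp (measurable_fst.prodMk ?_)
  exact (measurable_pi_apply i).comp ((measurable_pi_apply t).comp measurable_snd)

theorem integrable_gradOn_apply (hG : G.Standing) (i : Fin N) (c : Fin (n i)) (x : Profile n) :
    Integrable (fun ξ => G.gradOn i (x, ξ) c) G.law := by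
  by_cases hx : x ∈ G.domAll
  · simp only [G.gradOn_of_mem i hx]
    exact (EuclideanSpace.proj (𝕜 := ℝ) c).integrable_comp (hG.integrable_partialGrad i hx)
  · simp [G.gradOn_of_notMem i hx]

theorem integrable_gradError (hG : G.Standing) (i : Fin N) (c : Fin (n i)) (x : Profile n) :
    Integrable (fun ξ => G.gradError i c (x, ξ)) G.law := by
  have := hG.prob
  exact (hG.integrable_gradOn_apply i c x).sub
    (integrable_const (∫ ξ, G.gradOn i (x, ξ) c ∂G.law))

theorem integral_gradError (hG : G.Standing) (i : Fin N) (c : Fin (n i)) (x : Profile n) :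
    ∫ ξ, G.gradError i c (x, ξ) ∂G.law = 0 := by
  have := hG.prob
  simp only [gradError]
  rw [integral_sub (hG.integrable_gradOn_apply i c x) (integrable_const _)]
  simp

theorem saa_sub_pseudograd_apply (hG : G.Standing) {S : ℕ} (hS : S ≠ 0)
    (ζ : ℕ → Fin N → Vec d) {x : Profile n} (hx : x ∈ G.domAll) (i : Fin N) (c : Fin (n i)) :
    (G.saa S ζ x - G.pseudograd x) i c = G.batchError S i c (x, ζ) := by
  have hS' : (S : ℝ) ≠ 0 := Nat.cast_ne_zero.2 hS
  have h1 : G.pseudograd x i c = ∫ ξ, G.gradOn i (x, ξ) c ∂G.law := by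
    simp only [G.gradOn_of_mem i hx]
    exact ((EuclideanSpace.proj (𝕜 := ℝ) c).integral_comp_comm
      (hG.integrable_partialGrad i hx)).symm
  have h2 : G.saa S ζ x i c
      = (S : ℝ)⁻¹ * ∑ t ∈ Finset.range S, G.gradOn i (x, ζ t i) c := by
    simp [saa, G.gradOn_of_mem i hx]
  rw [PiLp.sub_apply, PiLp.sub_apply, h1, h2, batchError]
  simp only [gradError]
  rw [Finset.sum_sub_distrib, Finset.sum_const, Finset.card_range, nsmul_eq_mul, mul_sub,
    inv_mul_cancel_left₀ hS']

theorem gradError_of_notMem (i : Fin N) (c : Fin (n i)) {x : Profile n} (hx : x ∉ G.domAll)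
    (ξ : Vec d) : G.gradError i c (x, ξ) = 0 := by
  simp [gradError, G.gradOn_of_notMem i hx]

section Samples

variable {η : ℕ → Fin N → Ω → Vec d} (hηm : ∀ t i, Measurable (η t i))
  (hηlaw : ∀ t i, μ.map (η t i) = G.law)

include hηm hηlaw

omit [IsProbabilityMeasure μ] in
theorem memLp_gradError_comp_iff (hG : G.Standing) (t : ℕ) (i : Fin N) (c : Fin (n i))
    (x : Profile n) : MemLp (fun ω => G.gradError i c (x, η t i ω)) 2 μ
      ↔ MemLp (fun ξ => G.gradError i c (x, ξ)) 2 G.law := by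
  rw [← hηlaw t i, memLp_map_measure_iff _ (hηm t i).aemeasurable]
  · rfl
  · exact ((hG.measurable_gradError i c).comp measurable_prodMk_left).aestronglyMeasurable

omit [IsProbabilityMeasure μ] in
theorem integral_gradError_comp (hG : G.Standing) (t : ℕ) (i : Fin N) (c : Fin (n i))
    (x : Profile n) : ∫ ω, G.gradError i c (x, η t i ω) ∂μ = 0 := by
  rw [← hG.integral_gradError i c x, ← hηlaw t i, integral_map (hηm t i).aemeasurable]
  exact ((hG.measurable_gradError i c).comp measurable_prodMk_left).aestronglyMeasurable

omit [IsProbabilityMeasure μ] in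
theorem integral_gradError_sq_comp (hG : G.Standing) (t : ℕ) (i : Fin N) (c : Fin (n i))
    (x : Profile n) : ∫ ω, G.gradError i c (x, η t i ω) ^ 2 ∂μ
      = ∫ ξ, G.gradError i c (x, ξ) ^ 2 ∂G.law := by
  rw [← hηlaw t i, integral_map (hηm t i).aemeasurable]
  exact (((hG.measurable_gradError i c).comp measurable_prodMk_left).pow_const
    2).aestronglyMeasurable

variable (hηind : iIndepFun (fun t ω i => η t i ω) μ)

include hηind

omit [IsProbabilityMeasure μ] hηm hηlaw in
theorem iIndepFun_gradError_comp (hG : G.Standing) (i : Fin N) (c : Fin (n i))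
    (x : Profile n) : iIndepFun (fun t ω => G.gradError i c (x, η t i ω)) μ :=
  hηind.comp (fun _ v => G.gradError i c (x, v i)) fun _ =>
    (hG.measurable_gradError i c).comp (measurable_const.prodMk (measurable_pi_apply i))

/-- The second moment of the error of an average is inversely proportional to the batch size. -/
theorem integral_batchError_sq (hG : G.Standing) {S : ℕ} (hS : S ≠ 0) (i : Fin N) (c : Fin (n i))
    {x : Profile n} (hL : MemLp (fun ξ => G.gradError i c (x, ξ)) 2 G.law) :
    ∫ ω, G.batchError S i c (x, fun t i => η t i ω) ^ 2 ∂μ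
      = (∫ ξ, G.gradError i c (x, ξ) ^ 2 ∂G.law) / S := by
  have hS' : (S : ℝ) ≠ 0 := Nat.cast_ne_zero.2 hS
  simp only [batchError, mul_pow]
  rw [integral_const_mul, integral_sq_sum_of_iIndepFun
    (hG.iIndepFun_gradError_comp hηind i c x)
    (fun t => (hG.memLp_gradError_comp_iff hηm hηlaw t i c x).2 hL)
    fun t => hG.integral_gradError_comp hηm hηlaw t i c x]
  simp only [hG.integral_gradError_sq_comp hηm hηlaw]
  rw [Finset.sum_const, Finset.card_range, nsmul_eq_mul]
  field_simp

/-- A moment bound on averages bounds the variance of single samples. -/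
theorem integral_gradError_sq_le (hG : G.Standing) {S : ℕ} (hS : S ≠ 0) {p : ℝ} (hp : 2 ≤ p)
    {B : ℝ} (hB : 0 ≤ B) {x : Profile n} (hx : x ∈ G.domAll)
    (h : eLpNorm (fun ω => G.saa S (fun t i => η t i ω) x - G.pseudograd x)
      (ENNReal.ofReal p) μ ≤ ENNReal.ofReal B) (i : Fin N) (c : Fin (n i)) :
    MemLp (fun ξ => G.gradError i c (x, ξ)) 2 G.law ∧
      ∫ ξ, G.gradError i c (x, ξ) ^ 2 ∂G.law ≤ S * B ^ 2 := by
  have hS' : (S : ℝ) ≠ 0 := Nat.cast_ne_zero.2 hS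
  set φ : Ω → ℝ := fun ω => G.batchError S i c (x, fun t i => η t i ω)
  have hφm : Measurable φ := (hG.measurable_batchError S i c).comp
    (measurable_const.prodMk (measurable_pi_lambda _ fun t => measurable_pi_lambda _ fun i =>
      hηm t i))
  -- On a probability space the `L²` norm is below the `L^p` norm for `p ≥ 2`, and a coordinate is
  -- below the norm of the profile.
  have h1 : eLpNorm φ 2 μ ≤ ENNReal.ofReal B := by
    refine le_trans ?_ h
    have h2 : (2 : ENNReal) ≤ ENNReal.ofReal p := by
      rw [← ENNReal.ofReal_ofNat 2]
      exact ENNReal.ofReal_le_ofReal hp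
    refine (eLpNorm_le_eLpNorm_of_exponent_le h2 hφm.aestronglyMeasurable).trans ?_
    refine eLpNorm_mono fun ω => ?_
    simp only [φ]
    rw [← hG.saa_sub_pseudograd_apply hS _ hx]
    exact (PiLp.norm_apply_le _ c).trans (PiLp.norm_apply_le _ i)
  have hφL : MemLp φ 2 μ := ⟨hφm.aestronglyMeasurable, h1.trans_lt ENNReal.ofReal_lt_top⟩
  have hsq : ∫ ω, φ ω ^ 2 ∂μ ≤ B ^ 2 := by
    rw [hφL.eLpNorm_eq_integral_rpow_norm two_ne_zero ENNReal.ofNat_ne_top] at h1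
    have h2 : ∫ ω, ‖φ ω‖ ^ (ENNReal.toReal 2) ∂μ = ∫ ω, φ ω ^ 2 ∂μ := by
      congr 1; ext ω; simp
    have h3 : (ENNReal.toReal 2)⁻¹ = 1 / 2 := by norm_num
    rw [h2, h3, ← Real.sqrt_eq_rpow, ENNReal.ofReal_le_ofReal_iff hB] at h1
    exact (Real.sqrt_le_left hB).1 h1
  have hsumL : MemLp (fun ω => ∑ t ∈ Finset.range S, G.gradError i c (x, η t i ω)) 2 μ := by
    convert hφL.const_mul (S : ℝ) using 2 with ω
    simp only [φ, batchError]
    rw [mul_inv_cancel_left₀ hS']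
  have hL := (hG.memLp_gradError_comp_iff hηm hηlaw 0 i c x).1
    (memLp_two_of_iIndepFun_sum (X := fun t ω => G.gradError i c (x, η t i ω))
      (fun t => (hG.measurable_gradError i c).comp (measurable_const.prodMk (hηm t i)))
      (hG.iIndepFun_gradError_comp hηind i c x) hS hsumL)
  refine ⟨hL, ?_⟩
  have h4 := hG.integral_batchError_sq hηm hηlaw hηind hS i c hL
  have h5 : (∫ ξ, G.gradError i c (x, ξ) ^ 2 ∂G.law) / S ≤ B ^ 2 := h4 ▸ hsq
  have hSpos : (0 : ℝ) < S := Nat.cast_pos.2 (Nat.pos_of_ne_zero hS)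
  rw [div_le_iff₀ hSpos] at h5
  linarith

end Samples

end Standing

end Game

end BatchNoise

/-! ### Measurability of the iterates -/

section Iterates

variable {N m d : ℕ} {n : Fin N → ℕ} {G : Game N m d n}

theorem continuous_act {p q : ℕ} (M : Matrix (Fin p) (Fin q) ℝ) : Continuous (act M) :=
  (PiLp.continuous_toLp 2 _).comp
    (Continuous.matrix_mulVec continuous_const (PiLp.continuous_ofLp 2 _))

theorem continuous_projNonneg {p : ℕ} : Continuous (projNonneg : Vec p → Vec p) :=
  (PiLp.continuous_toLp 2 _).comp (continuous_pi fun r =>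
    ((EuclideanSpace.proj (𝕜 := ℝ) r).continuous).max continuous_const)

theorem Profile.measurable_of_apply {α : Type*} [MeasurableSpace α] {x : α → Profile n}
    (h : ∀ i, Measurable fun ω => x ω i) : Measurable x :=
  (PiLp.continuous_toLp 2 fun i => Vec (n i)).measurable.comp
    (measurable_pi_lambda (fun ω i => x ω i) h)

theorem Profile.measurable_apply {α : Type*} [MeasurableSpace α] {x : α → Profile n}
    (h : Measurable x) (i : Fin N) : Measurable fun ω => x ω i :=
  (PiLp.continuous_apply 2 (fun i => Vec (n i)) i).measurable.comp h

namespace Game.Standing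

theorem measurable_step {α : Type*} [MeasurableSpace α] (hG : G.Standing)
    (W : Matrix (Fin N) (Fin N) ℝ) {s : Steps N} (hα : ∀ i, 0 < s.α i) {F : α → Profile n}
    (hF : Measurable F) {w : α → State n m} (hx : Measurable fun ω => (w ω).x)
    (hz : Measurable fun ω => (w ω).z) (hl : Measurable fun ω => (w ω).lam) :
    (Measurable fun ω => (G.step W s (F ω) (w ω)).x) ∧
      (Measurable fun ω => (G.step W s (F ω) (w ω)).z) ∧
      Measurable fun ω => (G.step W s (F ω) (w ω)).lam := by
  have hxi := Profile.measurable_apply hx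
  have hzi : ∀ i, Measurable fun ω => (w ω).z i := fun i => (measurable_pi_apply i).comp hz
  have hli : ∀ i, Measurable fun ω => (w ω).lam i := fun i => (measurable_pi_apply i).comp hl
  have hact : ∀ {p q : ℕ} (M : Matrix (Fin p) (Fin q) ℝ) {f : α → Vec q}, Measurable f →
      Measurable fun ω => act M (f ω) := fun M _ hf => (continuous_act M).measurable.comp hf
  have hx' : Measurable fun ω => (G.step W s (F ω) (w ω)).x :=
    Profile.measurable_of_apply fun i => (hG.continuous_prox i (hα i)).measurable.comp
      ((hxi i).sub (((Profile.measurable_apply hF i).add (hact _ (hli i))).const_smul (s.α i)))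
  have hz' : Measurable fun ω => (G.step W s (F ω) (w ω)).z :=
    measurable_pi_lambda _ fun i => (hzi i).sub ((Finset.measurable_fun_sum _ fun j _ =>
      ((hli i).sub (hli j)).const_smul (W i j)).const_smul (s.ν i))
  have hxi' := Profile.measurable_apply hx'
  have hzi' : ∀ i, Measurable fun ω => (G.step W s (F ω) (w ω)).z i := fun i =>
    (measurable_pi_apply i).comp hz'
  refine ⟨hx', hz', measurable_pi_lambda _ fun i => continuous_projNonneg.measurable.comp ?_⟩
  refine (((hli i).add (((hact _ (((hxi' i).const_smul (2 : ℝ)).sub (hxi i))).sub_const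
    (G.b i)).const_smul (s.σ i))).add ((Finset.measurable_fun_sum _ fun j _ =>
      ((((hzi' i).sub (hzi' j)).const_smul (2 : ℝ)).sub ((hzi i).sub (hzi j))).const_smul
        (W i j)).const_smul (s.σ i))).sub ((Finset.measurable_fun_sum _ fun j _ =>
      ((hli i).sub (hli j)).const_smul (W i j)).const_smul (s.σ i))

theorem measurable_saa {α : Type*} [MeasurableSpace α] (hG : G.Standing) (S : ℕ)
    {ζ : α → ℕ → Fin N → Vec d} (hζ : Measurable ζ) {x : α → Profile n} (hx : Measurable x)
    (hxd : ∀ ω, x ω ∈ G.domAll) : Measurable fun ω => G.saa S (ζ ω) (x ω) := by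
  refine Profile.measurable_of_apply fun i => ?_
  have h1 : ∀ t, Measurable fun ω => G.gradOn i (x ω, ζ ω t i) := fun t =>
    (hG.measurable_gradOn i).comp (hx.prodMk
      ((measurable_pi_apply i).comp ((measurable_pi_apply t).comp hζ)))
  have h2 : ∀ ω, G.saa S (ζ ω) (x ω) i
      = (S : ℝ)⁻¹ • ∑ t ∈ Finset.range S, G.gradOn i (x ω, ζ ω t i) := fun ω => by
    simp [saa, G.gradOn_of_mem i (hxd ω)]
  simp_rw [h2]
  exact (Finset.measurable_fun_sum _ fun t _ => h1 t).const_smul (S : ℝ)⁻¹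

theorem iter_mem (hG : G.Standing) (W : Matrix (Fin N) (Fin N) ℝ) (s : Steps N) (S : ℕ → ℕ)
    (ζ : ℕ → ℕ → Fin N → Vec d) {w₀ : State n m} (h₀ : w₀.x ∈ G.domAll) (k : ℕ) :
    (G.iter W s S ζ w₀ k).x ∈ G.domAll := by
  cases k with
  | zero => exact h₀
  | succ k => exact step_mem hG W s _ _

/-- Step `k` consumes batch `k`, so iterate `k` depends only on the initial point and on the batches
before `k`. -/
theorem measurable_iter {α : Type*} (hG : G.Standing) (W : Matrix (Fin N) (Fin N) ℝ)
    {s : Steps N} (hα : ∀ i, 0 < s.α i) (S : ℕ → ℕ) {ζ : α → ℕ → ℕ → Fin N → Vec d}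
    {w₀ : α → State n m} (h₀ : ∀ ω, (w₀ ω).x ∈ G.domAll) {ℱ : ℕ → MeasurableSpace α}
    (hmono : Monotone ℱ) (hζ : ∀ k, Measurable[ℱ (k + 1)] fun ω => ζ ω k)
    (hx : Measurable[ℱ 0] fun ω => (w₀ ω).x) (hz : Measurable[ℱ 0] fun ω => (w₀ ω).z)
    (hl : Measurable[ℱ 0] fun ω => (w₀ ω).lam) (k : ℕ) :
    (Measurable[ℱ k] fun ω => (G.iter W s S (ζ ω) (w₀ ω) k).x) ∧
      (Measurable[ℱ k] fun ω => (G.iter W s S (ζ ω) (w₀ ω) k).z) ∧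
      Measurable[ℱ k] fun ω => (G.iter W s S (ζ ω) (w₀ ω) k).lam := by
  induction k with
  | zero => exact ⟨hx, hz, hl⟩
  | succ k ih =>
    obtain ⟨h1, h2, h3⟩ := ih
    have hle := hmono k.le_succ
    have hF := @measurable_saa _ _ _ _ _ _ (ℱ (k + 1)) hG (S k) _ (hζ k) _ (h1.mono hle le_rfl)
      fun ω => hG.iter_mem W s S (ζ ω) (h₀ ω) k
    exact @measurable_step _ _ _ _ _ _ (ℱ (k + 1)) hG W _ hα _ hF _ (h1.mono hle le_rfl)
      (h2.mono hle le_rfl) (h3.mono hle le_rfl)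

end Game.Standing

end Iterates

/-! ### The filtration of past batches -/

section History

variable {Ω I V : Type*} [mΩ : MeasurableSpace Ω] [MeasurableSpace I] [MeasurableSpace V]
  {μ : Measure Ω}

/-- Information carried by an initial value and by the variables of the first `k` batches. -/
def history {X : Ω → I} (hX : Measurable X) {Y : ℕ × ℕ → Ω → V} (hY : ∀ p, Measurable (Y p)) :
    Filtration ℕ mΩ where
  seq k := MeasurableSpace.comap X inferInstance ⊔
    ⨆ p ∈ {p : ℕ × ℕ | p.1 < k}, MeasurableSpace.comap (Y p) inferInstance
  mono' j k h := by
    refine sup_le le_sup_left (le_sup_of_le_right (iSup₂_le fun p hp => ?_))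
    exact le_biSup (fun p => MeasurableSpace.comap (Y p) inferInstance)
      (show p ∈ {p : ℕ × ℕ | p.1 < k} from lt_of_lt_of_le hp h)
  le' _ := sup_le hX.comap_le (iSup₂_le fun p _ => (hY p).comap_le)

variable {X : Ω → I} (hX : Measurable X) {Y : ℕ × ℕ → Ω → V} (hY : ∀ p, Measurable (Y p))

theorem measurable_history_init (k : ℕ) : Measurable[history hX hY k] X :=
  measurable_iff_comap_le.2 le_sup_left

theorem measurable_history_batch (k : ℕ) :
    Measurable[history hX hY (k + 1)] fun ω t => Y (k, t) ω := by
  refine @measurable_pi_lambda _ _ _ (history hX hY (k + 1)) _ _ fun t =>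
    measurable_iff_comap_le.2 (le_sup_of_le_right ?_)
  exact le_biSup (fun p => MeasurableSpace.comap (Y p) inferInstance)
    (show (k, t) ∈ {p : ℕ × ℕ | p.1 < k + 1} from k.lt_succ_self)

/-- The batch of index `k` is independent of the preceding ones and of the initial value. -/
theorem indep_history_batch (hi : iIndepFun Y μ) (hXY : IndepFun X (fun ω p => Y p ω) μ)
    (k : ℕ) : Indep (history hX hY k)
      (MeasurableSpace.comap (fun ω t => Y (k, t) ω) inferInstance) μ := by
  set M : Option (ℕ × ℕ) → MeasurableSpace Ω := fun o =>
    o.elim (MeasurableSpace.comap X inferInstance)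
      (fun i => MeasurableSpace.comap (Y i) inferInstance) with hM
  have hle : ∀ o, M o ≤ mΩ := by
    rintro (_ | p)
    exacts [hX.comap_le, (hY p).comap_le]
  -- With the initial value indexed by `none`, past and present batches have disjoint index sets in
  -- one independent family.
  have hdisj : Disjoint ({none} ∪ some '' {p : ℕ × ℕ | p.1 < k})
      (some '' {p : ℕ × ℕ | p.1 = k}) := by
    rw [Set.disjoint_left]
    rintro o (rfl | ⟨p, hp, rfl⟩) ⟨q, hq, hqe⟩
    · cases hqe
    · cases hqe
      exact absurd hq (ne_of_lt hp)
  have hMi : iIndep M μ := iIndep_option hi hXY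
  clear_value M
  refine indep_of_indep_of_le (indep_iSup_of_disjoint hle hMi hdisj) ?_ ?_
  · have h1 : MeasurableSpace.comap X inferInstance = M none := by rw [hM]; rfl
    have h2 : ∀ p, MeasurableSpace.comap (Y p) inferInstance = M (some p) := by rw [hM]; simp
    change MeasurableSpace.comap X inferInstance ⊔
      ⨆ p ∈ {p : ℕ × ℕ | p.1 < k}, MeasurableSpace.comap (Y p) inferInstance ≤ _
    rw [h1]
    simp_rw [h2]
    exact sup_le (le_biSup M (Or.inl rfl))
      (iSup₂_le fun p hp => le_biSup M (Or.inr ⟨p, hp, rfl⟩))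
  · refine measurable_iff_comap_le.1 (@measurable_pi_lambda _ _ _ (_) _ _ fun t =>
      measurable_iff_comap_le.2 ?_)
    have h2 : MeasurableSpace.comap (Y (k, t)) inferInstance = M (some (k, t)) := by rw [hM]; rfl
    change MeasurableSpace.comap (Y (k, t)) inferInstance ≤ _
    rw [h2]
    exact le_biSup M ⟨(k, t), rfl, rfl⟩

end History

/-! ### Almost sure convergence of the error series -/

section Noise

variable {Ω : Type*} [mΩ : MeasurableSpace Ω] {μ : Measure Ω} [IsProbabilityMeasure μ]
  {N m d : ℕ} {n : Fin N → ℕ} {G : Game N m d n}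

namespace Game.Standing

/-- Under the variance reduction condition the sampled gradients have uniformly bounded
variances. -/
theorem exists_variance_bound (hG : G.Standing) {S : ℕ → ℕ} (hS : S 0 ≠ 0)
    {ξ : ℕ → ℕ → Fin N → Ω → Vec d} (hξm : ∀ k t i, Measurable (ξ k t i))
    (hξlaw : ∀ k t i, μ.map (ξ k t i) = G.law)
    (hξind : iIndepFun (fun (p : ℕ × ℕ) (ω : Ω) (i : Fin N) => ξ p.1 p.2 i ω) μ)
    (hvar : G.VarianceReduction μ S ξ) :
    ∃ V : ℝ, 0 ≤ V ∧ ∀ (x : Profile n) (i : Fin N) (c : Fin (n i)),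
      MemLp (fun η => G.gradError i c (x, η)) 2 G.law ∧
        ∫ η, G.gradError i c (x, η) ^ 2 ∂G.law ≤ V := by
  obtain ⟨p, hp, σ₁, hσ₁, σ, -, -, h⟩ := hvar
  obtain ⟨xs, hxs⟩ := hG.exists_mem_sol
  obtain ⟨R, hR⟩ := hG.isCompact_domAll.isBounded.exists_norm_le
  -- One solution and batch zero suffice: `Ω` is bounded, and the law of a sampled gradient does not
  -- depend on the iteration. The factor `S 0` lost in passing to single samples is a constant.
  set B : ℝ := |σ ⟨xs, hxs⟩| + σ₁ * (R + ‖xs‖)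
  refine ⟨S 0 * |B| ^ 2, by positivity, fun x i c => ?_⟩
  by_cases hx : x ∈ G.domAll
  · have hind : iIndepFun (fun t ω i => ξ 0 t i ω) μ :=
      hξind.precomp (g := fun t : ℕ => ((0 : ℕ), t)) fun a b hab => (Prod.mk.inj hab).2
    refine hG.integral_gradError_sq_le (fun t i => hξm 0 t i) (fun t i => hξlaw 0 t i) hind hS hp
      (abs_nonneg B) hx ((h 0 x hx ⟨xs, hxs⟩).trans (ENNReal.ofReal_le_ofReal ?_)) i c
    refine le_trans (add_le_add (le_abs_self _) (mul_le_mul_of_nonneg_left ?_ hσ₁))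
      (le_abs_self B)
    exact (norm_sub_le _ _).trans (by linarith [hR x hx])
  · simp only [gradError_of_notMem i c hx]
    refine ⟨MemLp.zero, ?_⟩
    simp only [ne_eq, OfNat.ofNat_ne_zero, not_false_eq_true, zero_pow, integral_zero]
    positivity

section Batch

variable {η : ℕ → Fin N → Ω → Vec d} (hηm : ∀ t i, Measurable (η t i))
  (hηlaw : ∀ t i, μ.map (η t i) = G.law)

include hηm hηlaw

omit [IsProbabilityMeasure μ] in
theorem integral_batchError_map (hG : G.Standing) (S : ℕ) (i : Fin N) (c : Fin (n i))
    (x : Profile n) : ∫ y, G.batchError S i c (x, y) ∂(μ.map fun ω t i => η t i ω) = 0 := by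
  have hm : Measurable fun ω t i => η t i ω :=
    measurable_pi_lambda _ fun t => measurable_pi_lambda _ fun i => hηm t i
  have hφ : Measurable fun y => G.batchError S i c (x, y) :=
    (hG.measurable_batchError S i c).comp measurable_prodMk_left
  rw [integral_map hm.aemeasurable hφ.aestronglyMeasurable]
  simp only [batchError]
  have hint : ∀ t, Integrable (fun ω => G.gradError i c (x, η t i ω)) μ := fun t => by
    have h := hG.integrable_gradError i c x
    rw [← hηlaw t i] at h
    exact h.comp_measurable (hηm t i)
  rw [integral_const_mul, integral_finsetSum _ fun t _ => hint t]
  simp [hG.integral_gradError_comp hηm hηlaw]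

theorem lintegral_batchError_map_le (hG : G.Standing) {S : ℕ} (hS : S ≠ 0)
    (hηind : iIndepFun (fun t ω i => η t i ω) μ) {V : ℝ} (i : Fin N) (c : Fin (n i))
    (x : Profile n) (hL : MemLp (fun η => G.gradError i c (x, η)) 2 G.law)
    (hV : ∫ η, G.gradError i c (x, η) ^ 2 ∂G.law ≤ V) :
    ∫⁻ y, ‖G.batchError S i c (x, y)‖ₑ ^ 2 ∂(μ.map fun ω t i => η t i ω)
      ≤ ENNReal.ofReal (V / S) := by
  have hm : Measurable fun ω t i => η t i ω :=
    measurable_pi_lambda _ fun t => measurable_pi_lambda _ fun i => hηm t i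
  have hφ : Measurable fun y => G.batchError S i c (x, y) :=
    (hG.measurable_batchError S i c).comp measurable_prodMk_left
  rw [lintegral_map (hφ.enorm.pow_const 2) hm]
  have hLb : MemLp (fun ω => G.batchError S i c (x, fun t i => η t i ω)) 2 μ := by
    simp only [batchError]
    exact (memLp_finsetSum (Finset.range S)
      (f := fun t ω => G.gradError i c (x, η t i ω)) fun t _ =>
        (hG.memLp_gradError_comp_iff hηm hηlaw t i c x).2 hL).const_mul (S : ℝ)⁻¹
  rw [← ofReal_integral_sq hLb, hG.integral_batchError_sq hηm hηlaw hηind hS i c hL]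
  exact ENNReal.ofReal_le_ofReal (by gcongr)

end Batch

/-- Weighted by bounded predictable multipliers, the errors of the sampled gradients along an
adapted sequence are square summable and form a convergent series. -/
theorem ae_tendsto_sum_batchError (hG : G.Standing) {S : ℕ → ℕ} (hS : ∀ k, S k ≠ 0)
    (hSsum : Summable fun k => (S k : ℝ)⁻¹) {I : Type*} [MeasurableSpace I] {X₀ : Ω → I}
    (hX₀ : Measurable X₀)
    {ξ : ℕ → ℕ → Fin N → Ω → Vec d} (hξm : ∀ k t i, Measurable (ξ k t i))
    (hξlaw : ∀ k t i, μ.map (ξ k t i) = G.law)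
    (hξind : iIndepFun (fun (p : ℕ × ℕ) (ω : Ω) (i : Fin N) => ξ p.1 p.2 i ω) μ)
    (hvar : G.VarianceReduction μ S ξ)
    (hYm : ∀ p : ℕ × ℕ, Measurable fun ω i => ξ p.1 p.2 i ω)
    (hind₀ : IndepFun X₀ (fun (ω : Ω) (p : ℕ × ℕ) (i : Fin N) => ξ p.1 p.2 i ω) μ)
    {x : ℕ → Ω → Profile n} (hx : ∀ k, Measurable[history hX₀ hYm k] (x k))
    {u : ℕ → Ω → ℝ} (hu : ∀ k, Measurable[history hX₀ hYm k] (u k)) {R : ℝ}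
    (hR : ∀ k ω, |u k ω| ≤ R) (i : Fin N) (c : Fin (n i)) :
    (∀ᵐ ω ∂μ, Summable fun k =>
      (u k ω * G.batchError (S k) i c (x k ω, fun t i => ξ k t i ω)) ^ 2) ∧
    ∀ᵐ ω ∂μ, ∃ l, Tendsto (fun K => ∑ k ∈ Finset.range K,
      u k ω * G.batchError (S k) i c (x k ω, fun t i => ξ k t i ω)) atTop (𝓝 l) := by
  obtain ⟨V, hV0, hV⟩ := hG.exists_variance_bound (hS 0) hξm hξlaw hξind hvar
  set ℱ := history hX₀ hYm
  set Y : ℕ → Ω → ℕ → Fin N → Vec d := fun k ω t i => ξ k t i ω with hYdef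
  have hYmeas : ∀ k, Measurable (Y k) := fun k =>
    measurable_pi_lambda _ fun t => measurable_pi_lambda _ fun i => hξm k t i
  have hYind : ∀ k, iIndepFun (fun t ω i => ξ k t i ω) μ := fun k =>
    hξind.precomp (g := fun t : ℕ => (k, t)) fun a b hab => (Prod.mk.inj hab).2
  have hindep : ∀ k, Indep (ℱ k) (MeasurableSpace.comap (Y k) inferInstance) μ := fun k =>
    indep_history_batch hX₀ hYm hξind hind₀ k
  have hxm : ∀ k, Measurable (x k) := fun k => (hx k).mono (ℱ.le k) le_rfl
  have hum : ∀ k, Measurable (u k) := fun k => (hu k).mono (ℱ.le k) le_rfl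
  set φ : ℕ → Ω → ℝ := fun k ω => G.batchError (S k) i c (x k ω, Y k ω) with hφdef
  have hφm : ∀ k, Measurable (φ k) := fun k =>
    (hG.measurable_batchError (S k) i c).comp ((hxm k).prodMk (hYmeas k))
  -- The iterate is independent of batch `k`, so it can be frozen; the variance bound is uniform in
  -- the frozen point.
  have hφl : ∀ k, ∫⁻ ω, ‖φ k ω‖ₑ ^ 2 ∂μ ≤ ENNReal.ofReal (V / S k) := fun k =>
    lintegral_comp_le_of_indepFun (hxm k) (hYmeas k)
      (indep_of_indep_of_le_left (hindep k) (measurable_iff_comap_le.1 (hx k)))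
      (φ := fun p => ‖G.batchError (S k) i c p‖ₑ ^ 2)
      ((hG.measurable_batchError (S k) i c).enorm.pow_const 2) fun a =>
        hG.lintegral_batchError_map_le (hξm k) (hξlaw k) (hS k) (hYind k) i c a
          (hV a i c).1 (hV a i c).2
  have hφL : ∀ k, MemLp (φ k) 2 μ := fun k =>
    memLp_two_of_lintegral_le (hφm k).aestronglyMeasurable ENNReal.ofReal_ne_top (hφl k)
  have hφsq : ∀ k, ∫ ω, φ k ω ^ 2 ∂μ ≤ V / S k := fun k => by
    have h1 := hφl k
    rw [← ofReal_integral_sq (hφL k)] at h1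
    exact (ENNReal.ofReal_le_ofReal_iff (by positivity)).1 h1
  set D : ℕ → Ω → ℝ := fun k ω => u k ω * φ k ω with hDdef
  have hDL : ∀ k, MemLp (D k) 2 μ := fun k => by
    refine MemLp.of_le_mul (c := R) (hφL k) ((hum k).mul (hφm k)).aestronglyMeasurable
      (Eventually.of_forall fun ω => ?_)
    rw [Real.norm_eq_abs, abs_mul, Real.norm_eq_abs]
    exact mul_le_mul_of_nonneg_right (hR k ω) (abs_nonneg _)
  have hDm : ∀ k, Measurable[ℱ (k + 1)] (D k) := fun k => by
    refine @Measurable.fun_mul _ _ _ _ (ℱ (k + 1)) _ _ _ ((hu k).mono (ℱ.mono k.le_succ) le_rfl) ?_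
    exact (hG.measurable_batchError (S k) i c).comp
      (@Measurable.prodMk _ (ℱ (k + 1)) _ _ _ _ _ _ ((hx k).mono (ℱ.mono k.le_succ) le_rfl)
        (measurable_history_batch hX₀ hYm k))
  -- Both `Z` and the weight `u k` belong to the past, so their product is an admissible multiplier
  -- of the centred batch error.
  have horth : ∀ k (Z : Ω → ℝ), Measurable[ℱ k] Z → MemLp Z 2 μ → ∫ ω, Z ω * D k ω ∂μ = 0 := by
    intro k Z hZ hZL
    have hZu : Measurable[ℱ k] fun ω => Z ω * u k ω := 
      @Measurable.fun_mul _ _ _ _ (ℱ k) _ _ _ hZ (hu k)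
    have hint : Integrable (fun ω => Z ω * D k ω) μ := hZL.integrable_mul (hDL k)
    have he : ∀ ω, Z ω * D k ω = Z ω * u k ω * φ k ω := fun ω => (mul_assoc _ _ _).symm
    simp_rw [he] at hint ⊢
    refine integral_mul_eq_zero_of_indepFun (hxm k) (hZu.mono (ℱ.le k) le_rfl) (hYmeas k)
      (indep_of_indep_of_le_left (hindep k) (measurable_iff_comap_le.1
        (@Measurable.prodMk _ (ℱ k) _ _ _ _ _ _ (hx k) hZu)))
      (hG.measurable_batchError (S k) i c)
      (fun a => hG.integral_batchError_map (hξm k) (hξlaw k) (S k) i c a) hint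
  have hDsum : Summable fun k => ∫ ω, D k ω ^ 2 ∂μ := by
    refine Summable.of_nonneg_of_le (fun k => integral_nonneg fun ω => sq_nonneg _) (fun k => ?_)
      (hSsum.mul_left (R ^ 2 * V))
    calc ∫ ω, D k ω ^ 2 ∂μ ≤ ∫ ω, R ^ 2 * φ k ω ^ 2 ∂μ := by
          refine integral_mono (hDL k).integrable_sq ((hφL k).integrable_sq.const_mul _) fun ω => ?_
          simp only [hDdef, mul_pow]
          refine mul_le_mul_of_nonneg_right ?_ (sq_nonneg _)
          exact sq_le_sq' (by linarith [abs_le.1 (hR k ω)]) (abs_le.1 (hR k ω)).2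
      _ = R ^ 2 * ∫ ω, φ k ω ^ 2 ∂μ := integral_const_mul _ _
      _ ≤ R ^ 2 * (V / S k) := mul_le_mul_of_nonneg_left (hφsq k) (sq_nonneg _)
      _ = R ^ 2 * V * (S k : ℝ)⁻¹ := by rw [div_eq_mul_inv, mul_assoc]
  exact ⟨ae_summable_sq hDL hDsum, ae_tendsto_sum_of_orthogonal hDm hDL horth hDsum⟩

end Game.Standing

end Noise

/-! ### Pathwise convergence -/

section Convergence

variable {N m d : ℕ} {n : Fin N → ℕ} {G : Game N m d n} {Γ : SimpleGraph (Fin N)}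
  {W : Matrix (Fin N) (Fin N) ℝ}

theorem Profile.norm_sq_eq_sum (x : Profile n) : ‖x‖ ^ 2 = ∑ i, ∑ c, x i c ^ 2 := by
  rw [← real_inner_self_eq_norm_sq, Profile.inner_eq_sum]
  simp only [sq]

theorem inner_triple_zero (x : Profile n) (u : PrimalDual n m) :
    inner ℝ (triple x 0 0) u = inner ℝ x (primal u) := by
  rw [inner_primalDual]
  simp

theorem Profile.exists_tendsto_of_apply {v : ℕ → Profile n}
    (h : ∀ i c, ∃ l, Tendsto (fun k => v k i c) atTop (𝓝 l)) : ∃ l, Tendsto v atTop (𝓝 l) := by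
  choose l hl using h
  refine ⟨WithLp.toLp 2 fun i => WithLp.toLp 2 (l i), ?_⟩
  refine ((PiLp.continuous_toLp 2 _).tendsto _).comp (tendsto_pi_nhds.2 fun i => ?_)
  exact ((PiLp.continuous_toLp 2 _).tendsto (l i)).comp (tendsto_pi_nhds.2 fun c => hl i c)

/-- Pathwise convergence: perturbations of the pseudogradient that are square summable and, alone
and paired with the iterates, form convergent series do not destroy convergence. -/
theorem Game.Standing.exists_tendsto_of_perturbation (hG : G.Standing) (hΓ : Γ.Connected)
    (hW : IsWeightedAdj Γ W) {β : ℝ} (hcoco : G.RestrictedCocoercive β) {θ : ℝ} (hθ : 0 < θ)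
    (hθβ : θ ≤ β) (hθd : ∀ i, θ * (2 * deg W i) ≤ 1) {γ : ℝ} (hγ : 0 < γ) {s : Steps N}
    (hs : G.StepBounds W γ θ s) {w : ℕ → State n m} {Fh : ℕ → Profile n}
    (h₀ : (w 0).x ∈ G.domAll) (hw : ∀ k, w (k + 1) = G.step W s (Fh k) (w k))
    (hsq : ∀ i c, Summable fun k => ((Fh k - G.pseudograd (w k).x) i c) ^ 2)
    (hsum : ∀ i c, ∃ l, Tendsto (fun K => ∑ k ∈ Finset.range K,
      (Fh k - G.pseudograd (w k).x) i c) atTop (𝓝 l))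
    (hinner : ∀ i c, ∃ l, Tendsto (fun K => ∑ k ∈ Finset.range K,
      (w k).x i c * (Fh k - G.pseudograd (w k).x) i c) atTop (𝓝 l)) :
    ∃ xs, G.IsVSGNE xs ∧ Tendsto (fun k => (w k).x) atTop (𝓝 xs) := by
  set P := G.precondMap W s
  set τ₀ := ‖Matrix.toEuclideanCLM (𝕜 := ℝ) (G.precond W s)⁻¹‖
  have hP : ∀ v, ‖v‖ ^ 2 ≤ τ₀ * inner ℝ (P v) v := G.norm_sq_le_precondMap hW hγ hs
  -- The splitting theorem requires a positive constant. Replacing the norm by its maximum with `θ`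
  -- ensures this and stays below `2θ`.
  have hτ : ∀ v, ‖v‖ ^ 2 ≤ max τ₀ θ * inner ℝ (P v) v := fun v => by
    rcases le_or_gt 0 (inner ℝ (P v) v) with hn | hn
    · exact (hP v).trans (mul_le_mul_of_nonneg_right (le_max_left _ _) hn)
    · have h1 := hP v
      have h2 : τ₀ * inner ℝ (P v) v ≤ 0 := mul_nonpos_of_nonneg_of_nonpos (norm_nonneg _) hn.le
      have h3 : v = 0 := by
        have : ‖v‖ ^ 2 = 0 := le_antisymm (h1.trans h2) (sq_nonneg _)
        simpa using this
      rw [h3, map_zero, inner_zero_left] at hn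
      exact absurd hn (lt_irrefl _)
  have hwD : ∀ k, (w k).x ∈ G.domAll := fun k => by
    cases k with
    | zero => exact h₀
    | succ k => rw [hw]; exact G.step_mem hG W s _ _
  set ε : ℕ → Profile n := fun k => Fh k - G.pseudograd (w k).x
  set e : ℕ → PrimalDual n m := fun k => triple (ε k) 0 0
  have hes : ∃ l, Tendsto (fun K => ∑ k ∈ Finset.range K, e k) atTop (𝓝 l) := by
    obtain ⟨l, hl⟩ := Profile.exists_tendsto_of_apply
      (v := fun K => ∑ k ∈ Finset.range K, ε k) fun i c => by
        simpa only [WithLp.ofLp_sum, Finset.sum_apply] using hsum i c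
    refine ⟨triple l 0 0, ?_⟩
    have hc : Continuous fun x : Profile n => (triple x 0 0 : PrimalDual n m) :=
      continuousOn_univ.1 (continuous_triple continuousOn_id continuousOn_const
        continuousOn_const)
    refine ((hc.tendsto l).comp hl).congr fun K => ?_
    simp only [Function.comp_apply, e]
    induction K with
    | zero => rfl
    | succ K ih =>
      rw [Finset.sum_range_succ, Finset.sum_range_succ, ← ih, triple_add, add_zero]
  obtain ⟨u, hu, hlim⟩ := forwardBackward_tendsto (Φ := P) (G.precondMap_symm s hW)
    (τ := max τ₀ θ) (θ := θ) (lt_max_of_lt_right hθ) hθ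
    (max_lt hs.norm_inv (by linarith)) hτ
    (D := {u : PrimalDual n m | primal u ∈ G.domAll})
    (hG.isCompact_domAll.isClosed.preimage primal.continuous)
    (C := G.smoothPart W) (smoothPart_continuousOn hG) (B := G.MonotonePart W)
    (fun u v u' v' h h' => MonotonePart.monotone hW h h')
    (fun u v u' v' h h1 h2 => MonotonePart.of_tendsto hG h h1 h2)
    (fun u hu w hw => smoothPart_cocoercive hG hW hΓ hcoco hθ.le hθβ hθd hu hw)
    (exists_zero_of_mem_sol hG hW hΓ hG.exists_mem_sol.choose_spec)
    (u := fun k => toTriple (w k)) (e := e) (fun k => hwD k)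
    (fun k => by
      rw [hw]
      exact step_monotonePart hG hs.α_pos hs.ν_pos hs.σ_pos (Fh k) (w k))
    (by
      have h1 : ∀ k, ‖e k‖ ^ 2 = ∑ i, ∑ c, ε k i c ^ 2 := fun k => by
        rw [← real_inner_self_eq_norm_sq, inner_triple_zero, primal_triple,
          real_inner_self_eq_norm_sq, Profile.norm_sq_eq_sum]
      simp_rw [h1]
      exact summable_sum fun i _ => summable_sum fun c _ => hsq i c)
    hes
    (by
      choose l hl using hinner
      refine ⟨∑ i, ∑ c, l i c, (tendsto_finsetSum _ fun i _ => tendsto_finsetSum _ fun c _ =>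
        hl i c).congr fun K => ?_⟩
      have h1 : ∀ k, inner ℝ (e k) (toTriple (w k)) = ∑ i, ∑ c, (w k).x i c * ε k i c :=
        fun k => by
          rw [inner_triple_zero, Profile.inner_eq_sum]
          exact Finset.sum_congr rfl fun i _ => Finset.sum_congr rfl fun c _ => mul_comm _ _
      simp_rw [h1]
      rw [Finset.sum_comm]
      refine Finset.sum_congr rfl fun i _ => ?_
      rw [Finset.sum_comm])
  refine ⟨primal u, hG.isVSGNE_of_mem_sol (MonotonePart.primal_mem_sol hG hW hΓ hu), ?_⟩
  exact (primal.continuous.tendsto u).comp hlim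

theorem summable_inv_of_rpow_le {S : ℕ → ℕ} {c k₀ a : ℝ} (hc : 0 < c) (hk₀ : 0 < k₀)
    (ha : 0 < a) (hS : ∀ k : ℕ, c * ((k : ℝ) + k₀) ^ (a + 1) ≤ (S k : ℝ)) :
    Summable fun k => (S k : ℝ)⁻¹ := by
  have h1 : Summable fun k : ℕ => 1 / |(k : ℝ) + k₀| ^ (a + 1) :=
    (Real.summable_one_div_nat_add_rpow k₀ (a + 1)).2 (by linarith)
  refine Summable.of_nonneg_of_le (fun k => by positivity) (fun k => ?_) (h1.mul_left c⁻¹)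
  have hpos : 0 < (k : ℝ) + k₀ := by positivity
  rw [abs_of_pos hpos, one_div, ← mul_inv]
  exact inv_anti₀ (by positivity) (hS k)

end Convergence

end SGNE

end

/-! ### Main theorem -/

theorem theorem1 {N m d : ℕ} {n : Fin N → ℕ} (G : SGNE.Game N m d n) (hG : G.Standing)
    -- dual-variable graph
    (Γ : SimpleGraph (Fin N)) (hΓ : Γ.Connected)
    (W : Matrix (Fin N) (Fin N) ℝ) (hW : SGNE.IsWeightedAdj Γ W)
    -- restricted cocoercivity; the bound on `θ` reads `θ ≤ min {1 / (2 d*), β}`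
    (β : ℝ) (hβ : 0 < β) (hcoco : G.RestrictedCocoercive β)
    (θ : ℝ) (hθ : 0 < θ) (hθβ : θ ≤ β) (hθd : ∀ i, θ * (2 * SGNE.deg W i) ≤ 1)
    -- step sizes
    (γ : ℝ) (hγ : 0 < γ) (s : SGNE.Steps N) (hs : G.StepBounds W γ θ s)
    -- batch sizes
    (S : ℕ → ℕ) (c k₀ a : ℝ) (hc : 0 < c) (hk₀ : 0 < k₀) (ha : 0 < a)
    (hS : ∀ k : ℕ, c * ((k : ℝ) + k₀) ^ (a + 1) ≤ (S k : ℝ))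
    -- samples `ξ k t i` (iteration `k`, sample `t`, agent `i`): independent over `(k, t)`
    {Ξ : Type*} [MeasurableSpace Ξ] (μ : Measure Ξ) [IsProbabilityMeasure μ]
    (ξ : ℕ → ℕ → Fin N → Ξ → SGNE.Vec d)
    (hξm : ∀ k t i, Measurable (ξ k t i))
    (hξlaw : ∀ k t i, μ.map (ξ k t i) = G.law)
    (hξind : iIndepFun (fun (p : ℕ × ℕ) (ω : Ξ) (i : Fin N) => ξ p.1 p.2 i ω) μ)
    (hvar : G.VarianceReduction μ S ξ)
    -- initial point, possibly random, independent of the samples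
    (x₀ : Ξ → SGNE.Profile n) (z₀ lam₀ : Ξ → Fin N → SGNE.Vec m)
    (hx₀m : Measurable x₀) (hz₀m : Measurable z₀) (hlam₀m : Measurable lam₀)
    (hx₀ : ∀ ω, x₀ ω ∈ G.domAll) (hlam₀ : ∀ ω i r, 0 ≤ lam₀ ω i r)
    (hind₀ : IndepFun (fun ω => (x₀ ω, z₀ ω, lam₀ ω))
      (fun (ω : Ξ) (p : ℕ × ℕ) (i : Fin N) => ξ p.1 p.2 i ω) μ) :
    ∀ᵐ ω ∂μ, ∃ xs : SGNE.Profile n, G.IsVSGNE xs ∧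
      Tendsto (fun k => (G.iter W s S (fun k t i => ξ k t i ω) ⟨x₀ ω, z₀ ω, lam₀ ω⟩ k).x)
        atTop (𝓝 xs) := by
  have hSne : ∀ k, S k ≠ 0 := fun k h0 => by
    have h1 := hS k
    rw [h0, Nat.cast_zero] at h1
    have h2 : 0 < c * ((k : ℝ) + k₀) ^ (a + 1) := by positivity
    exact absurd h1 (not_le.2 h2)
  have hSsum := SGNE.summable_inv_of_rpow_le hc hk₀ ha hS
  have hX₀ : Measurable fun ω => (x₀ ω, z₀ ω, lam₀ ω) := hx₀m.prodMk (hz₀m.prodMk hlam₀m)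
  have hYm : ∀ p : ℕ × ℕ, Measurable fun ω i => ξ p.1 p.2 i ω := fun p =>
    measurable_pi_lambda _ fun i => hξm p.1 p.2 i
  set ℱ := SGNE.history hX₀ hYm
  have hinit : Measurable[ℱ 0] fun ω => (x₀ ω, z₀ ω, lam₀ ω) :=
    SGNE.measurable_history_init hX₀ hYm 0
  set w : Ξ → ℕ → SGNE.State n m := fun ω =>
    G.iter W s S (fun k t i => ξ k t i ω) ⟨x₀ ω, z₀ ω, lam₀ ω⟩
  have hwD : ∀ ω k, (w ω k).x ∈ G.domAll := fun ω k => hG.iter_mem W s S _ (hx₀ ω) k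
  have hxm : ∀ k, Measurable[ℱ k] fun ω => (w ω k).x := fun k =>
    (hG.measurable_iter W hs.α_pos S (ζ := fun ω k t i => ξ k t i ω)
      (w₀ := fun ω => ⟨x₀ ω, z₀ ω, lam₀ ω⟩) hx₀ (ℱ := ℱ) (fun _ _ h => ℱ.mono h)
      (SGNE.measurable_history_batch hX₀ hYm) (measurable_fst.comp hinit)
      (measurable_fst.comp (measurable_snd.comp hinit))
      (measurable_snd.comp (measurable_snd.comp hinit)) k).1
  have herr : ∀ ω k i c, (G.saa (S k) (fun t i => ξ k t i ω) (w ω k).x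
      - G.pseudograd (w ω k).x) i c = G.batchError (S k) i c ((w ω k).x, fun t i => ξ k t i ω) :=
    fun ω k i c => hG.saa_sub_pseudograd_apply (hSne k) _ (hwD ω k) i c
  obtain ⟨R, hR⟩ := hG.isCompact_domAll.isBounded.exists_norm_le
  -- Weight 1 gives the series of errors; the coordinates of the iterate, bounded because `Ω` is
  -- compact, give the series of errors paired with the iterate.
  have hone := fun i c => hG.ae_tendsto_sum_batchError hSne hSsum hX₀ hξm hξlaw hξind hvar hYm
    hind₀ hxm (u := fun _ _ => 1) (fun _ => measurable_const) (R := 1) (fun _ _ => by simp) i c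
  have hpair := fun i c => (hG.ae_tendsto_sum_batchError hSne hSsum hX₀ hξm hξlaw hξind hvar hYm
    hind₀ hxm (u := fun k ω => (w ω k).x i c)
    (fun k => (EuclideanSpace.proj (𝕜 := ℝ) c).continuous.measurable.comp
      (@SGNE.Profile.measurable_apply _ _ _ (ℱ k) _ (hxm k) i)) (R := R)
    (fun k ω => ((PiLp.norm_apply_le ((w ω k).x i) c).trans (PiLp.norm_apply_le _ i)).trans
      (hR _ (hwD ω k))) i c).2
  have h1 := ae_all_iff.2 fun i => ae_all_iff.2 fun c => (hone i c).1
  have h2 := ae_all_iff.2 fun i => ae_all_iff.2 fun c => (hone i c).2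
  have h3 := ae_all_iff.2 fun i => ae_all_iff.2 fun c => hpair i c
  -- The exceptional set is a finite union over coordinates and does not depend on the limiting
  -- solution; the rest is pathwise.
  filter_upwards [h1, h2, h3] with ω hω1 hω2 hω3
  simp only [one_mul, ← herr] at hω1 hω2 hω3
  exact hG.exists_tendsto_of_perturbation hΓ hW hcoco hθ hθβ hθd hγ hs (w := w ω)
    (Fh := fun k => G.saa (S k) (fun t i => ξ k t i ω) (w ω k).x) (hx₀ ω) (fun k => rfl)
    hω1 hω2 hω3
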